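/- **Setting.** Fix $\beta>0$. Let $\mathcal G$ be the set of right continuous nondecreasing functions $g:[0,1)\to[0,1]$, with the Borel $\sigma$-algebra of the $L^2([0,1],dx)$-distance (equivalently, the $\sigma$-algebra generated by the evaluations $g\mapsto g(t)$), and let $\mathbb Q^\beta$ be the law of the Dirichlet process on $\mathcal G$: for all $0=t_0<t_1<\dots<t_{n}<t_{n+1}=1$, $$\mathbb Q^\beta(g(t_1)\in dx_1,\dots,g(t_n)\in dx_n)=\frac{\Gamma(\beta)}{\prod_{i=1}^{n+1}\Gamma(\beta(t_i-t_{i-1}))}\prod_{i=1}^{n+1}(x_i-x_{i-1})^{\beta(t_i-t_{i-1})-1}\,dx_1\cdots dx_n$$ on $\{0=x_0\le x_1\le\dots\le x_n\le x_{n+1}=1\}$. Put $H=L^2(\mathcal G,\mathbb Q^\beta)$. *The limit form.* $\mathcal E$ is the closure in $H$ of $\mathcal E(u,u)=\int_{\mathcal G}\|\nabla u_{|g}\|^2_{L^2([0,1])}\,\mathbb Q^\beta(dg)$ on the functions $u(g)=U(\langle f_1,g\rangle_{L^2},\dots,\langle f_m,g\rangle_{L^2})$ with $m\in\mathbb N$,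 $U\in C^1_c(\mathbb R^m)$, $f_i\in L^2([0,1])$, where $\nabla u_{|g}=\sum_i\partial_iU(\langle f_1,g\rangle,\dots,\langle f_m,g\rangle)f_i$. *Markov uniqueness.* Let $\mathcal Z_0$ be the set of functions $u(g)=U(\int_0^1\varphi_1(g(t))dt,\dots,\int_0^1\varphi_m(g(t))dt)$ with $m\in\mathbb N$, $U\in C_c^\infty(\mathbb R^m)$, $\varphi_i\in C_c^\infty(\mathbb R)$ and $\varphi_i'(0)=\varphi_i'(1)=0$; these lie in the domain of the generator $L$ of $\mathcal E$. $\mathcal E$ is called Markov-unique if it is the only (symmetric, not necessarily regular) Dirichlet form on $H$ whose generator extends $L|_{\mathcal Z_0}$. *The approximating forms.* For $N\ge1$ let $\Sigma_N=\{x\in\mathbb R^{N-1}:0\le x_1\le\dots\le x_{N-1}\le1\}$, $x_0=0$, $x_N=1$, and $$q_N(dx)=\frac{\Gamma(\beta)}{\Gamma(\beta/N)^N}\prod_{i=1}^N(x_i-x_{i-1})^{\beta/N-1}dx_1\cdots dx_{N-1}\quad\text{on }\Sigma_N,$$ $H^N=L^2(\Sigma_N,q_N)$, and let $\mathcal E^N$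 be the closure in $H^N$ of $\int_{\Sigma_N}|\nabla f|^2dq_N$, $f\in C^\infty(\Sigma_N)$. Let $\Phi^N:H\to H^N$, $(\Phi^Nu)(x)=\mathbb E_{\mathbb Q^\beta}(u\,|\,g(i/N)=x_i,\ i=1,\dots,N-1)$. All forms take the value $+\infty$ outside their domains. Write $\mathcal E(u)=\mathcal E(u,u)$, $\mathcal E^N(u)=\mathcal E^N(u,u)$. *Convergence.* A sequence $u_N\in H^N$ converges strongly to $u\in H$ if there are $\tilde u_k\in H$ with $\tilde u_k\to u$ in $H$ and $\lim_k\limsup_M\|\Phi^M\tilde u_k-u_M\|_{H^M}=0$; it converges weakly to $u$ if $\langle u_N,v_N\rangle_{H^N}\to\langle u,v\rangle_H$ whenever $v_N\in H^N$ converges strongly to $v\in H$. **Theorem.** Assume that $\mathcal E$ is Markov-unique. Then $(N\cdot\mathcal E^N,H^N)$ converges to $(\mathcal E,H)$ along $\Phi^N$ in the generalized Mosco sense of Kuwae and Shioya, that is: 1. $\lim_N\|\Phi^Nu\|_{H^N}=\|u\|_H$ for all $u\in H$; 2. (Mosco I) if $u_N\in H^N$ converges weakly to $u\in H$, then $\mathcal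 E(u)\le\liminf_N N\,\mathcal E^N(u_N)$; 3. (Mosco II) for every $u\in H$ there are $u_N\in H^N$ converging strongly to $u$ with $N\,\mathcal E^N(u_N)\to\mathcal E(u)$; 4. (Mosco II') there is a core $K$ of $\mathcal E$ (a subset of the domain, dense in it for the norm $(\mathcal E(u)+\|u\|_H^2)^{1/2}$) such that for every $u\in K$ there are $u_N$ in the domain of $\mathcal E^N$, for every $N$, converging strongly to $u$ with $N\,\mathcal E^N(u_N)\to\mathcal E(u)$. -/

import Mathlib

open MeasureTheory Filter Topology Set
open scoped ENNReal ContDiff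

noncomputable section

/-! ### Forms on varying Hilbert spaces and Mosco convergence

A non-negative quadratic form on a Hilbert space is represented by its diagonal
`u ↦ E(u,u)`, with the value `∞` outside the domain. -/

section Mosco

/-- The form `u ↦ ‖∇u‖²` obtained by closing a gradient operator whose graph is `S`. A pair
`(u, ξ)` lies in the closure of `S` iff there are core functions `u_k → u` with `∇u_k → ξ`, that
is, iff some sequence of core functions that is Cauchy for the form converges to `u`, with
gradients tending to `ξ`. For a closable form `ξ` is determined by `u`; the domain of the closure
is the set of all `u` which have such a `ξ`, and the form is `∞` elsewhere. -/
def closedForm {H T : Type*} [NormedAddCommGroup H] [NormedAddCommGroup T]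
    (S : Set (H × T)) (u : H) : ℝ≥0∞ :=
  ⨅ (ξ : T) (_ : (u, ξ) ∈ closure S), ‖ξ‖ₑ ^ 2

variable {H : Type*} [NormedAddCommGroup H] [InnerProductSpace ℝ H]
  {K : ℕ → Type*} [∀ n, NormedAddCommGroup (K n)] [∀ n, InnerProductSpace ℝ (K n)]

/-- Convergence of the Hilbert spaces `K n` to `H` along the linear maps `Φ n`. -/
def HilbertConverges (Φ : ∀ n, H →L[ℝ] K n) : Prop :=
  ∀ u : H, Tendsto (fun n => ‖Φ n u‖) atTop (𝓝 ‖u‖)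

/-- Strong convergence of `u n ∈ K n` to `v ∈ H` along `Φ`. -/
def StronglyConverges (Φ : ∀ n, H →L[ℝ] K n) (u : ∀ n, K n) (v : H) : Prop :=
  ∃ w : ℕ → H, Tendsto w atTop (𝓝 v) ∧
    Tendsto (fun k => limsup (fun m => ‖Φ m (w k) - u m‖ₑ) atTop) atTop (𝓝 0)

/-- Weak convergence of `u n ∈ K n` to `v ∈ H` along `Φ`. -/
def WeaklyConverges (Φ : ∀ n, H →L[ℝ] K n) (u : ∀ n, K n) (v : H) : Prop :=
  ∀ (z : ∀ n, K n) (y : H), StronglyConverges Φ z y →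
    Tendsto (fun n => inner ℝ (u n) (z n)) atTop (𝓝 (inner ℝ v y))

/-- The lower bound condition. -/
def MoscoI (Φ : ∀ n, H →L[ℝ] K n) (F : ∀ n, K n → ℝ≥0∞) (E : H → ℝ≥0∞) : Prop :=
  ∀ (u : ∀ n, K n) (v : H), WeaklyConverges Φ u v →
    E v ≤ liminf (fun n => F n (u n)) atTop

/-- Existence of recovery sequences for all vectors. -/
def MoscoII (Φ : ∀ n, H →L[ℝ] K n) (F : ∀ n, K n → ℝ≥0∞) (E : H → ℝ≥0∞) : Prop :=
  ∀ v : H, ∃ u : ∀ n, K n, StronglyConverges Φ u v ∧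
    Tendsto (fun n => F n (u n)) atTop (𝓝 (E v))

/-- `C` is a core of the form `E`: a subset of the domain of `E` which is dense in it for the norm
`(E(u,u) + ‖u‖²)^(1/2)`. -/
def IsFormCore (E : H → ℝ≥0∞) (C : Set H) : Prop :=
  (∀ v ∈ C, E v < ⊤) ∧
    ∀ u : H, E u < ⊤ → ∃ v : ℕ → H, (∀ k, v k ∈ C) ∧ Tendsto v atTop (𝓝 u) ∧
      Tendsto (fun k => E (v k - u)) atTop (𝓝 0)

/-- Existence of recovery sequences, inside the domains, for the vectors of some core. -/
def MoscoII' (Φ : ∀ n, H →L[ℝ] K n) (F : ∀ n, K n → ℝ≥0∞) (E : H → ℝ≥0∞) : Prop :=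
  ∃ C : Set H, IsFormCore E C ∧ ∀ v ∈ C, ∃ u : ∀ n, K n,
    (∀ n, F n (u n) < ⊤) ∧ StronglyConverges Φ u v ∧
    Tendsto (fun n => F n (u n)) atTop (𝓝 (E v))

end Mosco

/-! ### Dirichlet forms -/

/-- A (symmetric, not necessarily regular) Dirichlet form on `L²(X, μ)`. -/
structure DirichletForm {X : Type*} [MeasurableSpace X] (μ : Measure X) where
  /-- the domain -/
  dom : Submodule ℝ (Lp ℝ 2 μ)
  /-- the bilinear form -/
  form : dom →ₗ[ℝ] dom →ₗ[ℝ] ℝ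
  dense : Dense (dom : Set (Lp ℝ 2 μ))
  symm : ∀ u v : dom, form u v = form v u
  nonneg : ∀ u : dom, 0 ≤ form u u
  /-- `dom` is complete for the norm `(form u u + ‖u‖²)^(1/2)` -/
  closed : ∀ (u : ℕ → dom) (v : Lp ℝ 2 μ),
    Tendsto (fun k => (u k : Lp ℝ 2 μ)) atTop (𝓝 v) →
    Tendsto (fun p : ℕ × ℕ => form (u p.1 - u p.2) (u p.1 - u p.2)) atTop (𝓝 0) →
    ∃ hv : v ∈ dom, Tendsto (fun k => form (u k - ⟨v, hv⟩) (u k - ⟨v, hv⟩)) atTop (𝓝 0)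
  /-- the unit contraction `(0 ∨ u) ∧ 1` operates on the form -/
  markov : ∀ (u : dom) (v : Lp ℝ 2 μ),
    (v =ᵐ[μ] fun x => min (max 0 ((u : Lp ℝ 2 μ) x)) 1) →
    ∃ hv : v ∈ dom, form ⟨v, hv⟩ ⟨v, hv⟩ ≤ form u u

open Classical in
/-- The diagonal of a Dirichlet form, with the value `∞` outside its domain. -/
def DirichletForm.energy {X : Type*} [MeasurableSpace X] {μ : Measure X}
    (E : DirichletForm μ) (u : Lp ℝ 2 μ) : ℝ≥0∞ :=
  if h : u ∈ E.dom then ENNReal.ofReal (E.form ⟨u, h⟩ ⟨u, h⟩) else ⊤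

/-- `u` lies in the domain of the generator `L` of the form and `L u = w`. -/
def DirichletForm.HasGenerator {X : Type*} [MeasurableSpace X] {μ : Measure X}
    (E : DirichletForm μ) (u w : Lp ℝ 2 μ) : Prop :=
  ∃ hu : u ∈ E.dom, ∀ v : E.dom, E.form ⟨u, hu⟩ v = -inner ℝ w (v : Lp ℝ 2 μ)

/-! ### The particle configurations and their Dirichlet distribution -/

/-- The vector `(0, x₁, …, x_n, 1)`. -/
def withEnds {n : ℕ} (x : Fin n → ℝ) : Fin (n + 2) → ℝ :=
  Fin.cons (α := fun _ => ℝ) 0 (Fin.snoc (α := fun _ => ℝ) x 1)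

/-- The increments `x_{i+1} - x_i`, `i = 0, …, n`, where `x_0 = 0` and `x_{n+1} = 1`. -/
def gap {n : ℕ} (x : Fin n → ℝ) (i : Fin (n + 1)) : ℝ :=
  withEnds x i.succ - withEnds x i.castSucc

/-- The set of all `x` with `0 ≤ x₁ ≤ ⋯ ≤ x_n ≤ 1`. -/
def orderedSimplex (n : ℕ) : Set (Fin n → ℝ) :=
  {x | Monotone x ∧ ∀ i, x i ∈ Icc (0 : ℝ) 1}

/-- The law on `orderedSimplex n` under which the increments have the Dirichlet distribution with
parameters `a 0, …, a n`. -/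
def dirichletMeasure {n : ℕ} (a : Fin (n + 1) → ℝ) : Measure (Fin n → ℝ) :=
  (volume.restrict (orderedSimplex n)).withDensity fun x =>
    ENNReal.ofReal
      (Real.Gamma (∑ i, a i) / (∏ i, Real.Gamma (a i)) * ∏ i, gap x i ^ (a i - 1))

/-- The measure `q_N` for `N = n + 1`: its density on `orderedSimplex n` is
`Γ(β) / Γ(β/N) ^ N * ∏ i, (x_i - x_{i-1}) ^ (β/N - 1)`. -/
def particleMeasure (β : ℝ) (n : ℕ) : Measure (Fin n → ℝ) :=
  dirichletMeasure fun _ : Fin (n + 1) => β / (n + 1 : ℕ)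

/-- The pairs `(f, ∇f)`, where `f` is smooth on `orderedSimplex n` up to the boundary. -/
def particleGradient (β : ℝ) (n : ℕ) :
    Set (Lp ℝ 2 (particleMeasure β n) × Lp (EuclideanSpace ℝ (Fin n)) 2 (particleMeasure β n)) :=
  {p | ∃ f : (Fin n → ℝ) → ℝ, ContDiff ℝ ∞ f ∧ p.1 =ᵐ[particleMeasure β n] f ∧
    p.2 =ᵐ[particleMeasure β n] fun x => WithLp.toLp 2 fun i => fderiv ℝ f x (Pi.single i 1)}

/-- The form `𝓔^N` for `N = n + 1`, i.e. the closure of `∫ |∇f|² dq_N` on smooth functions. -/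
def particleForm (β : ℝ) (n : ℕ) : Lp ℝ 2 (particleMeasure β n) → ℝ≥0∞ :=
  closedForm (particleGradient β n)

/-! ### Quantile functions and the Dirichlet process -/

/-- The interval `[0,1)`. -/
abbrev UnitIco : Type := Set.Ico (0 : ℝ) 1

/-- Lebesgue measure on `[0,1)`. -/
def lebesgueIco : Measure UnitIco := Measure.comap Subtype.val volume

/-- The space `𝓖` of right continuous nondecreasing functions `[0,1) → [0,1]` (left limits exist
by monotonicity), with the σ-algebra generated by the evaluations, which is the Borel σ-algebra of
the `L²`-distance. -/
abbrev QuantileFn : Type :=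
  {g : UnitIco → ℝ // Monotone g ∧ (∀ t, g t ∈ Icc (0 : ℝ) 1) ∧
    ∀ t, ContinuousWithinAt g (Ici t) t}

/-- `Q` is the law of the Dirichlet process over `[0,1]` with parameter `β`: for all
`0 < t₁ < ⋯ < t_n < 1` the increments of `(0, g(t₁), …, g(t_n), 1)` have the Dirichlet
distribution with parameters `β * (t_{i+1} - t_i)`, where `t_0 = 0` and `t_{n+1} = 1`. -/
structure IsDirichletLaw (β : ℝ) (Q : Measure QuantileFn) : Prop where
  isProbabilityMeasure : IsProbabilityMeasure Q
  map_eval : ∀ (n : ℕ) (t : Fin n → UnitIco), StrictMono t → (∀ i, 0 < (t i : ℝ)) →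
    Q.map (fun g i => g.1 (t i)) = dirichletMeasure fun i => β * gap (fun j => (t j : ℝ)) i

/-- The inner product of `f` and `g` in `L²([0,1])`. -/
def pairing (f : Lp ℝ 2 lebesgueIco) (g : QuantileFn) : ℝ :=
  ∫ t, f t * g.1 t ∂lebesgueIco

/-- The pairs `(u, ∇u)` for cylinder functions `u(g) = U(⟨f₁, g⟩, …, ⟨f_m, g⟩)` with
`U ∈ C¹_c(ℝ^m)` and `f_i ∈ L²([0,1])`; here `∇u|_g = ∑ i, ∂_i U(⟨f₁, g⟩, …, ⟨f_m, g⟩) f_i`, and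
`∇u` is regarded as an element of `L²(𝓖 × [0,1], Q ⊗ dt)`. -/
def cylinderGradient (Q : Measure QuantileFn) :
    Set (Lp ℝ 2 Q × Lp ℝ 2 (Q.prod lebesgueIco)) :=
  {p | ∃ (m : ℕ) (U : (Fin m → ℝ) → ℝ) (f : Fin m → Lp ℝ 2 lebesgueIco),
    ContDiff ℝ 1 U ∧ HasCompactSupport U ∧
    (p.1 =ᵐ[Q] fun g => U fun i => pairing (f i) g) ∧
    p.2 =ᵐ[Q.prod lebesgueIco] fun z =>
      ∑ i, fderiv ℝ U (fun j => pairing (f j) z.1) (Pi.single i 1) * f i z.2}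

/-- The Wasserstein Dirichlet form `𝓔`, i.e. the closure of `∫ ‖∇u|_g‖² Q(dg)` on cylinder
functions. -/
def wassersteinForm (Q : Measure QuantileFn) : Lp ℝ 2 Q → ℝ≥0∞ :=
  closedForm (cylinderGradient Q)

/-- The pairs `(u, ∇u)` for the functions `u(g) = U(∫ φ₁(g(t)) dt, …, ∫ φ_m(g(t)) dt)`, where
`U` and the `φ_i` are smooth with compact support and `φ_i'(0) = φ_i'(1) = 0`; here
`∇u|_g(t) = ∑ i, ∂_i U(…) φ_i'(g(t))`. -/
def neumannGradient (Q : Measure QuantileFn) :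
    Set (Lp ℝ 2 Q × Lp ℝ 2 (Q.prod lebesgueIco)) :=
  {p | ∃ (m : ℕ) (U : (Fin m → ℝ) → ℝ) (φ : Fin m → ℝ → ℝ),
    ContDiff ℝ ∞ U ∧ HasCompactSupport U ∧
    (∀ i, ContDiff ℝ ∞ (φ i) ∧ HasCompactSupport (φ i) ∧
      deriv (φ i) 0 = 0 ∧ deriv (φ i) 1 = 0) ∧
    (p.1 =ᵐ[Q] fun g => U fun i => ∫ t, φ i (g.1 t) ∂lebesgueIco) ∧
    p.2 =ᵐ[Q.prod lebesgueIco] fun z =>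
      ∑ i, fderiv ℝ U (fun j => ∫ t, φ j (z.1.1 t) ∂lebesgueIco) (Pi.single i 1) *
        deriv (φ i) (z.1.1 z.2)}

/-- The generator `L` of `𝓔` on the functions `u` of `neumannGradient`: `L u = w` means that
`∫ ⟨∇u, ∇v⟩ dQ = -∫ w v dQ` for all cylinder functions `v` (which are a core of `𝓔`). -/
def IsNeumannGenerator (Q : Measure QuantileFn) (u w : Lp ℝ 2 Q) : Prop :=
  ∃ ξ, (u, ξ) ∈ neumannGradient Q ∧
    ∀ p ∈ cylinderGradient Q, inner ℝ ξ p.2 = -inner ℝ w p.1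

/-- Markov uniqueness of `𝓔`: it is the only Dirichlet form on `L²(𝓖, Q)` whose generator extends
the generator of `𝓔` on the smooth Neumann functions. -/
def IsMarkovUnique (Q : Measure QuantileFn) : Prop :=
  ∀ E : DirichletForm Q, (∀ u w, IsNeumannGenerator Q u w → E.HasGenerator u w) →
    E.energy = wassersteinForm Q

/-! ### The conditional expectation maps -/

/-- The times `i / N`, `i = 1, …, N - 1`, where `N = n + 1`. -/
def gridTime (n : ℕ) (i : Fin n) : UnitIco :=
  ⟨(i + 1 : ℕ) / (n + 1 : ℕ), by positivity, by
    rw [div_lt_one (by positivity)]; exact_mod_cast Nat.succ_lt_succ i.2⟩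

/-- The map `g ↦ (g(1/N), …, g((N-1)/N))`, where `N = n + 1`. -/
def gridEval (n : ℕ) (g : QuantileFn) : Fin n → ℝ := fun i => g.1 (gridTime n i)

theorem withEnds_gridTime (n : ℕ) (i : Fin (n + 2)) :
    withEnds (fun j => (gridTime n j : ℝ)) i = (i : ℝ) / (n + 1 : ℕ) := by
  unfold withEnds
  refine Fin.cases ?_ (fun j => ?_) i
  · simp
  · refine Fin.lastCases ?_ (fun k => ?_) j
    · rw [Fin.cons_succ, Fin.snoc_last, Fin.val_succ, Fin.val_last, div_self (by positivity)]
    · simp [gridTime]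

theorem gap_gridTime (n : ℕ) (i : Fin (n + 1)) :
    gap (fun j => (gridTime n j : ℝ)) i = 1 / (n + 1 : ℕ) := by
  unfold gap
  rw [withEnds_gridTime, withEnds_gridTime, ← sub_div]
  simp

theorem IsDirichletLaw.measurePreserving {β : ℝ} {Q : Measure QuantileFn}
    (hQ : IsDirichletLaw β Q) (n : ℕ) :
    MeasurePreserving (gridEval n) Q (particleMeasure β n) := by
  refine ⟨measurable_pi_lambda _ fun i => (measurable_pi_apply _).comp measurable_subtype_coe, ?_⟩
  have h := hQ.map_eval n (gridTime n)
    (by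
      intro i j hij
      change ((i + 1 : ℕ) : ℝ) / (n + 1 : ℕ) < ((j + 1 : ℕ) : ℝ) / (n + 1 : ℕ)
      have hij' : (i : ℕ) < j := hij
      gcongr)
    (by
      intro i
      change (0 : ℝ) < ((i + 1 : ℕ) : ℝ) / (n + 1 : ℕ)
      positivity)
  unfold gridEval particleMeasure
  rw [h]
  simp only [gap_gridTime, mul_one_div]

/-- The isometric embedding `f ↦ f ∘ gridEval n` of `L²(q_N)` into `L²(Q)`. -/
def liftMap {β : ℝ} {Q : Measure QuantileFn} (hQ : IsDirichletLaw β Q) (n : ℕ) :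
    Lp ℝ 2 (particleMeasure β n) →ₗᵢ[ℝ] Lp ℝ 2 Q :=
  Lp.compMeasurePreservingₗᵢ ℝ (gridEval n) (hQ.measurePreserving n)

/-- The conditional expectation `(Φ^N u)(x) = 𝔼(u | g(i/N) = x_i, i = 1, …, N - 1)` for
`N = n + 1`, as the adjoint of the embedding of `L²(q_N)` into `L²(Q)`; see
`condExpMap_comp_gridEval`. -/
def condExpMap {β : ℝ} {Q : Measure QuantileFn} (hQ : IsDirichletLaw β Q) (n : ℕ) :
    Lp ℝ 2 Q →L[ℝ] Lp ℝ 2 (particleMeasure β n) :=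
  ContinuousLinearMap.adjoint (liftMap hQ n).toContinuousLinearMap

/-- `condExpMap hQ n u`, evaluated at `(g(1/N), …, g((N-1)/N))`, is the conditional expectation of
`u` given the σ-algebra generated by these values. -/
theorem condExpMap_comp_gridEval {β : ℝ} {Q : Measure QuantileFn} (hQ : IsDirichletLaw β Q)
    (n : ℕ) (u : Lp ℝ 2 Q) :
    (fun g => condExpMap hQ n u (gridEval n g)) =ᵐ[Q]
      Q[u | MeasurableSpace.comap (gridEval n) inferInstance] := by
  have := hQ.isProbabilityMeasure
  have hmp := hQ.measurePreserving n
  have : IsProbabilityMeasure (particleMeasure β n) := by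
    rw [← hmp.map_eq]; exact Measure.isProbabilityMeasure_map hmp.measurable.aemeasurable
  have hle : MeasurableSpace.comap (gridEval n) inferInstance ≤
      (inferInstance : MeasurableSpace QuantileFn) := hmp.measurable.comap_le
  have hu : Integrable u Q := (Lp.memLp u).integrable (by norm_num)
  have hc : Integrable (condExpMap hQ n u) (particleMeasure β n) :=
    (Lp.memLp _).integrable (by norm_num)
  have hc' : Integrable (fun g => condExpMap hQ n u (gridEval n g)) Q :=
    hmp.integrable_comp_of_integrable hc
  refine ae_eq_condExp_of_forall_setIntegral_eq hle hu (fun _ _ _ => hc'.integrableOn) ?_ ?_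
  · rintro _ ⟨s, hs, rfl⟩ -
    have h1 : inner ℝ (indicatorConstLp 2 hs (measure_ne_top (particleMeasure β n) s) (1 : ℝ))
        (condExpMap hQ n u) =
        inner ℝ (liftMap hQ n
          (indicatorConstLp 2 hs (measure_ne_top (particleMeasure β n) s) (1 : ℝ))) u := by
      rw [condExpMap, ContinuousLinearMap.adjoint_inner_right]; rfl
    have h2 : liftMap hQ n
        (indicatorConstLp 2 hs (measure_ne_top (particleMeasure β n) s) (1 : ℝ)) =
        indicatorConstLp 2 (hmp.measurable hs) (measure_ne_top Q _) (1 : ℝ) :=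
      Lp.indicatorConstLp_compMeasurePreserving hs _ 1 hmp
    rw [h2, L2.inner_indicatorConstLp_one, L2.inner_indicatorConstLp_one] at h1
    have h3 : ∀ v : (Fin n → ℝ) → ℝ, AEStronglyMeasurable v (particleMeasure β n) →
        ∫ g in gridEval n ⁻¹' s, v (gridEval n g) ∂Q = ∫ x in s, v x ∂(particleMeasure β n) := by
      intro v hv
      rw [← hmp.map_eq] at hv ⊢
      exact (setIntegral_map hs hv hmp.measurable.aemeasurable).symm
    rw [← h1]
    exact h3 _ hc.aestronglyMeasurable
  · exact ((Lp.stronglyMeasurable (condExpMap hQ n u)).comp_measurable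
      (comap_measurable (gridEval n))).aestronglyMeasurable

end

/-! Write N = n + 1. The maps Φ^N are the adjoints of the isometric embeddings `liftMap` of H^N into
H, so the whole argument can be run inside H. Since g is the pointwise limit of its grid step
functions, and since trigonometric functions of the integrals ∫ c(t) g(t) dt are total in H
(`ae_eq_zero_of_trig_path`), the projections `liftMap ∘ condExpMap` tend strongly to the identity
(`tendsto_condExp`). This gives the convergence of the Hilbert spaces and turns strong convergence
along Φ^N into norm convergence of the lifts.

Lower bound. Take φ with φ(0) = φ(1) = 0 and move every particle by φ. The Dirichlet density allows
integration by parts along this field, and the resulting divergence `vecDiv` is bounded uniformly in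
N, because its two large sums cancel (`abs_vecDiv_le`). The divergences on nested grids are
consistent, so they converge in H to a bounded divergence on path space (`exists_divergence`). A
gradient on Σ_N, spread over the grid cells with a factor N, becomes an element of L²(Q ⊗ dt) with
squared norm N‖∇f‖². Hence a weak limit of functions with bounded N·𝓔^N satisfies the limiting
integration by parts against all fields w(g) φ(g(t)). It therefore has a weak gradient, with the
right bound on its norm (`moscoI_weakGraph`).

So far the liminf dominates only the form of weak gradients, which may a priori be smaller than 𝓔.
Markov uniqueness closes this gap in `wassersteinForm_le`, provided that the weak form is a
Dirichlet form whose generator extends L on 𝒵₀. Closedness is built into the definition by duality.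
The generator condition holds because the gradients of functions in 𝒵₀ are finite sums of admissible
fields, which is where φ_i'(0) = φ_i'(1) = 0 is needed (`neumann_generator`). The unit contraction
requires a chain rule for weak gradients (`weakGraph_chain`), and this is the delicate point. Tested
against one field φ, a weak gradient is seen only through a scalar component, the weak derivative of
u along φ. Differentiation along φ is skew-symmetric up to multiplication by the bounded divergence.
The ranges of l ± D are dense, because the Laplace transform along the flow of φ, discretised by
Euler steps, solves the resolvent equation approximately (`exists_resolvent`). Therefore weak
derivatives along φ are strong (`mem_closure_of_weak`, `mem_closure_testGraph`), and the chain rule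
follows by approximation with test functions.

Upper bound. Evaluate a cylinder function at step functions. Its partial derivatives are the
integrals of its gradient over the grid cells, so Jensen's inequality bounds N|∇f|² by the squared
norm of the gradient at the step function (`exists_recovery_cylinder`). A diagonal argument extends
the limsup inequality to all of H, and together with the lower bound it becomes convergence of the
energies (`moscoII`). -/

noncomputable section

/-! ### Hilbert space preliminaries -/

section Hilbert

variable {H : Type*} [NormedAddCommGroup H] [InnerProductSpace ℝ H]

/-- Bounded families have weak limits along ultrafilters. -/
theorem exists_weak_limit [CompleteSpace H] {ι : Type*} (F : Ultrafilter ι) (x : ι → H) (C : ℝ)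
    (hC : ∀ᶠ i in F, ‖x i‖ ≤ C) :
    ∃ a : H, ‖a‖ ≤ C ∧ ∀ y, Tendsto (fun i => inner ℝ (x i) y) F (𝓝 (inner ℝ a y)) := by
  have hC0 : 0 ≤ C := by
    obtain ⟨i, hi⟩ := hC.exists
    exact (norm_nonneg _).trans hi
  have hex : ∀ y : H, ∃ l : ℝ, ‖l‖ ≤ C * ‖y‖ ∧ Tendsto (fun i => inner ℝ (x i) y) F (𝓝 l) := by
    intro y
    have hc : IsCompact (Metric.closedBall (0 : ℝ) (C * ‖y‖)) := isCompact_closedBall _ _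
    have hle : ((F.map fun i => inner ℝ (x i) y : Ultrafilter ℝ) : Filter ℝ) ≤
        𝓟 (Metric.closedBall (0 : ℝ) (C * ‖y‖)) := by
      rw [le_principal_iff]
      change ∀ᶠ i in F, inner ℝ (x i) y ∈ Metric.closedBall (0 : ℝ) (C * ‖y‖)
      filter_upwards [hC] with i hi
      rw [mem_closedBall_zero_iff]
      exact (norm_inner_le_norm _ _).trans (by gcongr)
    obtain ⟨l, hl, hl'⟩ := hc.ultrafilter_le_nhds _ hle
    exact ⟨l, mem_closedBall_zero_iff.1 hl, hl'⟩
  choose l hl hlim using hex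
  let f : H →ₗ[ℝ] ℝ :=
    { toFun := l
      map_add' := fun y z => by
        refine tendsto_nhds_unique (hlim (y + z)) ?_
        simpa only [inner_add_right] using (hlim y).add (hlim z)
      map_smul' := fun r y => by
        refine tendsto_nhds_unique (hlim (r • y)) ?_
        simpa only [inner_smul_right, smul_eq_mul, RingHom.id_apply] using (hlim y).const_mul r }
  let g : StrongDual ℝ H := f.mkContinuous C hl
  refine ⟨(InnerProductSpace.toDual ℝ H).symm g, ?_, fun y => ?_⟩
  · rw [LinearIsometryEquiv.norm_map]
    exact f.mkContinuous_norm_le hC0 hl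
  · rw [InnerProductSpace.toDual_symm_apply]
    exact hlim y

/-- A linear subspace is dense if only `0` is orthogonal to it. -/
theorem dense_of_orthogonal [CompleteSpace H] (S : Submodule ℝ H)
    (h : ∀ y, (∀ x ∈ S, inner ℝ x y = 0) → y = 0) : Dense (S : Set H) := by
  rw [Submodule.dense_iff_topologicalClosure_eq_top, Submodule.topologicalClosure_eq_top_iff,
    Submodule.eq_bot_iff]
  intro y hy
  exact h y fun x hx => (Submodule.mem_orthogonal S y).1 hy x hx

/-- Weak and strong extensions of a densely defined operator coincide, if the operator is
skew-symmetric up to a bounded perturbation `V` and has dense resolvent ranges. -/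
theorem mem_closure_of_weak [CompleteSpace H] (Z : Submodule ℝ (H × H)) (V : H → H) {C l : ℝ}
    (hC : 0 ≤ C) (hl : 2 * C < l) (hV : ∀ w, ‖V w‖ ≤ C * ‖w‖)
    (hibp : ∀ p ∈ Z, ∀ q ∈ Z,
      inner ℝ p.2 q.1 + inner ℝ p.1 q.2 + inner ℝ p.1 (V q.1) = (0 : ℝ))
    (hd₁ : ∀ f : H, ∀ ε > 0, ∃ p ∈ Z, ‖l • p.1 - p.2 - f‖ < ε)
    (hd₂ : ∀ f : H, ∀ ε > 0, ∃ p ∈ Z, ‖l • p.1 + p.2 - f‖ < ε)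
    (u e : H) (hue : ∀ p ∈ Z, inner ℝ u (p.2 + V p.1) = -inner ℝ e p.1) :
    (u, e) ∈ closure (Z : Set (H × H)) := by
  have hl0 : 0 < l := by linarith
  -- Taking q = p in the integration by parts formula leaves 2⟨Dp, p⟩ = -⟨p, Vp⟩.
  have hsq : ∀ p ∈ Z, |inner ℝ p.2 p.1| ≤ C / 2 * ‖p.1‖ ^ 2 := by
    intro p hp
    have h1 := hibp p hp p hp
    rw [real_inner_comm p.2 p.1] at h1
    have h2 : |inner ℝ p.1 (V p.1)| ≤ C * ‖p.1‖ ^ 2 := by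
      refine (abs_real_inner_le_norm _ _).trans ?_
      have := mul_le_mul_of_nonneg_left (hV p.1) (norm_nonneg p.1)
      nlinarith
    have h3 : inner ℝ p.2 p.1 = -(inner ℝ p.1 (V p.1)) / 2 := by
      linarith
    rw [h3, abs_div, abs_neg, abs_two]
    linarith
  -- Coercivity for both signs: s = -1 makes resolvent approximations Cauchy, s = 1 gives
  -- uniqueness.
  have hco : ∀ p ∈ Z, ∀ s : ℝ, |s| = 1 → (l - C / 2) * ‖p.1‖ ≤ ‖l • p.1 + s • p.2‖ := by
    intro p hp s hs
    rcases (norm_nonneg p.1).eq_or_lt with h0 | h0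
    · rw [← h0, mul_zero]; positivity
    have h1 : inner ℝ (l • p.1 + s • p.2) p.1 = l * ‖p.1‖ ^ 2 + s * inner ℝ p.2 p.1 := by
      rw [inner_add_left, inner_smul_left, inner_smul_left, real_inner_self_eq_norm_sq]
      simp
    have h2 : -(C / 2 * ‖p.1‖ ^ 2) ≤ s * inner ℝ p.2 p.1 := by
      have := hsq p hp
      refine (abs_le.1 ?_).1
      rwa [abs_mul, hs, one_mul]
    have h3 := real_inner_le_norm (l • p.1 + s • p.2) p.1
    refine le_of_mul_le_mul_right ?_ h0
    nlinarith
  have hlC : 0 < l - C / 2 := by linarith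
  -- solve the resolvent equation in the closure
  have hcl : ∃ q : H × H, q ∈ closure (Z : Set (H × H)) ∧ l • q.1 - q.2 = l • u - e := by
    have hpos : ∀ k : ℕ, (0 : ℝ) < 1 / (k + 1) := fun k => by positivity
    choose p hpZ hp using fun k : ℕ => hd₁ (l • u - e) (1 / (k + 1)) (hpos k)
    have hlim : Tendsto (fun k => l • (p k).1 - (p k).2) atTop (𝓝 (l • u - e)) := by
      rw [tendsto_iff_norm_sub_tendsto_zero]
      exact squeeze_zero (fun _ => norm_nonneg _) (fun k => (hp k).le)
        tendsto_one_div_add_atTop_nhds_zero_nat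
    have hcau : CauchySeq fun k => (p k).1 := by
      have h1 := hlim.cauchySeq
      rw [Metric.cauchySeq_iff] at h1 ⊢
      intro ε hε
      obtain ⟨N, hN⟩ := h1 ((l - C / 2) * ε) (by positivity)
      refine ⟨N, fun m hm n hn => ?_⟩
      have h2 := hN m hm n hn
      rw [dist_eq_norm] at h2 ⊢
      have h3 := hco (p m - p n) (Z.sub_mem (hpZ m) (hpZ n)) (-1) (by simp)
      have h4 : l • (p m - p n).1 + (-1 : ℝ) • (p m - p n).2 =
          l • (p m).1 - (p m).2 - (l • (p n).1 - (p n).2) := by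
        simp only [Prod.fst_sub, Prod.snd_sub, smul_sub, neg_smul, one_smul]; abel
      rw [h4] at h3
      have := h3.trans_lt h2
      exact lt_of_mul_lt_mul_left this hlC.le
    obtain ⟨a, ha⟩ := cauchySeq_tendsto_of_complete hcau
    refine ⟨(a, l • a - (l • u - e)), ?_, by simp⟩
    refine mem_closure_of_tendsto (f := p) (b := atTop) ?_ (Eventually.of_forall hpZ)
    have h2 : Tendsto (fun k => (p k).2) atTop (𝓝 (l • a - (l • u - e))) := by
      have := (ha.const_smul l).sub hlim
      simpa using this
    exact ha.prodMk_nhds h2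
  obtain ⟨q, hq, hqe⟩ := hcl
  have hqw : ∀ p ∈ Z, inner ℝ q.1 (p.2 + V p.1) = -inner ℝ q.2 p.1 := by
    intro p hp
    have hc : IsClosed {q : H × H | inner ℝ q.1 (p.2 + V p.1) = -inner ℝ q.2 p.1} :=
      isClosed_eq (by fun_prop) (by fun_prop)
    refine hc.closure_subset_iff.2 ?_ hq
    intro q' hq'
    have := hibp q' hq' p hp
    simp only [mem_ofPred_eq, inner_add_right]
    linarith
  set z := u - q.1 with hz
  have he : e - q.2 = l • z := by
    rw [hz, smul_sub]
    have : q.2 = l • q.1 - (l • u - e) := by rw [← hqe]; abel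
    rw [this]; abel
  have hzw : ∀ p ∈ Z, inner ℝ z (l • p.1 + p.2) = -inner ℝ z (V p.1) := by
    intro p hp
    have h1 : inner ℝ z (p.2 + V p.1) = -inner ℝ (e - q.2) p.1 := by
      rw [hz, inner_sub_left, inner_sub_left, hue p hp, hqw p hp]; ring
    rw [he, inner_smul_left, inner_add_right] at h1
    rw [inner_add_right, inner_smul_right]
    simp only [RCLike.conj_to_real] at h1
    linarith
  -- Testing with an approximate solution of l p + Dp = z gives, as ε → 0, ‖z‖² ≤ C / (l - C/2)
  -- ‖z‖², and the factor is below 1 because l > 2C.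
  have hz0 : z = 0 := by
    by_contra hne
    have hzp : 0 < ‖z‖ := norm_pos_iff.2 hne
    have key : ∀ ε > 0, ‖z‖ ^ 2 ≤ C * ‖z‖ * ((‖z‖ + ε) / (l - C / 2)) + ‖z‖ * ε := by
      intro ε hε
      obtain ⟨p, hp, hpe⟩ := hd₂ z ε hε
      have h1 := hco p hp 1 (by simp)
      rw [one_smul] at h1
      have h2 : ‖l • p.1 + p.2‖ ≤ ‖z‖ + ε := by
        have := norm_le_norm_add_norm_sub' (l • p.1 + p.2) z
        linarith
      have h3 : ‖p.1‖ ≤ (‖z‖ + ε) / (l - C / 2) := by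
        rw [le_div_iff₀ hlC]; linarith
      have h4 : ‖z‖ ^ 2 = inner ℝ z (l • p.1 + p.2) - inner ℝ z (l • p.1 + p.2 - z) := by
        rw [← inner_sub_right, sub_sub_cancel, real_inner_self_eq_norm_sq]
      rw [h4, hzw p hp]
      have h5 : -inner ℝ z (V p.1) ≤ ‖z‖ * ‖V p.1‖ :=
        (neg_le_abs _).trans (abs_real_inner_le_norm _ _)
      have h6 : -inner ℝ z (l • p.1 + p.2 - z) ≤ ‖z‖ * ‖l • p.1 + p.2 - z‖ :=
        (neg_le_abs _).trans (abs_real_inner_le_norm _ _)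
      have h7 : ‖z‖ * ‖V p.1‖ ≤ ‖z‖ * (C * ((‖z‖ + ε) / (l - C / 2))) := by
        gcongr
        exact (hV _).trans (by gcongr)
      have h8 : ‖z‖ * ‖l • p.1 + p.2 - z‖ ≤ ‖z‖ * ε := by gcongr
      linarith
    have hlim : Tendsto (fun ε : ℝ => C * ‖z‖ * ((‖z‖ + ε) / (l - C / 2)) + ‖z‖ * ε) (𝓝[>] 0)
        (𝓝 (C * ‖z‖ * ((‖z‖ + 0) / (l - C / 2)) + ‖z‖ * 0)) := by
      refine tendsto_nhdsWithin_of_tendsto_nhds (Continuous.tendsto ?_ 0)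
      fun_prop
    have h1 := ge_of_tendsto hlim (eventually_nhdsWithin_of_forall key)
    rw [add_zero, mul_zero, add_zero, mul_div_assoc', le_div_iff₀ hlC] at h1
    nlinarith [sq_nonneg ‖z‖, sq_pos_of_pos hzp]
  have h1 : u = q.1 := sub_eq_zero.1 hz0
  have h2 : e = q.2 := by rw [hz0, smul_zero] at he; exact sub_eq_zero.1 he
  rw [h1, h2]
  exact hq

end Hilbert

/-! ### Strong and weak convergence along adjoints of isometric embeddings -/

section Convergence

variable {H : Type*} [NormedAddCommGroup H] [InnerProductSpace ℝ H] [CompleteSpace H]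
  {K : ℕ → Type*} [∀ n, NormedAddCommGroup (K n)] [∀ n, InnerProductSpace ℝ (K n)]
  [∀ n, CompleteSpace (K n)] (J : ∀ n, K n →ₗᵢ[ℝ] H)

/-- The adjoint of an isometric embedding. -/
def coisometry (n : ℕ) : H →L[ℝ] K n :=
  ContinuousLinearMap.adjoint (J n).toContinuousLinearMap

theorem coisometry_inner (n : ℕ) (u : H) (v : K n) :
    inner ℝ (coisometry J n u) v = inner ℝ u (J n v) :=
  ContinuousLinearMap.adjoint_inner_left _ _ _

theorem coisometry_apply_self (n : ℕ) (v : K n) : coisometry J n (J n v) = v := by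
  refine ext_inner_right ℝ fun w => ?_
  rw [coisometry_inner, LinearIsometry.inner_map_map]

theorem norm_coisometry_le (n : ℕ) (u : H) : ‖coisometry J n u‖ ≤ ‖u‖ := by
  have h : ‖coisometry J n u‖ * ‖coisometry J n u‖ ≤ ‖u‖ * ‖coisometry J n u‖ := by
    rw [← real_inner_self_eq_norm_mul_norm, coisometry_inner]
    exact (real_inner_le_norm _ _).trans_eq (by rw [LinearIsometry.norm_map])
  rcases (norm_nonneg (coisometry J n u)).eq_or_lt with h0 | h0
  · rw [← h0]; exact norm_nonneg _
  · exact le_of_mul_le_mul_right h h0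

/-- If the vectors approximable by the subspaces are dense, the projections converge to `1`. -/
theorem tendsto_projection (S : Set H) (hS : Dense S)
    (h : ∀ u ∈ S, ∃ v : ∀ n, K n, Tendsto (fun n => J n (v n)) atTop (𝓝 u)) (u : H) :
    Tendsto (fun n => J n (coisometry J n u)) atTop (𝓝 u) := by
  rw [Metric.tendsto_atTop]
  intro ε hε
  obtain ⟨y, hy, hyu⟩ := Metric.mem_closure_iff.1 (hS u) (ε / 4) (by positivity)
  obtain ⟨v, hv⟩ := h y hy
  obtain ⟨N, hN⟩ := Metric.tendsto_atTop.1 hv (ε / 4) (by positivity)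
  refine ⟨N, fun n hn => ?_⟩
  have h1 := hN n hn
  rw [dist_eq_norm] at h1 hyu ⊢
  -- The projection fixes the range of `J n`, so u may be replaced by its small distance vector to
  -- an element of that range.
  have h2 : J n (coisometry J n u) - u =
      J n (coisometry J n (u - J n (v n))) - (u - J n (v n)) := by
    rw [map_sub, coisometry_apply_self, map_sub]; abel
  rw [h2]
  have h3 : ‖u - J n (v n)‖ < ε / 2 := by
    calc ‖u - J n (v n)‖ = ‖(u - y) - (J n (v n) - y)‖ := by congr 1; abel
      _ ≤ ‖u - y‖ + ‖J n (v n) - y‖ := norm_sub_le _ _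
      _ < ε / 2 := by linarith
  calc _ ≤ ‖J n (coisometry J n (u - J n (v n)))‖ + ‖u - J n (v n)‖ := norm_sub_le _ _
    _ ≤ ‖u - J n (v n)‖ + ‖u - J n (v n)‖ := by
      rw [LinearIsometry.norm_map]; gcongr; exact norm_coisometry_le J n _
    _ < ε := by linarith

theorem hilbertConverges_of_tendsto
    (h : ∀ u : H, Tendsto (fun n => J n (coisometry J n u)) atTop (𝓝 u)) :
    HilbertConverges (coisometry J) := fun u => by
  simpa only [LinearIsometry.norm_map] using (h u).norm

/-- A constant approximating sequence suffices. With the converse `tendsto_of_stronglyConverges`,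
strong convergence along Φ becomes norm convergence of the lifts. -/
theorem stronglyConverges_of_tendsto {u : ∀ n, K n} {v : H}
    (h : Tendsto (fun n => J n (u n)) atTop (𝓝 v)) : StronglyConverges (coisometry J) u v := by
  refine ⟨fun _ => v, tendsto_const_nhds, ?_⟩
  have h1 : Tendsto (fun m => ‖coisometry J m v - u m‖ₑ) atTop (𝓝 0) := by
    have h2 : Tendsto (fun m => ‖coisometry J m v - u m‖) atTop (𝓝 0) := by
      refine squeeze_zero (fun _ => norm_nonneg _) (fun m => ?_)
        (tendsto_iff_norm_sub_tendsto_zero.1 h)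
      rw [← coisometry_apply_self J m (u m), ← map_sub, coisometry_apply_self, norm_sub_rev]
      exact norm_coisometry_le J m _
    have h3 := ENNReal.tendsto_ofReal h2
    simpa only [ofReal_norm, ENNReal.ofReal_zero] using h3
  simp only [h1.limsup_eq]
  exact tendsto_const_nhds

theorem tendsto_of_stronglyConverges
    (hJ : ∀ u : H, Tendsto (fun n => J n (coisometry J n u)) atTop (𝓝 u))
    {u : ∀ n, K n} {v : H} (h : StronglyConverges (coisometry J) u v) :
    Tendsto (fun n => J n (u n)) atTop (𝓝 v) := by
  obtain ⟨w, hw, hl⟩ := h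
  rw [Metric.tendsto_nhds]
  intro ε hε
  have h1 := Metric.tendsto_nhds.1 hw (ε / 3) (by positivity)
  have h2 : ∀ᶠ k in atTop,
      limsup (fun m => ‖coisometry J m (w k) - u m‖ₑ) atTop < ENNReal.ofReal (ε / 3) :=
    hl.eventually_lt_const (by simpa using hε)
  obtain ⟨k, hk1, hk2⟩ := (h1.and h2).exists
  have h3 := eventually_lt_of_limsup_lt hk2
  have h4 := Metric.tendsto_nhds.1 (hJ (w k)) (ε / 3) (by positivity)
  filter_upwards [h3, h4] with m hm3 hm4
  rw [← ofReal_norm, ENNReal.ofReal_lt_ofReal_iff (by positivity)] at hm3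
  rw [dist_eq_norm] at *
  calc ‖J m (u m) - v‖ = ‖-(J m (coisometry J m (w k) - u m)) +
      (J m (coisometry J m (w k)) - w k) + (w k - v)‖ := by congr 1; rw [map_sub]; abel
    _ ≤ ‖J m (coisometry J m (w k) - u m)‖ + ‖J m (coisometry J m (w k)) - w k‖ + ‖w k - v‖ := by
      refine (norm_add_le _ _).trans ?_
      gcongr
      refine (norm_add_le _ _).trans_eq ?_
      rw [norm_neg]
    _ < ε := by rw [LinearIsometry.norm_map]; linarith

/-- Lets the lower bound condition be applied to recovery sequences. -/
theorem weaklyConverges_of_tendsto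
    (hJ : ∀ u : H, Tendsto (fun n => J n (coisometry J n u)) atTop (𝓝 u))
    {u : ∀ n, K n} {v : H} (h : Tendsto (fun n => J n (u n)) atTop (𝓝 v)) :
    WeaklyConverges (coisometry J) u v := fun z y hz => by
  have h1 := h.inner (tendsto_of_stronglyConverges J hJ hz) (𝕜 := ℝ)
  simpa only [LinearIsometry.inner_map_map] using h1

end Convergence

/-- Diagonal selection. -/
theorem exists_diagonal {K : ℕ → Type*} [∀ n, Nonempty (K n)] (P : ℕ → ∀ n, K n → Prop)
    (hmono : ∀ k l, k ≤ l → ∀ n x, P l n x → P k n x)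
    (h : ∀ k, ∀ᶠ n in atTop, ∃ x, P k n x) :
    ∃ u : ∀ n, K n, ∀ k, ∀ᶠ n in atTop, P k n (u n) := by
  classical
  -- For each n take a witness of the largest level k ≤ n that is solvable; by monotonicity it
  -- serves all lower levels too.
  have hex : ∀ n, ∃ x : K n, ∀ k ≤ n, (∃ y, P k n y) → (∀ l ≤ k, ∃ y, P l n y) → P k n x := by
    intro n
    by_cases h0 : ∃ y, P 0 n y
    · have hne : (Finset.filter (fun k => ∃ y, P k n y) (Finset.range (n + 1))).Nonempty :=
        ⟨0, by simpa using h0⟩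
      obtain ⟨y, hy⟩ := (Finset.mem_filter.1 (Finset.max'_mem _ hne)).2
      refine ⟨y, fun k hk hk' _ => ?_⟩
      refine hmono _ _ (Finset.le_max' _ _ ?_) n y hy
      exact Finset.mem_filter.2 ⟨Finset.mem_range.2 (by omega), hk'⟩
    · exact ⟨Classical.arbitrary _, fun k _ _ h2 => absurd (h2 0 (Nat.zero_le _)) h0⟩
  choose u hu using hex
  refine ⟨u, fun k => ?_⟩
  have hall : ∀ᶠ n in atTop, ∀ l ≤ k, ∃ y, P l n y := by
    filter_upwards [h k] with n hn l hl
    obtain ⟨y, hy⟩ := hn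
    exact ⟨y, hmono l k hl n y hy⟩
  filter_upwards [hall, eventually_ge_atTop k] with n hn hkn
  exact hu n k hkn (hn k le_rfl) hn

/-! ### Dirichlet forms from closed gradient graphs -/

/-- The Dirichlet form `‖D u‖²` of a closed operator with graph `G`. -/
theorem exists_dirichletForm {X : Type*} [MeasurableSpace X] {μ : Measure X} {T : Type*}
    [NormedAddCommGroup T] [InnerProductSpace ℝ T] [CompleteSpace T]
    (G : Submodule ℝ (Lp ℝ 2 μ × T)) (hclosed : IsClosed (G : Set (Lp ℝ 2 μ × T)))
    (hfun : ∀ ξ, (0, ξ) ∈ G → ξ = 0) (hdense : Dense {u | ∃ ξ, (u, ξ) ∈ G})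
    (hmarkov : ∀ u ξ (v : Lp ℝ 2 μ), (u, ξ) ∈ G → (v =ᵐ[μ] fun x => min (max 0 (u x)) 1) →
      ∃ η, (v, η) ∈ G ∧ ‖η‖ ≤ ‖ξ‖) :
    ∃ E : DirichletForm μ, (∀ u, E.energy u < ⊤ → ∃ ξ, (u, ξ) ∈ G) ∧
      (∀ u ξ, (u, ξ) ∈ G → E.energy u = ‖ξ‖ₑ ^ 2) ∧
      ∀ u ξ w, (u, ξ) ∈ G → (∀ v η, (v, η) ∈ G → inner ℝ ξ η = -inner ℝ w v) →
        E.HasGenerator u w := by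
  have hfun' : ∀ x ∈ G, x.1 = 0 → x.2 = 0 := by
    rintro ⟨a, ξ⟩ hx ha
    simp only at ha
    subst ha
    exact hfun ξ hx
  set D := G.toLinearPMap with hD
  have hgraph : D.graph = G := Submodule.toLinearPMap_graph_eq G hfun'
  have hmem : ∀ u : D.domain, ((u : Lp ℝ 2 μ), D u) ∈ G := fun u => by
    rw [← hgraph]; exact D.mem_graph u
  have hdom : ∀ u ξ, (u, ξ) ∈ G → ∃ h : u ∈ D.domain, D ⟨u, h⟩ = ξ := by
    intro u ξ h
    rw [← hgraph, LinearPMap.mem_graph_iff] at h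
    obtain ⟨y, hy1, hy2⟩ := h
    simp only at hy1 hy2
    subst hy1
    exact ⟨y.2, hy2⟩
  let B : D.domain →ₗ[ℝ] D.domain →ₗ[ℝ] ℝ := (innerₗ T).compl₁₂ D.toFun D.toFun
  have hB : ∀ u v, B u v = inner ℝ (D u) (D v) := fun u v => rfl
  have hBn : ∀ u, B u u = ‖D u‖ ^ 2 := fun u => by rw [hB, real_inner_self_eq_norm_sq]
  let E : DirichletForm μ :=
    { dom := D.domain
      form := B
      dense := by
        refine hdense.mono ?_
        rintro u ⟨ξ, h⟩
        exact (hdom u ξ h).1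
      symm := fun u v => by rw [hB, hB, real_inner_comm]
      nonneg := fun u => by rw [hBn]; positivity
      closed := fun u v hv hc => by
        have hcau : CauchySeq fun k => D (u k) := by
          rw [cauchySeq_iff_tendsto_dist_atTop_0]
          have h1 : Tendsto (fun p : ℕ × ℕ => √(B (u p.1 - u p.2) (u p.1 - u p.2))) atTop
              (𝓝 (√0)) := (Real.continuous_sqrt.tendsto 0).comp hc
          rw [Real.sqrt_zero] at h1
          refine h1.congr fun p => ?_
          rw [hBn, Real.sqrt_sq (norm_nonneg _), dist_eq_norm, LinearPMap.map_sub]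
        obtain ⟨ξ, hξ⟩ := cauchySeq_tendsto_of_complete hcau
        have hvG : (v, ξ) ∈ G := by
          refine hclosed.mem_of_tendsto (hv.prodMk_nhds hξ)
            (Eventually.of_forall fun k => hmem (u k))
        obtain ⟨hv', hDv⟩ := hdom v ξ hvG
        refine ⟨hv', ?_⟩
        have h1 : Tendsto (fun k => ‖D (u k) - ξ‖ ^ 2) atTop (𝓝 0) := by
          have := (tendsto_iff_norm_sub_tendsto_zero.1 hξ).pow 2
          simpa using this
        refine h1.congr fun k => ?_
        rw [hBn, LinearPMap.map_sub, hDv]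
      markov := fun u v hv => by
        obtain ⟨η, hη, hle⟩ := hmarkov u (D u) v (hmem u) hv
        obtain ⟨hv', hDv⟩ := hdom v η hη
        refine ⟨hv', ?_⟩
        rw [hBn, hBn, hDv]
        gcongr }
  refine ⟨E, ?_, ?_, ?_⟩
  · intro u hu
    unfold DirichletForm.energy at hu
    split_ifs at hu with h
    · exact ⟨_, hmem ⟨u, h⟩⟩
    · exact absurd hu (lt_irrefl _)
  · intro u ξ h
    obtain ⟨hu, hDu⟩ := hdom u ξ h
    have h1 : u ∈ E.dom := hu
    unfold DirichletForm.energy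
    rw [dif_pos h1]
    change ENNReal.ofReal (B ⟨u, hu⟩ ⟨u, hu⟩) = _
    rw [hBn, hDu, ENNReal.ofReal_pow (norm_nonneg _), ofReal_norm]
  · intro u ξ w h hw
    obtain ⟨hu, hDu⟩ := hdom u ξ h
    refine ⟨hu, fun v => ?_⟩
    change B ⟨u, hu⟩ v = _
    rw [hB, hDu]
    exact hw _ _ (hmem v)

/-! ### Calculus on the ordered simplex -/

section Simplex

variable {n : ℕ}

/-- The vector `(0, v₁, …, v_n, 0)`, as a linear function of `v`, coordinatewise. -/
def endsLin (n : ℕ) (k : Fin (n + 2)) : (Fin n → ℝ) →L[ℝ] ℝ :=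
  LinearMap.toContinuousLinearMap
    { toFun := fun v => Fin.cons (α := fun _ => ℝ) 0 (Fin.snoc (α := fun _ => ℝ) v 0) k
      map_add' := fun v w => by
        refine Fin.cases ?_ (fun j => ?_) k
        · simp
        · refine Fin.lastCases ?_ (fun i => ?_) j <;> simp
      map_smul' := fun r v => by
        refine Fin.cases ?_ (fun j => ?_) k
        · simp
        · refine Fin.lastCases ?_ (fun i => ?_) j <;> simp }

@[simp] theorem endsLin_zero (v : Fin n → ℝ) : endsLin n 0 v = 0 := rfl

@[simp] theorem endsLin_last (v : Fin n → ℝ) : endsLin n (Fin.last n).succ v = 0 := by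
  change Fin.cons (α := fun _ => ℝ) 0 (Fin.snoc (α := fun _ => ℝ) v 0) (Fin.last n).succ = 0
  simp

@[simp] theorem endsLin_mid (v : Fin n → ℝ) (i : Fin n) : endsLin n i.castSucc.succ v = v i := by
  change Fin.cons (α := fun _ => ℝ) 0 (Fin.snoc (α := fun _ => ℝ) v 0) i.castSucc.succ = v i
  simp

@[simp] theorem withEnds_zero (x : Fin n → ℝ) : withEnds x 0 = 0 := rfl

@[simp] theorem withEnds_last (x : Fin n → ℝ) : withEnds x (Fin.last n).succ = 1 := by
  simp [withEnds]

@[simp] theorem withEnds_mid (x : Fin n → ℝ) (i : Fin n) :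
    withEnds x i.castSucc.succ = x i := by
  simp [withEnds]

theorem withEnds_cases {p : Fin (n + 2) → Prop} (h0 : p 0) (h1 : p (Fin.last n).succ)
    (h : ∀ i : Fin n, p i.castSucc.succ) (k : Fin (n + 2)) : p k :=
  Fin.cases h0 (fun j => Fin.lastCases h1 h j) k

theorem withEnds_eq (x : Fin n → ℝ) (k : Fin (n + 2)) :
    withEnds x k = endsLin n k x + withEnds (0 : Fin n → ℝ) k := by
  revert k
  refine withEnds_cases ?_ ?_ fun i => ?_ <;> simp [-Fin.succ_last]

theorem hasFDerivAt_withEnds (k : Fin (n + 2)) (x : Fin n → ℝ) :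
    HasFDerivAt (fun x : Fin n → ℝ => withEnds x k) (endsLin n k) x := by
  have h : (fun x : Fin n → ℝ => withEnds x k) =
      fun x => endsLin n k x + withEnds (0 : Fin n → ℝ) k := funext fun x => withEnds_eq x k
  rw [h]
  exact (endsLin n k).hasFDerivAt.add_const _

theorem contDiff_withEnds {r : WithTop ℕ∞} (k : Fin (n + 2)) :
    ContDiff ℝ r fun x : Fin n → ℝ => withEnds x k := by
  have h : (fun x : Fin n → ℝ => withEnds x k) =
      fun x => endsLin n k x + withEnds (0 : Fin n → ℝ) k := funext fun x => withEnds_eq x k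
  rw [h]
  exact (endsLin n k).contDiff.add contDiff_const

@[fun_prop]
theorem continuous_withEnds (k : Fin (n + 2)) :
    Continuous fun x : Fin n → ℝ => withEnds x k := (contDiff_withEnds (r := 0) k).continuous

/-- The frozen end points 0 and 1 have velocity 0, which agrees with φ exactly because φ vanishes
there. So all N + 1 nodes can be treated alike. -/
theorem endsLin_comp {φ : ℝ → ℝ} (h0 : φ 0 = 0) (h1 : φ 1 = 0) (x : Fin n → ℝ)
    (k : Fin (n + 2)) : endsLin n k (fun i => φ (x i)) = φ (withEnds x k) := by
  revert k
  refine withEnds_cases ?_ ?_ fun i => ?_ <;> simp [-Fin.succ_last, h0, h1]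

/-- The derivative of `gap`. -/
def gapLin (n : ℕ) (i : Fin (n + 1)) : (Fin n → ℝ) →L[ℝ] ℝ :=
  endsLin n i.succ - endsLin n i.castSucc

theorem hasFDerivAt_gap (i : Fin (n + 1)) (x : Fin n → ℝ) :
    HasFDerivAt (fun x : Fin n → ℝ => gap x i) (gapLin n i) x :=
  (hasFDerivAt_withEnds _ x).sub (hasFDerivAt_withEnds _ x)

theorem contDiff_gap {r : WithTop ℕ∞} (i : Fin (n + 1)) :
    ContDiff ℝ r fun x : Fin n → ℝ => gap x i :=
  (contDiff_withEnds _).sub (contDiff_withEnds _)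

@[fun_prop]
theorem continuous_gap (i : Fin (n + 1)) :
    Continuous fun x : Fin n → ℝ => gap x i := (contDiff_gap (r := 0) i).continuous

theorem sum_gap (x : Fin n → ℝ) : ∑ i, gap x i = 1 := by
  have h1 : ∑ i : Fin (n + 1), gap x i =
      ∑ i : Fin (n + 1), withEnds x i.succ - ∑ i : Fin (n + 1), withEnds x i.castSucc := by
    rw [← Finset.sum_sub_distrib]; rfl
  have h2 := Fin.sum_univ_succ (withEnds x)
  have h3 := Fin.sum_univ_castSucc (withEnds x)
  rw [withEnds_zero] at h2
  rw [← Fin.succ_last, withEnds_last] at h3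
  linarith

theorem withEnds_mem_Icc {x : Fin n → ℝ} (hx : x ∈ orderedSimplex n) (k : Fin (n + 2)) :
    withEnds x k ∈ Icc (0 : ℝ) 1 := by
  refine withEnds_cases (p := fun k => withEnds x k ∈ Icc (0 : ℝ) 1) ?_ ?_ (fun i => ?_) k
  · simp
  · rw [withEnds_last]; simp
  · rw [withEnds_mid]; exact hx.2 i

theorem mem_orderedSimplex_iff {x : Fin n → ℝ} :
    x ∈ orderedSimplex n ↔ ∀ i, 0 ≤ gap x i := by
  constructor
  · intro hx i
    rw [gap, sub_nonneg]
    refine Fin.lastCases ?_ (fun j => ?_) i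
    · rw [withEnds_last]; exact (withEnds_mem_Icc hx _).2
    · rw [withEnds_mid]
      rcases Fin.eq_zero_or_eq_succ j.castSucc with h | ⟨l, hl⟩
      · rw [h]; exact (hx.2 j).1
      · have h2 : (j.castSucc).castSucc = l.castSucc.succ := by
          rw [hl]; rfl
        have hlj : (l : ℕ) + 1 = j := by
          have := congrArg Fin.val hl
          simpa using this.symm
        have h3 : (j.castSucc).castSucc =
            (Fin.castSucc (⟨l, by omega⟩ : Fin n)).succ := by
          rw [h2]
        rw [h3, withEnds_mid]
        exact hx.1 (Fin.le_def.2 (by simp only; omega))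
  · intro h
    have hm : Monotone (withEnds x) := Fin.monotone_iff_le_succ.2 fun i => sub_nonneg.1 (h i)
    refine ⟨fun i j hij => ?_, fun i => ⟨?_, ?_⟩⟩
    · have := hm (show i.castSucc.succ ≤ j.castSucc.succ by simpa using hij)
      simpa using this
    · have := hm (Fin.zero_le i.castSucc.succ)
      simpa using this
    · have := hm (Fin.le_last i.castSucc.succ)
      rw [← Fin.succ_last, withEnds_last, withEnds_mid] at this
      exact this

theorem isCompact_orderedSimplex (n : ℕ) : IsCompact (orderedSimplex n) := by
  have h1 : IsCompact (Set.pi univ fun _ : Fin n => Icc (0 : ℝ) 1) :=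
    isCompact_univ_pi fun _ => isCompact_Icc
  refine h1.of_isClosed_subset ?_ fun x hx i _ => hx.2 i
  have : orderedSimplex n = ⋂ i, {x | 0 ≤ gap x i} := by
    ext x
    simp only [mem_iInter]
    exact mem_orderedSimplex_iff
  rw [this]
  exact isClosed_iInter fun i => isClosed_le continuous_const (continuous_gap i)

/-- Without particles the single gap is constant. Otherwise a gap ending at a particle is detected
by that particle's coordinate vector, and the last gap by the constant vector 1. -/
theorem gapLin_ne_zero_or (i : Fin (n + 1)) : gapLin n i ≠ 0 ∨ ∀ x : Fin n → ℝ, gap x i = 1 := by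
  rcases Nat.eq_zero_or_pos n with h | h
  · right
    subst h
    intro x
    have h2 : i = 0 := Fin.eq_zero i
    have := sum_gap x
    rw [Fin.sum_univ_one] at this
    rw [h2, this]
  · left
    intro h0
    have hz : ∀ x : Fin n → ℝ, gapLin n i x = 0 := fun x => by rw [h0]; rfl
    rcases Fin.eq_castSucc_or_eq_last i with ⟨j, rfl⟩ | rfl
    · have h1 := hz fun k => if k = j then 1 else 0
      rw [gapLin, sub_apply, endsLin_mid, if_pos rfl] at h1
      have h2 : endsLin n j.castSucc.castSucc (fun k => if k = j then (1 : ℝ) else 0) = 0 := by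
        rcases Fin.eq_zero_or_eq_succ j.castSucc with h | ⟨l, hl⟩
        · rw [h]; rfl
        · have hlj : (l : ℕ) + 1 = j := by
            have := congrArg Fin.val hl
            simpa using this.symm
          have h3 : (j.castSucc).castSucc =
              (Fin.castSucc (⟨l, by omega⟩ : Fin n)).succ := by
            rw [hl]; rfl
          rw [h3, endsLin_mid, if_neg]
          intro h
          have := congrArg Fin.val h
          simp only at this
          omega
      rw [h2] at h1
      norm_num at h1
    · obtain ⟨m, rfl⟩ : ∃ m, n = m + 1 := ⟨n - 1, by omega⟩
      have h1 := hz fun _ => 1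
      rw [gapLin, sub_apply, endsLin_last] at h1
      have h2 : (Fin.last (m + 1)).castSucc = (Fin.castSucc (Fin.last m)).succ := rfl
      rw [h2, endsLin_mid] at h1
      norm_num at h1

/-- The zero set is empty or a proper affine subspace. Hence almost surely all gaps are positive and
their negative powers are harmless. -/
theorem volume_gap_eq_zero (i : Fin (n + 1)) :
    volume {x : Fin n → ℝ | gap x i = 0} = 0 := by
  rcases gapLin_ne_zero_or i with h | h
  · by_cases hp : ∃ p : Fin n → ℝ, gap p i = 0
    · obtain ⟨p, hp⟩ := hp
      have heq : {x : Fin n → ℝ | gap x i = 0} =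
          (AffineSubspace.mk' p (LinearMap.ker (gapLin n i).toLinearMap) : Set (Fin n → ℝ)) := by
        ext x
        rw [SetLike.mem_coe, AffineSubspace.mem_mk', LinearMap.mem_ker, vsub_eq_sub, map_sub]
        have h1 : ∀ y : Fin n → ℝ, gap y i = gapLin n i y + gap (0 : Fin n → ℝ) i := by
          intro y
          simp only [gap, gapLin, sub_apply]
          rw [withEnds_eq y, withEnds_eq y]; ring
        have h2 := h1 p
        rw [hp] at h2
        change gap x i = 0 ↔ gapLin n i x - gapLin n i p = 0
        rw [h1 x]
        constructor <;> intro h <;> linarith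
      rw [heq]
      refine Measure.addHaar_affineSubspace _ _ fun htop => h ?_
      have h1 := AffineSubspace.direction_mk' p (LinearMap.ker (gapLin n i).toLinearMap)
      rw [htop, AffineSubspace.direction_top] at h1
      ext1 v
      have : v ∈ LinearMap.ker (gapLin n i).toLinearMap := by rw [← h1]; trivial
      exact this
    · have : {x : Fin n → ℝ | gap x i = 0} = ∅ := by
        ext x; exact ⟨fun hx => hp ⟨x, hx⟩, fun hx => hx.elim⟩
      rw [this, measure_empty]
  · have : {x : Fin n → ℝ | gap x i = 0} = ∅ := by
      ext x
      refine ⟨fun hx => ?_, fun hx => hx.elim⟩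
      have h1 : gap x i = 0 := hx
      rw [h x] at h1
      norm_num at h1
    rw [this, measure_empty]

end Simplex

/-! ### Regularised powers -/

/-- A continuously differentiable approximation of `r ^ (a - 1)`, vanishing for `r ≤ 0`. -/
def regPow (a ε r : ℝ) : ℝ := max r 0 ^ (a + 1) / (r ^ 2 + ε)

/-- The derivative of `regPow`. -/
def regPow' (a ε r : ℝ) : ℝ :=
  ((a + 1) * max r 0 ^ a * (r ^ 2 + ε) - max r 0 ^ (a + 1) * (2 * r)) / (r ^ 2 + ε) ^ 2

/-- Away from 0 the function is a power or zero. At 0 the derivative is obtained as a limit of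
derivatives, which is continuous since a > 0. -/
theorem hasDerivAt_max_rpow {a : ℝ} (ha : 0 < a) (r : ℝ) :
    HasDerivAt (fun r : ℝ => max r 0 ^ (a + 1)) ((a + 1) * max r 0 ^ a) r := by
  have hc : ∀ b : ℝ, 0 < b → Continuous fun r : ℝ => max r 0 ^ b := fun b hb =>
    (continuous_id.max continuous_const).rpow_const fun _ => Or.inr hb.le
  refine hasDerivAt_of_hasDerivAt_of_ne' (x := 0) (f := fun r : ℝ => max r 0 ^ (a + 1))
    (g := fun r => (a + 1) * max r 0 ^ a) ?_
    (hc _ (by linarith)).continuousAt ((hc a ha).const_mul _).continuousAt r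
  intro y hy
  rcases lt_or_gt_of_ne hy with h | h
  · have h1 : (fun r : ℝ => max r 0 ^ (a + 1)) =ᶠ[𝓝 y] fun _ => 0 := by
      filter_upwards [Iio_mem_nhds h] with r hr
      rw [max_eq_right (le_of_lt hr), Real.zero_rpow (by linarith)]
    have h2 : (a + 1) * max y 0 ^ a = 0 := by
      rw [max_eq_right h.le, Real.zero_rpow ha.ne', mul_zero]
    rw [h2]
    exact (hasDerivAt_const y (0 : ℝ)).congr_of_eventuallyEq h1
  · have h1 : (fun r : ℝ => max r 0 ^ (a + 1)) =ᶠ[𝓝 y] fun r => r ^ (a + 1) := by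
      filter_upwards [Ioi_mem_nhds h] with r hr
      rw [max_eq_left (le_of_lt hr)]
    rw [max_eq_left h.le]
    have := Real.hasDerivAt_rpow_const (x := y) (p := a + 1) (Or.inl h.ne')
    rw [add_sub_cancel_right] at this
    exact this.congr_of_eventuallyEq h1

theorem hasDerivAt_regPow {a ε : ℝ} (ha : 0 < a) (hε : 0 < ε) (r : ℝ) :
    HasDerivAt (regPow a ε) (regPow' a ε r) r := by
  have h1 : HasDerivAt (fun r : ℝ => r ^ 2 + ε) (2 * r) r := by
    simpa using (hasDerivAt_pow 2 r).add_const ε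
  exact (hasDerivAt_max_rpow ha r).div h1 (by positivity)

theorem continuous_regPow' {a ε : ℝ} (ha : 0 < a) (hε : 0 < ε) : Continuous (regPow' a ε) := by
  have hc : ∀ b : ℝ, 0 < b → Continuous fun r : ℝ => max r 0 ^ b := fun b hb =>
    (continuous_id.max continuous_const).rpow_const fun _ => Or.inr hb.le
  have h1 := hc a ha
  have h2 := hc (a + 1) (by linarith)
  unfold regPow'
  refine Continuous.div (by fun_prop) (by fun_prop) fun r => by positivity

theorem contDiff_regPow {a ε : ℝ} (ha : 0 < a) (hε : 0 < ε) : ContDiff ℝ 1 (regPow a ε) := by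
  rw [contDiff_one_iff_deriv]
  refine ⟨fun r => (hasDerivAt_regPow ha hε r).differentiableAt, ?_⟩
  rw [show deriv (regPow a ε) = regPow' a ε from funext fun r => (hasDerivAt_regPow ha hε r).deriv]
  exact continuous_regPow' ha hε

theorem regPow_of_nonpos {a ε r : ℝ} (ha : 0 < a) (hr : r ≤ 0) : regPow a ε r = 0 := by
  rw [regPow, max_eq_right hr, Real.zero_rpow (by linarith), zero_div]

theorem regPow'_of_nonpos {a ε r : ℝ} (ha : 0 < a) (hr : r ≤ 0) : regPow' a ε r = 0 := by
  rw [regPow', max_eq_right hr, Real.zero_rpow ha.ne', Real.zero_rpow (by linarith)]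
  simp

/-- The factor r² / (r² + ε) lies in [0, 1] and tends to 1 as ε → 0, so this form yields both the
domination and the limit. -/
theorem regPow_eq {a ε r : ℝ} (hr : 0 < r) :
    regPow a ε r = r ^ 2 / (r ^ 2 + ε) * r ^ (a - 1) := by
  have h : r ^ (a + 1) = r ^ 2 * r ^ (a - 1) := by
    rw [← Real.rpow_natCast, ← Real.rpow_add hr]; congr 1; push_cast; ring
  rw [regPow, max_eq_left hr.le, h]; ring

/-- After multiplication by r the derivative is comparable to r^(a-1) uniformly in ε. The increment
of φ over a gap of length r supplies this factor. -/
theorem mul_regPow'_eq {a ε r : ℝ} (hr : 0 < r) (hε : 0 < ε) :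
    r * regPow' a ε r = ((a + 1) * (r ^ 2 / (r ^ 2 + ε)) - 2 * (r ^ 2 / (r ^ 2 + ε)) ^ 2) *
      r ^ (a - 1) := by
  have h : r ^ (a + 1) = r ^ 2 * r ^ (a - 1) := by
    rw [← Real.rpow_natCast, ← Real.rpow_add hr]; congr 1; push_cast; ring
  have h' : r ^ a = r * r ^ (a - 1) := by
    nth_rw 2 [← Real.rpow_one r]
    rw [← Real.rpow_add hr]; congr 1; ring
  have h3 : r ^ 2 + ε ≠ 0 := by positivity
  rw [regPow', max_eq_left hr.le, h, h']
  field_simp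

theorem regPow_nonneg {a ε : ℝ} (hε : 0 < ε) (r : ℝ) : 0 ≤ regPow a ε r := by
  unfold regPow
  positivity

theorem ratio_mem {ε r : ℝ} (hε : 0 < ε) : r ^ 2 / (r ^ 2 + ε) ∈ Icc (0 : ℝ) 1 :=
  ⟨by positivity, div_le_one_of_le₀ (by linarith) (by positivity)⟩

theorem regPow_le {a ε r : ℝ} (hr : 0 < r) (hε : 0 < ε) : regPow a ε r ≤ r ^ (a - 1) := by
  rw [regPow_eq hr]
  exact mul_le_of_le_one_left (by positivity) (ratio_mem hε).2

theorem abs_mul_regPow'_le {a ε r : ℝ} (ha : 0 < a) (hr : 0 < r) (hε : 0 < ε) :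
    |r * regPow' a ε r| ≤ (a + 3) * r ^ (a - 1) := by
  rw [mul_regPow'_eq hr hε, abs_mul, abs_of_nonneg (Real.rpow_nonneg hr.le _)]
  gcongr
  obtain ⟨h1, h2⟩ := ratio_mem (r := r) hε
  set q := r ^ 2 / (r ^ 2 + ε)
  rw [abs_le]
  constructor <;> nlinarith

/-! ### Integration by parts for the particle measures -/

/-- Twice continuously differentiable functions with bounded derivatives. -/
structure BddC2 (ψ : ℝ → ℝ) : Prop where
  contDiff : ContDiff ℝ 2 ψ
  bound : ∃ C, 0 ≤ C ∧ ∀ x, |ψ x| ≤ C ∧ |deriv ψ x| ≤ C ∧ |deriv (deriv ψ) x| ≤ C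

/-- Vector fields on `[0,1]` vanishing at the end points. -/
structure VecField (φ : ℝ → ℝ) : Prop extends BddC2 φ where
  zero : φ 0 = 0
  one : φ 1 = 0

theorem BddC2.differentiable {ψ : ℝ → ℝ} (h : BddC2 ψ) : Differentiable ℝ ψ :=
  h.contDiff.differentiable (by norm_num)

theorem BddC2.continuous {ψ : ℝ → ℝ} (h : BddC2 ψ) : Continuous ψ := h.contDiff.continuous

theorem BddC2.contDiff_deriv {ψ : ℝ → ℝ} (h : BddC2 ψ) : ContDiff ℝ 1 (deriv ψ) :=
  (contDiff_succ_iff_deriv (n := 1)).1 (by simpa [one_add_one_eq_two] using h.contDiff) |>.2.2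

theorem BddC2.continuous_deriv {ψ : ℝ → ℝ} (h : BddC2 ψ) : Continuous (deriv ψ) :=
  h.contDiff_deriv.continuous

theorem BddC2.hasDerivAt {ψ : ℝ → ℝ} (h : BddC2 ψ) (x : ℝ) : HasDerivAt ψ (deriv ψ x) x :=
  (h.differentiable x).hasDerivAt

/-- The divergence of the vector field `x ↦ (φ x₁, …, φ x_n)` with respect to the particle
measure. -/
def vecDiv (β : ℝ) (n : ℕ) (φ : ℝ → ℝ) (x : Fin n → ℝ) : ℝ :=
  ∑ i, deriv φ (x i) + (β / (n + 1 : ℕ) - 1) *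
    ∑ i : Fin (n + 1), (φ (withEnds x i.succ) - φ (withEnds x i.castSucc)) / gap x i

theorem clm_apply_eq_sum {ι : Type*} [Fintype ι] [DecidableEq ι] (A : (ι → ℝ) →L[ℝ] ℝ)
    (v : ι → ℝ) :
    A v = ∑ i, v i * A (Pi.single i 1) := by
  conv_lhs => rw [pi_eq_sum_univ' v]
  rw [map_sum]
  refine Finset.sum_congr rfl fun i _ => ?_
  rw [map_smul, smul_eq_mul]

/-- Divergence theorem for compactly supported vector fields of the form `F(x) (φ x₁, …, φ x_n)`. -/
theorem integral_div_eq_zero {n : ℕ} {φ : ℝ → ℝ} (hφ : ContDiff ℝ 1 φ) {F : (Fin n → ℝ) → ℝ}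
    (hF : ContDiff ℝ 1 F) (hc : HasCompactSupport F) :
    ∫ x, (fderiv ℝ F x (fun i => φ (x i)) + F x * ∑ i, deriv φ (x i)) = 0 := by
  have hG : ∀ i : Fin n, ContDiff ℝ 1 fun x : Fin n → ℝ => φ (x i) * F x := fun i =>
    (hφ.comp (contDiff_apply ℝ ℝ i)).mul hF
  have hGc : ∀ i : Fin n, HasCompactSupport fun x : Fin n → ℝ => φ (x i) * F x := fun i =>
    hc.mul_left
  have hint : ∀ i : Fin n, Integrable fun x =>
      fderiv ℝ (fun x : Fin n → ℝ => φ (x i) * F x) x (Pi.single i 1) := fun i =>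
    Continuous.integrable_of_hasCompactSupport
      (((hG i).continuous_fderiv (by norm_num)).clm_apply continuous_const)
      ((hGc i).fderiv_apply ℝ _)
  have hz : ∀ i : Fin n,
      ∫ x, fderiv ℝ (fun x : Fin n → ℝ => φ (x i) * F x) x (Pi.single i 1) = 0 := by
    intro i
    -- Integration by parts against the constant 1 says that the integral of a directional
    -- derivative vanishes.
    have h := integral_mul_fderiv_eq_neg_fderiv_mul_of_integrable (μ := (volume : Measure (Fin n → ℝ)))
      (f := fun _ : Fin n → ℝ => (1 : ℝ)) (g := fun x : Fin n → ℝ => φ (x i) * F x)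
      (v := Pi.single i 1) (by simp) (by simpa using hint i)
      (by simpa using (hG i).continuous.integrable_of_hasCompactSupport (hGc i))
      (fun _ _ => differentiableAt_const _)
      (fun x _ => (hG i).differentiable (by norm_num) x)
    simpa using h
  have hsum : ∀ x, fderiv ℝ F x (fun i => φ (x i)) + F x * ∑ i, deriv φ (x i) =
      ∑ i, fderiv ℝ (fun x : Fin n → ℝ => φ (x i) * F x) x (Pi.single i 1) := by
    intro x
    rw [clm_apply_eq_sum, Finset.mul_sum, ← Finset.sum_add_distrib]
    refine Finset.sum_congr rfl fun i _ => ?_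
    have h1 : HasFDerivAt (fun x : Fin n → ℝ => φ (x i))
        (deriv φ (x i) • ContinuousLinearMap.proj (R := ℝ) (φ := fun _ : Fin n => ℝ) i) x :=
      HasDerivAt.comp_hasFDerivAt (h₂ := φ) (f := fun x : Fin n → ℝ => x i) x
        ((hφ.differentiable (by norm_num) _).hasDerivAt) (hasFDerivAt_apply i x)
    have h2 := h1.mul (hF.differentiable (by norm_num) x).hasFDerivAt
    rw [show fderiv ℝ (fun x : Fin n → ℝ => φ (x i) * F x) x = _ from h2.fderiv]
    simp
  simp_rw [hsum]
  rw [integral_finsetSum _ fun i _ => hint i]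
  exact Finset.sum_eq_zero fun i _ => hz i

/-! ### Integration by parts for the regularised Dirichlet density, and its limit -/

section RegWeight

variable {n : ℕ} {a : ℝ}

/-- The regularised Dirichlet density. -/
def regWeight (n : ℕ) (a ε : ℝ) (x : Fin n → ℝ) : ℝ := ∏ i, regPow a ε (gap x i)

theorem contDiff_regWeight (ha : 0 < a) {ε : ℝ} (hε : 0 < ε) :
    ContDiff ℝ 1 (regWeight n a ε) :=
  contDiff_prod fun i _ => (contDiff_regPow ha hε).comp (contDiff_gap i)

theorem exists_gap_neg {x : Fin n → ℝ} (hx : x ∉ orderedSimplex n) : ∃ i, gap x i < 0 := by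
  rw [mem_orderedSimplex_iff] at hx
  push Not at hx
  exact hx

theorem regWeight_eq_zero (ha : 0 < a) {ε : ℝ} {x : Fin n → ℝ} (hx : x ∉ orderedSimplex n) :
    regWeight n a ε x = 0 := by
  obtain ⟨i, hi⟩ := exists_gap_neg hx
  exact Finset.prod_eq_zero (Finset.mem_univ i) (regPow_of_nonpos ha hi.le)

theorem hasFDerivAt_regWeight (ha : 0 < a) {ε : ℝ} (hε : 0 < ε) (x : Fin n → ℝ) :
    HasFDerivAt (regWeight n a ε)
      (∑ i, (∏ j ∈ Finset.univ.erase i, regPow a ε (gap x j)) •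
        (regPow' a ε (gap x i) • gapLin n i)) x := by
  have h := HasFDerivAt.finsetProd (u := Finset.univ) (x := x)
    (g := fun (i : Fin (n + 1)) (x : Fin n → ℝ) => regPow a ε (gap x i))
    (g' := fun i => regPow' a ε (gap x i) • gapLin n i) fun i _ =>
      HasDerivAt.comp_hasFDerivAt (h₂ := regPow a ε) (f := fun x : Fin n → ℝ => gap x i) x
        (hasDerivAt_regPow ha hε _) (hasFDerivAt_gap i x)
  exact h

/-- The divergence of `f(x) (φ x₁, …, φ x_n)` with respect to `regWeight`, times `regWeight`. -/
def regDiv (n : ℕ) (a ε : ℝ) (φ : ℝ → ℝ) (f : (Fin n → ℝ) → ℝ) (x : Fin n → ℝ) : ℝ :=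
  fderiv ℝ f x (fun i => φ (x i)) * regWeight n a ε x +
    f x * (∑ i, (∏ j ∈ Finset.univ.erase i, regPow a ε (gap x j)) *
      (regPow' a ε (gap x i) *
        (φ (withEnds x i.succ) - φ (withEnds x i.castSucc)))) +
    f x * regWeight n a ε x * ∑ i, deriv φ (x i)

theorem gapLin_comp {φ : ℝ → ℝ} (h0 : φ 0 = 0) (h1 : φ 1 = 0) (x : Fin n → ℝ)
    (i : Fin (n + 1)) : gapLin n i (fun i => φ (x i)) =
      φ (withEnds x i.succ) - φ (withEnds x i.castSucc) := by
  rw [gapLin, sub_apply, endsLin_comp h0 h1, endsLin_comp h0 h1]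

/-- The regularised density is C¹ on the whole space and vanishes off the compact simplex, so the
divergence theorem applies without boundary terms, however singular the true density is. -/
theorem integral_regDiv (ha : 0 < a) {ε : ℝ} (hε : 0 < ε) {φ : ℝ → ℝ} (hφ : ContDiff ℝ 1 φ)
    (h0 : φ 0 = 0) (h1 : φ 1 = 0) {f : (Fin n → ℝ) → ℝ} (hf : ContDiff ℝ 1 f) :
    ∫ x, regDiv n a ε φ f x = 0 := by
  have hc : HasCompactSupport fun x => f x * regWeight n a ε x :=
    HasCompactSupport.intro (isCompact_orderedSimplex n) fun x hx => by
      rw [regWeight_eq_zero ha hx, mul_zero]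
  rw [← integral_div_eq_zero hφ (hf.mul (contDiff_regWeight ha hε)) hc]
  refine integral_congr_ae (Eventually.of_forall fun x => ?_)
  have h2 := (hf.differentiable (by norm_num) x).hasFDerivAt.mul (hasFDerivAt_regWeight ha hε x)
  simp only
  rw [show fderiv ℝ (fun x => f x * regWeight n a ε x) x = _ from h2.fderiv]
  simp only [regDiv, add_apply, smul_apply, smul_eq_mul,
    sum_apply, gapLin_comp h0 h1]
  ring

theorem regDiv_eq_zero (ha : 0 < a) {ε : ℝ} {φ : ℝ → ℝ} {f : (Fin n → ℝ) → ℝ} {x : Fin n → ℝ}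
    (hx : x ∉ orderedSimplex n) : regDiv n a ε φ f x = 0 := by
  obtain ⟨k, hk⟩ := exists_gap_neg hx
  have h : ∑ i, (∏ j ∈ Finset.univ.erase i, regPow a ε (gap x j)) *
      (regPow' a ε (gap x i) * (φ (withEnds x i.succ) - φ (withEnds x i.castSucc))) = 0 := by
    refine Finset.sum_eq_zero fun i _ => ?_
    by_cases hik : i = k
    · rw [hik, regPow'_of_nonpos ha hk.le]; ring
    · rw [Finset.prod_eq_zero (i := k) (by simp [Ne.symm hik]) (regPow_of_nonpos ha hk.le)]; ring
  rw [regDiv, regWeight_eq_zero ha hx, h]; ring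

/-- The Dirichlet density, up to normalisation. -/
def gapWeight (n : ℕ) (a : ℝ) (x : Fin n → ℝ) : ℝ := ∏ i, gap x i ^ (a - 1)

theorem regPow_tendsto {r : ℝ} (hr : 0 < r) :
    Tendsto (fun k : ℕ => r ^ 2 / (r ^ 2 + 1 / ((k : ℝ) + 1))) atTop (𝓝 1) := by
  have h := tendsto_const_nhds (x := r ^ 2).div
    (tendsto_const_nhds (x := r ^ 2).add (tendsto_one_div_add_atTop_nhds_zero_nat (𝕜 := ℝ)))
    (by positivity)
  rwa [add_zero, div_self (by positivity)] at h

theorem tendsto_regPow {r : ℝ} (hr : 0 < r) :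
    Tendsto (fun k : ℕ => regPow a (1 / ((k : ℝ) + 1)) r) atTop (𝓝 (r ^ (a - 1))) := by
  have h := (regPow_tendsto hr).mul_const (r ^ (a - 1))
  rw [one_mul] at h
  exact h.congr fun k => (regPow_eq hr).symm

theorem tendsto_mul_regPow' {r : ℝ} (hr : 0 < r) :
    Tendsto (fun k : ℕ => r * regPow' a (1 / ((k : ℝ) + 1)) r) atTop
      (𝓝 ((a - 1) * r ^ (a - 1))) := by
  have h := (((regPow_tendsto hr).const_mul (a + 1)).sub
    (((regPow_tendsto hr).pow 2).const_mul 2)).mul_const (r ^ (a - 1))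
  have h2 : (a + 1) * 1 - 2 * 1 ^ 2 = a - 1 := by ring
  rw [h2] at h
  exact h.congr fun k => (mul_regPow'_eq hr (by positivity)).symm

/-- The limit of `regDiv`. -/
theorem tendsto_regDiv {φ : ℝ → ℝ} {f : (Fin n → ℝ) → ℝ} {x : Fin n → ℝ}
    (hx : ∀ i, 0 < gap x i) :
    Tendsto (fun k : ℕ => regDiv n a (1 / ((k : ℝ) + 1)) φ f x) atTop
      (𝓝 ((fderiv ℝ f x (fun i => φ (x i)) + f x * (∑ i, deriv φ (x i) + (a - 1) *
        ∑ i : Fin (n + 1), (φ (withEnds x i.succ) - φ (withEnds x i.castSucc)) / gap x i)) *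
          gapWeight n a x)) := by
  have hw : Tendsto (fun k : ℕ => regWeight n a (1 / ((k : ℝ) + 1)) x) atTop
      (𝓝 (gapWeight n a x)) := tendsto_finsetProd _ fun i _ => tendsto_regPow (hx i)
  have hs : Tendsto (fun k : ℕ => ∑ i, (∏ j ∈ Finset.univ.erase i,
      regPow a (1 / ((k : ℝ) + 1)) (gap x j)) * (regPow' a (1 / ((k : ℝ) + 1)) (gap x i) *
        (φ (withEnds x i.succ) - φ (withEnds x i.castSucc)))) atTop
      (𝓝 (∑ i, (a - 1) * ((φ (withEnds x i.succ) - φ (withEnds x i.castSucc)) / gap x i) *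
        gapWeight n a x)) := by
    refine tendsto_finsetSum _ fun i _ => ?_
    -- The i-th factor is multiplied and divided by `gap x i`, so that `tendsto_mul_regPow'`
    -- applies.
    have h1 := tendsto_finsetProd (Finset.univ.erase i) fun j _ => tendsto_regPow (a := a) (hx j)
    have h2 := (h1.mul ((tendsto_mul_regPow' (a := a) (hx i)).mul_const
      ((φ (withEnds x i.succ) - φ (withEnds x i.castSucc)) / gap x i)))
    have h3 : (∏ j ∈ Finset.univ.erase i, gap x j ^ (a - 1)) * ((a - 1) * gap x i ^ (a - 1) *
        ((φ (withEnds x i.succ) - φ (withEnds x i.castSucc)) / gap x i)) =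
        (a - 1) * ((φ (withEnds x i.succ) - φ (withEnds x i.castSucc)) / gap x i) *
        gapWeight n a x := by
      rw [gapWeight, ← Finset.mul_prod_erase _ _ (Finset.mem_univ i)]; ring
    rw [h3] at h2
    refine h2.congr fun k => ?_
    have := (hx i).ne'
    field_simp
  have h := ((hw.const_mul (fderiv ℝ f x fun i => φ (x i))).add (hs.const_mul (f x))).add
    ((hw.const_mul (f x)).mul_const (∑ i, deriv φ (x i)))
  rw [← Finset.sum_mul, ← Finset.mul_sum] at h
  refine h.trans_eq (congrArg 𝓝 ?_)
  ring

/-- Domination uniform in ε: the Lipschitz bound on φ turns its increment into C times the gap,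
which tames the derivative of the regularised power. -/
theorem abs_regDiv_le (ha : 0 < a) {ε : ℝ} (hε : 0 < ε) {φ : ℝ → ℝ} {f : (Fin n → ℝ) → ℝ}
    {x : Fin n → ℝ} (hx : ∀ i, 0 < gap x i) {A B C : ℝ}
    (hA : |fderiv ℝ f x (fun i => φ (x i))| ≤ A) (hB : |f x| ≤ B)
    (hC0 : 0 ≤ C) (hC : ∀ y, |deriv φ y| ≤ C)
    (hL : ∀ y z, |φ y - φ z| ≤ C * |y - z|) :
    |regDiv n a ε φ f x| ≤ (A + B * ((n + 1) * ((a + 3) * C)) + B * (n * C)) * gapWeight n a x := by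
  have hB0 : 0 ≤ B := (abs_nonneg _).trans hB
  have hA0 : 0 ≤ A := (abs_nonneg _).trans hA
  have hw0 : 0 ≤ regWeight n a ε x := Finset.prod_nonneg fun i _ => regPow_nonneg hε _
  have hw : regWeight n a ε x ≤ gapWeight n a x :=
    Finset.prod_le_prod (fun i _ => regPow_nonneg hε _) fun i _ => regPow_le (hx i) hε
  have hg0 : 0 ≤ gapWeight n a x := hw0.trans hw
  have hd : |∑ i, deriv φ (x i)| ≤ n * C := by
    refine (Finset.abs_sum_le_sum_abs _ _).trans ?_
    refine (Finset.sum_le_card_nsmul _ _ C fun i _ => hC _).trans ?_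
    simp
  have hs : |∑ i, (∏ j ∈ Finset.univ.erase i, regPow a ε (gap x j)) * (regPow' a ε (gap x i) *
      (φ (withEnds x i.succ) - φ (withEnds x i.castSucc)))| ≤
      (n + 1) * ((a + 3) * C) * gapWeight n a x := by
    refine (Finset.abs_sum_le_sum_abs _ _).trans ?_
    refine (Finset.sum_le_card_nsmul _ _ ((a + 3) * C * gapWeight n a x) fun i _ => ?_).trans ?_
    · have h1 : 0 ≤ ∏ j ∈ Finset.univ.erase i, regPow a ε (gap x j) :=
        Finset.prod_nonneg fun i _ => regPow_nonneg hε _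
      have h2 : ∏ j ∈ Finset.univ.erase i, regPow a ε (gap x j) ≤
          ∏ j ∈ Finset.univ.erase i, gap x j ^ (a - 1) :=
        Finset.prod_le_prod (fun i _ => regPow_nonneg hε _) fun i _ => regPow_le (hx i) hε
      have h3 : |regPow' a ε (gap x i) * (φ (withEnds x i.succ) - φ (withEnds x i.castSucc))| ≤
          (a + 3) * C * gap x i ^ (a - 1) := by
        have h4 := abs_mul_regPow'_le ha (hx i) hε
        have h5 := hL (withEnds x i.succ) (withEnds x i.castSucc)
        rw [abs_mul] at h4 ⊢
        calc |regPow' a ε (gap x i)| * |φ (withEnds x i.succ) - φ (withEnds x i.castSucc)|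
            ≤ |regPow' a ε (gap x i)| * (C * |gap x i|) := by gcongr; exact h5
          _ = C * (|gap x i| * |regPow' a ε (gap x i)|) := by ring
          _ ≤ C * ((a + 3) * gap x i ^ (a - 1)) := by gcongr
          _ = _ := by ring
      rw [abs_mul, abs_of_nonneg h1, gapWeight, ← Finset.mul_prod_erase _ _ (Finset.mem_univ i)]
      calc _ ≤ (∏ j ∈ Finset.univ.erase i, gap x j ^ (a - 1)) *
            ((a + 3) * C * gap x i ^ (a - 1)) := by
            gcongr
            exact h1.trans h2
        _ = _ := by ring
    · simp only [Finset.card_univ, Fintype.card_fin, nsmul_eq_mul, Nat.cast_add, Nat.cast_one]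
      exact le_of_eq (by ring)
  unfold regDiv
  refine (abs_add_le _ _).trans ?_
  refine (add_le_add_left (abs_add_le _ _) _).trans ?_
  have e1 : |fderiv ℝ f x (fun i => φ (x i)) * regWeight n a ε x| ≤ A * gapWeight n a x := by
    rw [abs_mul, abs_of_nonneg hw0]; gcongr
  have e2 := mul_le_mul hB hs (abs_nonneg _) hB0
  rw [← abs_mul] at e2
  have e3 : |f x * regWeight n a ε x * ∑ i, deriv φ (x i)| ≤ B * gapWeight n a x * (n * C) := by
    rw [abs_mul, abs_mul, abs_of_nonneg hw0]; gcongr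
  linarith

end RegWeight

theorem BddC2.abs_sub_le {ψ : ℝ → ℝ} (h : BddC2 ψ) {C : ℝ} (hC : ∀ x, |deriv ψ x| ≤ C) (y z : ℝ) :
    |ψ y - ψ z| ≤ C * |y - z| :=
  Convex.norm_image_sub_le_of_norm_deriv_le (s := univ) (fun x _ => h.differentiable x)
    (fun x _ => hC x) convex_univ (mem_univ z) (mem_univ y)

theorem BddC2.abs_deriv_sub_le {ψ : ℝ → ℝ} (h : BddC2 ψ) {C : ℝ}
    (hC : ∀ x, |deriv (deriv ψ) x| ≤ C) (y z : ℝ) :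
    |deriv ψ y - deriv ψ z| ≤ C * |y - z| :=
  Convex.norm_image_sub_le_of_norm_deriv_le (s := univ)
    (fun x _ => h.contDiff_deriv.differentiable (by norm_num) x)
    (fun x _ => hC x) convex_univ (mem_univ z) (mem_univ y)

/-! ### The particle measures: integrability, integration by parts, bounds on the divergence -/

section Particle

variable {n : ℕ} {β : ℝ}

theorem gapWeight_nonneg {a : ℝ} {x : Fin n → ℝ} (hx : x ∈ orderedSimplex n) :
    0 ≤ gapWeight n a x :=
  Finset.prod_nonneg fun i _ => Real.rpow_nonneg (mem_orderedSimplex_iff.1 hx i) _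

theorem measurable_gapWeight {a : ℝ} : Measurable (gapWeight n a) :=
  Finset.measurable_prod _ fun i _ => (continuous_gap i).measurable.pow_const _

/-- The normalising constant of the particle measure. -/
def particleConst (β : ℝ) (n : ℕ) : ℝ :=
  Real.Gamma (∑ _i : Fin (n + 1), β / (n + 1 : ℕ)) /
    ∏ _i : Fin (n + 1), Real.Gamma (β / (n + 1 : ℕ))

theorem particleConst_pos (hβ : 0 < β) : 0 < particleConst β n := by
  have ha : 0 < β / (n + 1 : ℕ) := by positivity
  refine div_pos (Real.Gamma_pos_of_pos ?_) (Finset.prod_pos fun _ _ => Real.Gamma_pos_of_pos ha)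
  exact Finset.sum_pos (fun _ _ => ha) Finset.univ_nonempty

theorem particleMeasure_eq : particleMeasure β n = (volume.restrict (orderedSimplex n)).withDensity
    fun x => ENNReal.ofReal (particleConst β n * gapWeight n (β / (n + 1 : ℕ)) x) := rfl

theorem measurableSet_orderedSimplex : MeasurableSet (orderedSimplex n) :=
  (isCompact_orderedSimplex n).isClosed.measurableSet

theorem ae_gap_pos_volume :
    ∀ᵐ x ∂(volume.restrict (orderedSimplex n)), ∀ i, 0 < gap x i := by
  rw [ae_restrict_iff' measurableSet_orderedSimplex]
  have h : ∀ᵐ x : Fin n → ℝ, ∀ i, gap x i ≠ 0 := by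
    rw [ae_all_iff]
    intro i
    rw [ae_iff]
    simpa using volume_gap_eq_zero i
  filter_upwards [h] with x hx hxS i
  exact lt_of_le_of_ne (mem_orderedSimplex_iff.1 hxS i) (hx i).symm

theorem ae_mem_particleMeasure :
    ∀ᵐ x ∂(particleMeasure β n), x ∈ orderedSimplex n ∧ ∀ i, 0 < gap x i := by
  have hac : particleMeasure β n ≪ volume.restrict (orderedSimplex n) :=
    withDensity_absolutelyContinuous _ _
  exact hac.ae_le ((ae_restrict_mem measurableSet_orderedSimplex).and ae_gap_pos_volume)

/-- No Dirichlet integral is computed. Integrability is read off from the finiteness of the particle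
measure, which later holds because that measure is an image of Q. -/
theorem integrableOn_gapWeight (hβ : 0 < β) [IsFiniteMeasure (particleMeasure β n)] :
    IntegrableOn (gapWeight n (β / (n + 1 : ℕ))) (orderedSimplex n) := by
  have hK : 0 < particleConst β n := particleConst_pos hβ
  have h1 : Integrable (fun x => particleConst β n * gapWeight n (β / (n + 1 : ℕ)) x)
      (volume.restrict (orderedSimplex n)) := by
    refine ⟨(measurable_gapWeight.const_mul _).aestronglyMeasurable, ?_⟩
    rw [hasFiniteIntegral_iff_ofReal]
    · have h2 := measure_lt_top (particleMeasure β n) univ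
      rwa [particleMeasure_eq, withDensity_apply _ MeasurableSet.univ, setLIntegral_univ] at h2
    · filter_upwards [ae_restrict_mem measurableSet_orderedSimplex] with x hx
      exact mul_nonneg hK.le (gapWeight_nonneg hx)
  have h2 := h1.const_mul (particleConst β n)⁻¹
  refine h2.congr (Eventually.of_forall fun x => ?_)
  field_simp

theorem integral_particleMeasure (hβ : 0 < β) (F : (Fin n → ℝ) → ℝ) :
    ∫ x, F x ∂(particleMeasure β n) = particleConst β n *
      ∫ x in orderedSimplex n, F x * gapWeight n (β / (n + 1 : ℕ)) x := by
  rw [particleMeasure_eq, integral_withDensity_eq_integral_toReal_smul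
    (measurable_gapWeight.const_mul _).ennreal_ofReal
    (Eventually.of_forall fun _ => ENNReal.ofReal_lt_top), ← integral_const_mul]
  refine setIntegral_congr_fun measurableSet_orderedSimplex fun x hx => ?_
  rw [ENNReal.toReal_ofReal (mul_nonneg (particleConst_pos hβ).le (gapWeight_nonneg hx)),
    smul_eq_mul]
  ring

/-- Integration by parts for the particle measure. -/
theorem integral_particle_div (hβ : 0 < β) [IsFiniteMeasure (particleMeasure β n)] {φ : ℝ → ℝ}
    (hφ : VecField φ) {f : (Fin n → ℝ) → ℝ} (hf : ContDiff ℝ 1 f) :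
    ∫ x, (fderiv ℝ f x (fun i => φ (x i)) + f x * vecDiv β n φ x) ∂(particleMeasure β n) = 0 := by
  have ha : 0 < β / (n + 1 : ℕ) := by positivity
  set a := β / (n + 1 : ℕ) with hadef
  obtain ⟨C, hC0, hC⟩ := hφ.bound
  have hφ1 : ContDiff ℝ 1 φ := hφ.contDiff.of_le (by norm_num)
  have hcA : Continuous fun x : Fin n → ℝ => fderiv ℝ f x (fun i => φ (x i)) :=
    (hf.continuous_fderiv (by norm_num)).clm_apply
      (continuous_pi fun i => hφ.continuous.comp (continuous_apply i))
  obtain ⟨A, hA⟩ := (isCompact_orderedSimplex n).exists_bound_of_continuousOn hcA.continuousOn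
  obtain ⟨B, hB⟩ :=
    (isCompact_orderedSimplex n).exists_bound_of_continuousOn hf.continuous.continuousOn
  -- Let ε = 1/(k+1) → 0: each regularised integral is zero, and so is the limit.
  have hlim := tendsto_integral_of_dominated_convergence
    (μ := volume.restrict (orderedSimplex n))
    (F := fun k : ℕ => regDiv n a (1 / ((k : ℝ) + 1)) φ f)
    (f := fun x => (fderiv ℝ f x (fun i => φ (x i)) + f x * vecDiv β n φ x) * gapWeight n a x)
    (fun x => (A + B * ((n + 1) * ((a + 3) * C)) + B * (n * C)) * gapWeight n a x)
    (fun k => by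
      have hk : (0 : ℝ) < 1 / ((k : ℝ) + 1) := by positivity
      have h1 := (contDiff_regWeight (n := n) ha hk).continuous
      have h2 := hf.continuous
      have h3 : ∀ k, Continuous fun x : Fin n → ℝ => φ (withEnds x k) := fun k =>
        hφ.continuous.comp (continuous_withEnds k)
      have h4 := hφ.continuous_deriv
      have h5 : ∀ i : Fin (n + 1), Continuous fun x : Fin n → ℝ =>
          regPow a (1 / ((k : ℝ) + 1)) (gap x i) := fun i =>
        (contDiff_regPow ha hk).continuous.comp (continuous_gap i)
      have h6 : ∀ i : Fin (n + 1), Continuous fun x : Fin n → ℝ =>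
          regPow' a (1 / ((k : ℝ) + 1)) (gap x i) := fun i =>
        (continuous_regPow' ha hk).comp (continuous_gap i)
      refine Continuous.aestronglyMeasurable ?_
      unfold regDiv
      refine ((hcA.mul h1).add (h2.mul (continuous_finsetSum _ fun i _ => ?_))).add
        ((h2.mul h1).mul (continuous_finsetSum _ fun i _ => h4.comp (continuous_apply i)))
      exact (continuous_finsetProd _ fun j _ => h5 j).mul
        ((h6 i).mul ((h3 i.succ).sub (h3 i.castSucc))))
    ((integrableOn_gapWeight hβ).const_mul _)
    (fun k => by
      have hk : (0 : ℝ) < 1 / ((k : ℝ) + 1) := by positivity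
      filter_upwards [ae_gap_pos_volume, ae_restrict_mem measurableSet_orderedSimplex] with x hx hxS
      exact abs_regDiv_le ha hk hx (hA x hxS) (hB x hxS) hC0 (fun y => (hC y).2.1)
        (hφ.abs_sub_le fun y => (hC y).2.1))
    (by
      filter_upwards [ae_gap_pos_volume] with x hx
      exact tendsto_regDiv hx)
  have hz : ∀ k : ℕ, ∫ x in orderedSimplex n, regDiv n a (1 / ((k : ℝ) + 1)) φ f x = 0 := by
    intro k
    rw [setIntegral_eq_integral_of_forall_compl_eq_zero fun x hx => regDiv_eq_zero ha hx]
    exact integral_regDiv ha (by positivity) hφ1 hφ.zero hφ.one hf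
  simp only [hz] at hlim
  rw [integral_particleMeasure hβ, ← tendsto_nhds_unique tendsto_const_nhds hlim, mul_zero]

/-- The bound must not depend on n. Each difference quotient is a value of φ' inside its gap, so it
differs from φ' at the left end by at most C times the gap. The gaps sum to 1, hence the two long
sums cancel up to C. The left end 0 of the first gap costs another C, and the remaining β/N times N
quotients cost βC. -/
theorem abs_vecDiv_le (hβ : 0 < β) {φ : ℝ → ℝ} (hφ : BddC2 φ) {C : ℝ}
    (hC : ∀ x, |deriv φ x| ≤ C ∧ |deriv (deriv φ) x| ≤ C) {x : Fin n → ℝ}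
    (hx : ∀ i, 0 < gap x i) : |vecDiv β n φ x| ≤ (β + 2) * C := by
  set q : Fin (n + 1) → ℝ := fun i =>
    (φ (withEnds x i.succ) - φ (withEnds x i.castSucc)) / gap x i with hq
  have hmv : ∀ i, |q i| ≤ C ∧ |deriv φ (withEnds x i.castSucc) - q i| ≤ C * gap x i := by
    intro i
    have hlt : withEnds x i.castSucc < withEnds x i.succ := sub_pos.1 (hx i)
    obtain ⟨z, hz, hzq⟩ := exists_deriv_eq_slope φ hlt hφ.continuous.continuousOn
      hφ.differentiable.differentiableOn
    have hqz : q i = deriv φ z := hzq.symm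
    rw [hqz]
    refine ⟨(hC z).1, (hφ.abs_deriv_sub_le (fun x => (hC x).2) _ _).trans ?_⟩
    have hC0 : 0 ≤ C := (abs_nonneg _).trans (hC 0).1
    gcongr
    rw [abs_sub_comm, abs_of_pos (sub_pos.2 hz.1), gap]
    linarith [hz.2]
  have hsum : ∑ i, deriv φ (x i) =
      ∑ i : Fin (n + 1), deriv φ (withEnds x i.castSucc) - deriv φ 0 := by
    rw [Fin.sum_univ_succ]
    simp only [Fin.castSucc_zero, withEnds_zero, add_sub_cancel_left]
    refine Finset.sum_congr rfl fun i _ => ?_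
    rw [← Fin.succ_castSucc, withEnds_mid]
  have hN : (0 : ℝ) < (n + 1 : ℕ) := by positivity
  have heq : vecDiv β n φ x = ∑ i, (deriv φ (withEnds x i.castSucc) - q i) - deriv φ 0 +
      β / (n + 1 : ℕ) * ∑ i, q i := by
    rw [vecDiv, hsum, Finset.sum_sub_distrib]; ring
  have h1 : |∑ i, (deriv φ (withEnds x i.castSucc) - q i)| ≤ C := by
    refine (Finset.abs_sum_le_sum_abs _ _).trans ?_
    refine (Finset.sum_le_sum fun i _ => (hmv i).2).trans ?_
    rw [← Finset.mul_sum, sum_gap, mul_one]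
  have h2 : |∑ i, q i| ≤ (n + 1 : ℕ) * C := by
    refine (Finset.abs_sum_le_sum_abs _ _).trans ?_
    refine (Finset.sum_le_card_nsmul _ _ C fun i _ => (hmv i).1).trans ?_
    simp
  have h3 : |β / (n + 1 : ℕ) * ∑ i, q i| ≤ β * C := by
    rw [abs_mul, abs_of_pos (by positivity)]
    calc β / (n + 1 : ℕ) * |∑ i, q i| ≤ β / (n + 1 : ℕ) * ((n + 1 : ℕ) * C) := by gcongr
      _ = β * C := by field_simp
  rw [heq]
  have h4 := abs_add_le (∑ i, (deriv φ (withEnds x i.castSucc) - q i) - deriv φ 0)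
    (β / (n + 1 : ℕ) * ∑ i, q i)
  have h5 := abs_sub (∑ i, (deriv φ (withEnds x i.castSucc) - q i)) (deriv φ 0)
  have h6 := (hC 0).1
  linarith

end Particle

/-! ### Preliminaries on `L²` -/

section L2

variable {Ω : Type*} [MeasurableSpace Ω] {μ : Measure Ω}

theorem L2_inner_eq (f g : Lp ℝ 2 μ) : inner ℝ f g = ∫ x, f x * g x ∂μ := by
  rw [L2.inner_def]
  refine integral_congr_ae (Eventually.of_forall fun x => ?_)
  simp [mul_comm]

theorem L2_norm_sq (f : Lp ℝ 2 μ) : ‖f‖ ^ 2 = ∫ x, f x ^ 2 ∂μ := by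
  rw [← real_inner_self_eq_norm_sq, L2_inner_eq]
  simp_rw [sq]

theorem L2_inner_congr {f g : Lp ℝ 2 μ} {f' g' : Ω → ℝ} (hf : f =ᵐ[μ] f') (hg : g =ᵐ[μ] g') :
    inner ℝ f g = ∫ x, f' x * g' x ∂μ := by
  rw [L2_inner_eq]
  refine integral_congr_ae ?_
  filter_upwards [hf, hg] with x h1 h2
  rw [h1, h2]

theorem L2_integrable_mul (f g : Lp ℝ 2 μ) : Integrable (fun x => f x * g x) μ :=
  (Lp.memLp f).integrable_mul (Lp.memLp g)

theorem L2_tendsto_of_integral {ι : Type*} {l : Filter ι} {f : ι → Lp ℝ 2 μ} {g : Lp ℝ 2 μ}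
    (h : Tendsto (fun i => ∫ x, (f i x - g x) ^ 2 ∂μ) l (𝓝 0)) : Tendsto f l (𝓝 g) := by
  rw [tendsto_iff_norm_sub_tendsto_zero]
  have h1 : Tendsto (fun i => √(∫ x, (f i x - g x) ^ 2 ∂μ)) l (𝓝 (√0)) :=
    (Real.continuous_sqrt.tendsto 0).comp h
  rw [Real.sqrt_zero] at h1
  refine h1.congr fun i => ?_
  rw [← Real.sqrt_sq (norm_nonneg (f i - g)), L2_norm_sq]
  congr 1
  refine integral_congr_ae ?_
  filter_upwards [Lp.coeFn_sub (f i) g] with x hx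
  rw [hx]; rfl

/-- Dominated convergence in `L²`. -/
theorem L2_tendsto_of_dominated {f : ℕ → Lp ℝ 2 μ} {g : Lp ℝ 2 μ} (G : Ω → ℝ) (hG : MemLp G 2 μ)
    (hb : ∀ n, ∀ᵐ x ∂μ, |f n x| ≤ G x)
    (hl : ∀ᵐ x ∂μ, Tendsto (fun n => f n x) atTop (𝓝 (g x))) : Tendsto f atTop (𝓝 g) := by
  refine L2_tendsto_of_integral ?_
  have hgG : ∀ᵐ x ∂μ, |g x| ≤ G x := by
    filter_upwards [ae_all_iff.2 hb, hl] with x h1 h2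
    exact le_of_tendsto h2.abs (Eventually.of_forall h1)
  have h := tendsto_integral_of_dominated_convergence (μ := μ)
    (F := fun n x => (f n x - g x) ^ 2) (f := fun _ => (0 : ℝ)) (fun x => 4 * G x ^ 2)
    (fun n => ((Lp.aestronglyMeasurable (f n)).sub (Lp.aestronglyMeasurable g)).pow 2)
    (hG.integrable_sq.const_mul 4)
    (fun n => by
      filter_upwards [hb n, hgG] with x h1 h2
      rw [Real.norm_eq_abs, abs_of_nonneg (sq_nonneg _)]
      rw [abs_le] at h1 h2
      nlinarith)
    (by
      filter_upwards [hl] with x hx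
      simpa using (hx.sub_const (g x)).pow 2)
  simpa using h

theorem L2_tendsto_of_bounded [IsFiniteMeasure μ] {f : ℕ → Lp ℝ 2 μ} {g : Lp ℝ 2 μ} (C : ℝ)
    (hb : ∀ n, ∀ᵐ x ∂μ, |f n x| ≤ C)
    (hl : ∀ᵐ x ∂μ, Tendsto (fun n => f n x) atTop (𝓝 (g x))) : Tendsto f atTop (𝓝 g) :=
  L2_tendsto_of_dominated (fun _ => C) (memLp_const C) hb hl

theorem L2_norm_le_of_ae_le {f g : Lp ℝ 2 μ} {C : ℝ}
    (h : ∀ᵐ x ∂μ, |f x| ≤ C * |g x|) : ‖f‖ ≤ C * ‖g‖ :=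
  Lp.norm_le_mul_norm_of_ae_le_mul (by simpa using h)

/-- Products of boundedly convergent sequences and `L²`-convergent sequences converge. -/
theorem L2_tendsto_mul {a : ℕ → Ω → ℝ} {a' : Ω → ℝ} {b c : ℕ → Lp ℝ 2 μ} {b' c' : Lp ℝ 2 μ}
    {C : ℝ} (ham : ∀ n, AEStronglyMeasurable (a n) μ) (ham' : AEStronglyMeasurable a' μ)
    (ha : ∀ n, ∀ᵐ x ∂μ, |a n x| ≤ C) (hal : ∀ᵐ x ∂μ, Tendsto (fun n => a n x) atTop (𝓝 (a' x)))
    (hb : Tendsto b atTop (𝓝 b')) (hc : ∀ n, c n =ᵐ[μ] fun x => a n x * b n x)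
    (hc' : c' =ᵐ[μ] fun x => a' x * b' x) : Tendsto c atTop (𝓝 c') := by
  -- The zero measure is separated because only a nonempty almost-everywhere bound forces 0 ≤ C.
  by_cases hμ : μ = 0
  · subst hμ
    have : ∀ n, c n = c' := fun n => Lp.ext (by rw [ae_zero]; exact eventually_bot)
    exact tendsto_const_nhds.congr fun n => (this n).symm
  have : (ae μ).NeBot := ae_neBot.2 hμ
  have hC : 0 ≤ C := by
    obtain ⟨x, hx⟩ := (ha 0).exists
    exact (abs_nonneg _).trans hx
  have hmem : ∀ n, MemLp (fun x => a n x * b' x) 2 μ := fun n =>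
    MemLp.of_le_mul (c := C) (Lp.memLp b') ((ham n).mul (Lp.aestronglyMeasurable _)) (by
      filter_upwards [ha n] with x hx
      rw [Real.norm_eq_abs, abs_mul, Real.norm_eq_abs]
      gcongr)
  -- Split c n = a n (b n - b') + a n b'. The first term is small by the uniform bound on a n, the
  -- second, which is d n, converges by domination.
  let d : ℕ → Lp ℝ 2 μ := fun n => (hmem n).toLp _
  have hd : Tendsto d atTop (𝓝 c') := by
    refine L2_tendsto_of_dominated (fun x => C * |b' x|) ((Lp.memLp b').abs.const_mul C) ?_ ?_
    · intro n
      filter_upwards [(hmem n).coeFn_toLp, ha n] with x h1 h2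
      change |(hmem n).toLp _ x| ≤ _
      rw [h1, abs_mul]
      gcongr
    · filter_upwards [ae_all_iff.2 fun n => (hmem n).coeFn_toLp, hal, hc'] with x h1 h2 h3
      rw [h3]
      refine (h2.mul_const (b' x)).congr fun n => ?_
      exact (h1 n).symm
  have he : Tendsto (fun n => c n - d n) atTop (𝓝 0) := by
    rw [tendsto_zero_iff_norm_tendsto_zero]
    have h1 := (tendsto_iff_norm_sub_tendsto_zero.1 hb).const_mul C
    rw [mul_zero] at h1
    refine squeeze_zero (fun _ => norm_nonneg _) (fun n => ?_) h1
    refine L2_norm_le_of_ae_le ?_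
    filter_upwards [Lp.coeFn_sub (c n) (d n), Lp.coeFn_sub (b n) b', (hmem n).coeFn_toLp, hc n,
      ha n] with x h1 h2 h3 h4 h5
    rw [h1, h2, Pi.sub_apply, Pi.sub_apply, h4]
    change |_ - (hmem n).toLp _ x| ≤ _
    rw [h3, ← mul_sub, abs_mul]
    gcongr
  simpa using he.add hd

/-- A subsequence converges almost everywhere. -/
theorem L2_exists_subseq {f : ℕ → Lp ℝ 2 μ} {g : Lp ℝ 2 μ} (h : Tendsto f atTop (𝓝 g)) :
    ∃ s : ℕ → ℕ, StrictMono s ∧ ∀ᵐ x ∂μ, Tendsto (fun k => f (s k) x) atTop (𝓝 (g x)) := by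
  obtain ⟨s, hs, h⟩ := (tendstoInMeasure_of_tendsto_Lp h).exists_seq_tendsto_ae
  exact ⟨s, hs, h⟩

theorem L2_abs_le_of_tendsto {f : ℕ → Lp ℝ 2 μ} {g : Lp ℝ 2 μ} {C : ℝ}
    (h : Tendsto f atTop (𝓝 g)) (hC : ∀ n, ∀ᵐ x ∂μ, |f n x| ≤ C) : ∀ᵐ x ∂μ, |g x| ≤ C := by
  obtain ⟨s, -, hs⟩ := L2_exists_subseq h
  filter_upwards [hs, ae_all_iff.2 hC] with x h1 h2
  exact le_of_tendsto h1.abs (Eventually.of_forall fun k => h2 (s k))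

theorem sq_integral_le [IsProbabilityMeasure μ] {f : Ω → ℝ} (hf : MemLp f 2 μ) :
    (∫ x, f x ∂μ) ^ 2 ≤ ∫ x, f x ^ 2 ∂μ := by
  have hi := hf.integrable (by norm_num)
  have h : 0 ≤ ∫ x, (f x - ∫ y, f y ∂μ) ^ 2 ∂μ := integral_nonneg fun _ => sq_nonneg _
  set m := ∫ y, f y ∂μ
  have h1 : ∫ x, (f x - m) ^ 2 ∂μ = ∫ x, (f x ^ 2 - 2 * m * f x + m ^ 2) ∂μ :=
    integral_congr_ae (Eventually.of_forall fun x => by simp only; ring)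
  have h2 : Integrable (fun x => f x ^ 2 - 2 * m * f x) μ :=
    hf.integrable_sq.sub (hi.const_mul _)
  rw [h1, integral_add h2 (integrable_const _), integral_sub hf.integrable_sq (hi.const_mul _), integral_const_mul] at h
  simp only [integral_const, probReal_univ, one_smul] at h
  nlinarith

end L2

/-! ### Determination by trigonometric functions -/

section Trig

variable {Ω : Type*} [MeasurableSpace Ω] {μ : Measure Ω} {y : Ω → ℝ}

/-- `ENNReal.ofReal` truncates, so these are the images of y⁺ μ and y⁻ μ. Their characteristic
functions differ by the integral of (cos + i sin)(L ∘ p) · y, which is zero, and characteristic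
functions determine finite measures. -/
theorem map_withDensity_eq_of_trig {E : Type*} [NormedAddCommGroup E] [NormedSpace ℝ E]
    [CompleteSpace E] [MeasurableSpace E] [BorelSpace E] [SecondCountableTopology E]
    {p : Ω → E} (hp : Measurable p) (hy : Integrable y μ)
    (hcos : ∀ L : StrongDual ℝ E, ∫ x, Real.cos (L (p x)) * y x ∂μ = 0)
    (hsin : ∀ L : StrongDual ℝ E, ∫ x, Real.sin (L (p x)) * y x ∂μ = 0) :
    (μ.withDensity fun x => ENNReal.ofReal (y x)).map p =
      (μ.withDensity fun x => ENNReal.ofReal (-y x)).map p := by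
  have h1 := isFiniteMeasure_withDensity_ofReal hy.2
  have h2 := isFiniteMeasure_withDensity_ofReal hy.neg.2
  have h3 := Measure.isFiniteMeasure_map (μ.withDensity fun x => ENNReal.ofReal (y x)) p
  have h4 : IsFiniteMeasure ((μ.withDensity fun x => ENNReal.ofReal (-y x)).map p) :=
    Measure.isFiniteMeasure_map (μ.withDensity fun x => ENNReal.ofReal ((-y) x)) p
  refine Measure.ext_of_charFunDual (funext fun L => ?_)
  have hLp : Measurable fun x => (L (p x) : ℝ) := L.continuous.measurable.comp hp
  have hm : StronglyMeasurable fun v : E => Complex.exp (L v * Complex.I) := by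
    refine Continuous.stronglyMeasurable ?_
    fun_prop
  have hbd : ∀ x, ‖Complex.exp (L (p x) * Complex.I)‖ ≤ 1 := fun x => by
    rw [Complex.norm_exp_ofReal_mul_I]
  have hmp : AEStronglyMeasurable (fun x => Complex.exp (L (p x) * Complex.I)) μ :=
    (hm.comp_measurable hp).aestronglyMeasurable
  have key : ∀ z : Ω → ℝ, Integrable z μ →
      charFunDual ((μ.withDensity fun x => ENNReal.ofReal (z x)).map p) L =
      ∫ x, ((max (z x) 0 : ℝ) : ℂ) * Complex.exp (L (p x) * Complex.I) ∂μ := by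
    intro z hz
    rw [charFunDual_apply, integral_map hp.aemeasurable hm.aestronglyMeasurable,
      integral_withDensity_eq_integral_toReal_smul₀ hz.1.aemeasurable.ennreal_ofReal
        (Eventually.of_forall fun _ => ENNReal.ofReal_lt_top)]
    refine integral_congr_ae (Eventually.of_forall fun x => ?_)
    simp only [ENNReal.toReal_ofReal']
    rw [Complex.real_smul]
  have hint : ∀ z : Ω → ℝ, Integrable z μ → Integrable
      (fun x => ((max (z x) 0 : ℝ) : ℂ) * Complex.exp (L (p x) * Complex.I)) μ := by
    intro z hz
    have := hz.pos_part.ofReal (𝕜 := ℂ)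
    exact this.mul_bdd (c := 1) hmp (Eventually.of_forall hbd)
  have hkey2 := key (fun x => -y x) hy.neg
  have hint2 := hint (fun x => -y x) hy.neg
  rw [key y hy, hkey2, ← sub_eq_zero, ← integral_sub (hint y hy) hint2]
  have h5 : ∀ x, ((max (y x) 0 : ℝ) : ℂ) * Complex.exp (L (p x) * Complex.I) -
      ((max (-y x) 0 : ℝ) : ℂ) * Complex.exp (L (p x) * Complex.I) =
      ((Real.cos (L (p x)) * y x : ℝ) : ℂ) +
        ((Real.sin (L (p x)) * y x : ℝ) : ℂ) * Complex.I := by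
    intro x
    rw [← sub_mul, ← Complex.ofReal_sub, max_zero_sub_eq_self, Complex.exp_mul_I]
    push_cast
    ring
  simp_rw [h5]
  have hc : Integrable (fun x => Real.cos (L (p x)) * y x) μ :=
    hy.bdd_mul (c := 1) (Real.measurable_cos.comp hLp).aestronglyMeasurable
      (Eventually.of_forall fun x => Real.abs_cos_le_one _)
  have hs : Integrable (fun x => Real.sin (L (p x)) * y x) μ :=
    hy.bdd_mul (c := 1) (Real.measurable_sin.comp hLp).aestronglyMeasurable
      (Eventually.of_forall fun x => Real.abs_sin_le_one _)
  rw [integral_add hc.ofReal (hs.ofReal.mul_const _), integral_mul_const, integral_complex_ofReal,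
    integral_complex_ofReal, hcos L, hsin L]
  simp

theorem ae_eq_zero_of_withDensity_eq (hy : Integrable y μ)
    (h : (μ.withDensity fun x => ENNReal.ofReal (y x)) =
      μ.withDensity fun x => ENNReal.ofReal (-y x)) : y =ᵐ[μ] 0 := by
  refine hy.ae_eq_zero_of_forall_setIntegral_eq_zero fun s hs _ => ?_
  rw [integral_eq_lintegral_pos_part_sub_lintegral_neg_part hy.integrableOn,
    ← withDensity_apply _ hs, ← withDensity_apply _ hs, h, sub_self]

end Trig

/-! ### Step functions -/

theorem lebesgueIco_preimage (B : Set ℝ) :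
    lebesgueIco (Subtype.val ⁻¹' B) = volume (B ∩ Ico 0 1) := by
  rw [lebesgueIco, (MeasurableEmbedding.subtype_coe measurableSet_Ico).comap_apply,
    Subtype.image_preimage_coe, inter_comm]

instance : IsProbabilityMeasure lebesgueIco := ⟨by
  have := lebesgueIco_preimage univ
  rw [preimage_univ, univ_inter, Real.volume_Ico, sub_zero, ENNReal.ofReal_one] at this
  exact this⟩

section Step

variable {n : ℕ}

/-- The index of the grid cell containing `t`. -/
def cellIdx (n : ℕ) (t : UnitIco) : Fin (n + 1) :=
  ⟨⌊(n + 1 : ℝ) * t⌋₊, by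
    rw [Nat.floor_lt (mul_nonneg (by positivity) t.2.1)]
    push_cast
    have := t.2.2
    nlinarith [(Nat.cast_nonneg n : (0 : ℝ) ≤ n)]⟩

theorem measurable_cellIdx (n : ℕ) : Measurable (cellIdx n) := by
  refine measurable_to_countable' fun i => ?_
  have h : cellIdx n ⁻¹' {i} = (fun t : UnitIco => ⌊(n + 1 : ℝ) * t⌋₊) ⁻¹' {(i : ℕ)} := by
    ext t
    simp [cellIdx, Fin.ext_iff]
  rw [h]
  exact (Nat.measurable_floor.comp (measurable_subtype_coe.const_mul _)) (measurableSet_singleton _)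

/-- The grid cells. -/
def cell (n : ℕ) (i : Fin (n + 1)) : Set UnitIco := cellIdx n ⁻¹' {i}

theorem measurableSet_cell (i : Fin (n + 1)) : MeasurableSet (cell n i) :=
  measurable_cellIdx n (measurableSet_singleton i)

theorem cell_eq (i : Fin (n + 1)) :
    cell n i = Subtype.val ⁻¹' Ico ((i : ℝ) / (n + 1)) ((i + 1) / (n + 1)) := by
  ext t
  have hN : (0 : ℝ) < n + 1 := by positivity
  simp only [cell, mem_preimage, mem_singleton_iff, Fin.ext_iff, cellIdx, mem_Ico]
  rw [Nat.floor_eq_iff (mul_nonneg hN.le t.2.1), div_le_iff₀ hN, lt_div_iff₀ hN,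
    mul_comm (t : ℝ)]

theorem lebesgueIco_cell (i : Fin (n + 1)) :
    lebesgueIco.real (cell n i) = 1 / (n + 1) := by
  have hN : (0 : ℝ) < n + 1 := by positivity
  rw [Measure.real, cell_eq, lebesgueIco_preimage, inter_eq_left.2,
    Real.volume_Ico, ENNReal.toReal_ofReal]
  · ring
  · rw [← sub_div]; simp only [add_sub_cancel_left]; positivity
  · refine Ico_subset_Ico (by positivity) ?_
    rw [div_le_one hN]
    have : (i : ℕ) + 1 ≤ n + 1 := i.2
    exact_mod_cast this

/-- The step function with values `x₁, …, x_n, 1` on the grid cells. -/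
def step (n : ℕ) (x : Fin n → ℝ) (t : UnitIco) : ℝ := withEnds x (cellIdx n t).succ

theorem measurable_step (x : Fin n → ℝ) : Measurable (step n x) :=
  (Measurable.of_discrete (f := fun i : Fin (n + 1) => withEnds x i.succ)).comp
    (measurable_cellIdx n)

theorem measurable_gridEval (n : ℕ) : Measurable (gridEval n) :=
  measurable_pi_lambda _ fun _ => (measurable_pi_apply _).comp measurable_subtype_coe

theorem gridEval_mem (n : ℕ) (g : QuantileFn) : gridEval n g ∈ orderedSimplex n := by
  refine ⟨fun i j hij => g.2.1 ?_, fun i => g.2.2.1 _⟩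
  change ((i + 1 : ℕ) : ℝ) / (n + 1 : ℕ) ≤ ((j + 1 : ℕ) : ℝ) / (n + 1 : ℕ)
  have hij' : (i : ℕ) ≤ j := hij
  gcongr

/-- On each cell but the last, the step function takes the value of g at the right end of the cell,
so right continuity gives the limit. Since t < 1, the last cell, where the value is 1, is avoided
for large n. -/
theorem tendsto_step_gridEval (g : QuantileFn) (t : UnitIco) :
    Tendsto (fun n => step n (gridEval n g) t) atTop (𝓝 (g.1 t)) := by
  rw [Metric.tendsto_atTop]
  intro ε hε
  obtain ⟨δ, hδ, hg⟩ := Metric.continuousWithinAt_iff.1 (g.2.2.2 t) ε hε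
  have ht : (0 : ℝ) < 1 - t := sub_pos.2 t.2.2
  obtain ⟨N, hN⟩ := exists_nat_one_div_lt (lt_min hδ ht)
  refine ⟨N, fun n hn => ?_⟩
  have hnN : (1 : ℝ) / (n + 1) ≤ 1 / (N + 1) :=
    one_div_le_one_div_of_le (by positivity) (by gcongr)
  have h1 : (1 : ℝ) / (n + 1) < δ := hnN.trans_lt (hN.trans_le (min_le_left _ _))
  have h2 : (1 : ℝ) / (n + 1) < 1 - t := hnN.trans_lt (hN.trans_le (min_le_right _ _))
  have hp : (0 : ℝ) < n + 1 := by positivity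
  have hcell : t ∈ cell n (cellIdx n t) := rfl
  rw [cell_eq] at hcell
  obtain ⟨hl, hr⟩ := hcell
  set i := cellIdx n t with hi
  have h4 : ((i : ℝ) + 1) / (n + 1) ≤ t + 1 / (n + 1) := by rw [add_div]; gcongr
  have hin : (i : ℕ) < n := by
    have h5 : ((i : ℝ) + 1) / (n + 1) < 1 := by linarith
    rw [div_lt_one hp] at h5
    exact_mod_cast (by linarith : (i : ℝ) < n)
  have h6 : step n (gridEval n g) t = g.1 (gridTime n ⟨i, hin⟩) := by
    have : step n (gridEval n g) t =
        withEnds (gridEval n g) (Fin.castSucc ⟨i, hin⟩).succ := rfl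
    rw [this, withEnds_mid]
    rfl
  have h7 : ((gridTime n ⟨i, hin⟩ : UnitIco) : ℝ) = ((i : ℝ) + 1) / (n + 1) := by
    change (((i : ℕ) + 1 : ℕ) : ℝ) / (n + 1 : ℕ) = _
    push_cast; rfl
  rw [h6]
  refine hg ?_ ?_
  · change (t : ℝ) ≤ (gridTime n ⟨i, hin⟩ : UnitIco)
    rw [h7]; exact hr.le
  · rw [Subtype.dist_eq, h7, Real.dist_eq, abs_of_nonneg (by linarith)]
    linarith

theorem measurable_step_uncurry (n : ℕ) :
    Measurable fun p : QuantileFn × UnitIco => step n (gridEval n p.1) p.2 := by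
  have h : Measurable fun q : (Fin n → ℝ) × Fin (n + 1) => withEnds q.1 q.2.succ :=
    measurable_from_prod_countable_left fun i => (continuous_withEnds i.succ).measurable
  exact h.comp (((measurable_gridEval n).comp measurable_fst).prodMk
    ((measurable_cellIdx n).comp measurable_snd))

/-- The evaluation map is jointly measurable. -/
theorem measurable_eval : Measurable fun p : QuantileFn × UnitIco => p.1.1 p.2 := by
  refine measurable_of_tendsto_metrizable (measurable_step_uncurry ·) ?_
  rw [tendsto_pi_nhds]
  exact fun p => tendsto_step_gridEval p.1 p.2

theorem QuantileFn.measurable (g : QuantileFn) : Measurable g.1 :=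
  measurable_eval.comp measurable_prodMk_left

end Step

/-! ### Smooth functions of integrals along a path -/

/-- The functional `h ↦ ∫ c(t) ψ(h(t)) dt`. -/
def comp (c : UnitIco → ℝ) (ψ : ℝ → ℝ) (h : UnitIco → ℝ) : ℝ := ∫ t, c t * ψ (h t) ∂lebesgueIco

theorem abs_comp_le {c : UnitIco → ℝ} (hc : Integrable c lebesgueIco) {ψ : ℝ → ℝ} {C : ℝ}
    (hψ : ∀ x, |ψ x| ≤ C) (h : UnitIco → ℝ) :
    |comp c ψ h| ≤ C * ∫ t, |c t| ∂lebesgueIco := by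
  rw [← integral_const_mul]
  refine norm_integral_le_of_norm_le (f := fun t => c t * ψ (h t)) (hc.abs.const_mul C)
    (Eventually.of_forall fun t => ?_)
  rw [Real.norm_eq_abs, abs_mul, mul_comm]
  gcongr
  exact hψ _

theorem tendsto_comp {c : UnitIco → ℝ} (hc : Integrable c lebesgueIco) {ψ : ℝ → ℝ}
    (hψc : Continuous ψ) {C : ℝ} (hψ : ∀ x, |ψ x| ≤ C) {h : ℕ → UnitIco → ℝ} {h' : UnitIco → ℝ}
    (hm : ∀ n, Measurable (h n)) (hl : ∀ t, Tendsto (fun n => h n t) atTop (𝓝 (h' t))) :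
    Tendsto (fun n => comp c ψ (h n)) atTop (𝓝 (comp c ψ h')) := by
  refine tendsto_integral_of_dominated_convergence (fun t => C * |c t|) (fun n => ?_)
    (hc.abs.const_mul C) (fun n => Eventually.of_forall fun t => ?_)
    (Eventually.of_forall fun t => ?_)
  · exact hc.1.mul (hψc.measurable.comp (hm n)).aestronglyMeasurable
  · rw [Real.norm_eq_abs, abs_mul, mul_comm]
    gcongr
    exact hψ _
  · exact ((hψc.tendsto _).comp (hl t)).const_mul _

theorem comp_step {n : ℕ} {c : UnitIco → ℝ} (hc : Integrable c lebesgueIco) (ψ : ℝ → ℝ)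
    (x : Fin n → ℝ) : comp c ψ (step n x) =
      ∑ i, (∫ t in cell n i, c t ∂lebesgueIco) * ψ (withEnds x i.succ) := by
  have h : ∀ t, c t * ψ (step n x t) =
      ∑ i, (cell n i).indicator c t * ψ (withEnds x i.succ) := by
    intro t
    rw [Finset.sum_eq_single (cellIdx n t)]
    · rw [indicator_of_mem (show t ∈ cell n (cellIdx n t) from rfl)]; rfl
    · intro i _ hi
      rw [indicator_of_notMem, zero_mul]
      exact fun ht => hi (Eq.symm ht)
    · simp
  simp only [comp, h]
  rw [integral_finsetSum _ fun i _ => (hc.indicator (measurableSet_cell i)).mul_const _]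
  refine Finset.sum_congr rfl fun i _ => ?_
  rw [integral_mul_const, integral_indicator (measurableSet_cell i)]

theorem hasFDerivAt_comp_step {n : ℕ} {c : UnitIco → ℝ} (hc : Integrable c lebesgueIco)
    {ψ : ℝ → ℝ} (hψ : Differentiable ℝ ψ) (x : Fin n → ℝ) :
    HasFDerivAt (fun x => comp c ψ (step n x))
      (∑ i, (∫ t in cell n i, c t ∂lebesgueIco) •
        (deriv ψ (withEnds x i.succ) • endsLin n i.succ)) x := by
  simp only [comp_step hc]
  exact HasFDerivAt.fun_sum fun i _ => (HasDerivAt.comp_hasFDerivAt (h₂ := ψ)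
    (f := fun x : Fin n → ℝ => withEnds x i.succ) x (hψ _).hasDerivAt
    (hasFDerivAt_withEnds i.succ x)).const_mul _

theorem contDiff_comp_step {n : ℕ} {c : UnitIco → ℝ} (hc : Integrable c lebesgueIco)
    {r : WithTop ℕ∞} {ψ : ℝ → ℝ} (hψ : ContDiff ℝ r ψ) :
    ContDiff ℝ r fun x : Fin n → ℝ => comp c ψ (step n x) := by
  simp only [comp_step hc]
  exact ContDiff.sum fun i _ => contDiff_const.mul (hψ.comp (contDiff_withEnds i.succ))

/-- `w` is a `C¹` function of finitely many integrals `∫ c(t) ψ(h(t)) dt`, and `dw` is its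
derivative in the direction of the vector field `h ↦ φ ∘ h`. -/
def IsTest (φ : ℝ → ℝ) (w dw : (UnitIco → ℝ) → ℝ) : Prop :=
  ∃ (ι : Type) (_ : Fintype ι) (U : (ι → ℝ) → ℝ) (c : ι → UnitIco → ℝ) (ψ : ι → ℝ → ℝ),
    ContDiff ℝ 1 U ∧ (∀ j, Integrable (c j) lebesgueIco) ∧ (∀ j, BddC2 (ψ j)) ∧
    (∀ h, w h = U fun j => comp (c j) (ψ j) h) ∧
    ∀ h, dw h = fderiv ℝ U (fun j => comp (c j) (ψ j) h)
      fun j => comp (c j) (fun x => deriv (ψ j) x * φ x) h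

section Test

variable {φ : ℝ → ℝ} {w dw w' dw' : (UnitIco → ℝ) → ℝ}

theorem BddC2.deriv_mul_bound {ψ : ℝ → ℝ} (hψ : BddC2 ψ) (hφ : BddC2 φ) :
    ∃ C, ∀ x, |deriv ψ x * φ x| ≤ C := by
  obtain ⟨C, hC0, hC⟩ := hψ.bound
  obtain ⟨D, hD0, hD⟩ := hφ.bound
  refine ⟨C * D, fun x => ?_⟩
  rw [abs_mul]
  exact mul_le_mul (hC x).2.1 (hD x).1 (abs_nonneg _) hC0

theorem IsTest.bounded (h : IsTest φ w dw) (hφ : BddC2 φ) :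
    ∃ C, ∀ h, |w h| ≤ C ∧ |dw h| ≤ C := by
  obtain ⟨ι, _, U, c, ψ, hU, hc, hψ, hw, hdw⟩ := h
  have hb1 : ∀ j, ∃ C, ∀ h, |comp (c j) (ψ j) h| ≤ C := fun j => by
    obtain ⟨C, -, hC⟩ := (hψ j).bound
    exact ⟨_, abs_comp_le (hc j) fun x => (hC x).1⟩
  have hb2 : ∀ j, ∃ C, ∀ h, |comp (c j) (fun x => deriv (ψ j) x * φ x) h| ≤ C := fun j => by
    obtain ⟨C, hC⟩ := (hψ j).deriv_mul_bound hφ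
    exact ⟨_, abs_comp_le (hc j) hC⟩
  choose C1 hC1 using hb1
  choose C2 hC2 using hb2
  have hcomp : IsCompact (Set.pi univ (fun j => Icc (-C1 j) (C1 j)) ×ˢ
      Set.pi univ fun j => Icc (-C2 j) (C2 j)) :=
    (isCompact_univ_pi fun _ => isCompact_Icc).prod (isCompact_univ_pi fun _ => isCompact_Icc)
  have hcont : Continuous fun p : (ι → ℝ) × (ι → ℝ) => fderiv ℝ U p.1 p.2 :=
    ((hU.continuous_fderiv (by norm_num)).comp continuous_fst).clm_apply continuous_snd
  obtain ⟨A, hA⟩ := hcomp.exists_bound_of_continuousOn hcont.continuousOn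
  obtain ⟨B, hB⟩ := hcomp.exists_bound_of_continuousOn
    (hU.continuous.comp continuous_fst).continuousOn
  refine ⟨max A B, fun h => ?_⟩
  have hmem : ((fun j => comp (c j) (ψ j) h),
      fun j => comp (c j) (fun x => deriv (ψ j) x * φ x) h) ∈
      Set.pi univ (fun j => Icc (-C1 j) (C1 j)) ×ˢ Set.pi univ fun j => Icc (-C2 j) (C2 j) :=
    ⟨fun j _ => abs_le.1 (hC1 j h), fun j _ => abs_le.1 (hC2 j h)⟩
  rw [hw, hdw]
  exact ⟨(hB _ hmem).trans (le_max_right _ _), (hA _ hmem).trans (le_max_left _ _)⟩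

theorem IsTest.tendsto (h : IsTest φ w dw) (hφ : BddC2 φ) {k : ℕ → UnitIco → ℝ}
    {k' : UnitIco → ℝ} (hm : ∀ n, Measurable (k n))
    (hl : ∀ t, Tendsto (fun n => k n t) atTop (𝓝 (k' t))) :
    Tendsto (fun n => w (k n)) atTop (𝓝 (w k')) ∧
      Tendsto (fun n => dw (k n)) atTop (𝓝 (dw k')) := by
  obtain ⟨ι, _, U, c, ψ, hU, hc, hψ, hw, hdw⟩ := h
  have h1 : Tendsto (fun n j => comp (c j) (ψ j) (k n)) atTop
      (𝓝 fun j => comp (c j) (ψ j) k') := by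
    refine tendsto_pi_nhds.2 fun j => ?_
    obtain ⟨C, -, hC⟩ := (hψ j).bound
    exact tendsto_comp (hc j) (hψ j).continuous (fun x => (hC x).1) hm hl
  have h2 : Tendsto (fun n j => comp (c j) (fun x => deriv (ψ j) x * φ x) (k n)) atTop
      (𝓝 fun j => comp (c j) (fun x => deriv (ψ j) x * φ x) k') := by
    refine tendsto_pi_nhds.2 fun j => ?_
    obtain ⟨C, hC⟩ := (hψ j).deriv_mul_bound hφ
    exact tendsto_comp (hc j) ((hψ j).continuous_deriv.mul hφ.continuous) hC hm hl
  simp only [hw, hdw]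
  refine ⟨(hU.continuous.tendsto _).comp h1, ?_⟩
  have hcont : Continuous fun p : (ι → ℝ) × (ι → ℝ) => fderiv ℝ U p.1 p.2 :=
    ((hU.continuous_fderiv (by norm_num)).comp continuous_fst).clm_apply continuous_snd
  exact (hcont.tendsto _).comp (h1.prodMk_nhds h2)

theorem IsTest.contDiff_step (h : IsTest φ w dw) (n : ℕ) :
    ContDiff ℝ 1 fun x => w (step n x) := by
  obtain ⟨ι, _, U, c, ψ, hU, hc, hψ, hw, hdw⟩ := h
  simp only [hw]
  exact hU.comp (contDiff_pi.2 fun j =>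
    contDiff_comp_step (hc j) ((hψ j).contDiff.of_le (by norm_num)))

/-- Differentiation along φ on path space and on the particle space agree at step functions. The
last cell carries the fixed value 1 and contributes nothing on either side, as φ(1) = 0. -/
theorem IsTest.fderiv_step (h : IsTest φ w dw) (h0 : φ 0 = 0) (h1 : φ 1 = 0) (n : ℕ)
    (x : Fin n → ℝ) :
    fderiv ℝ (fun x => w (step n x)) x (fun i => φ (x i)) = dw (step n x) := by
  obtain ⟨ι, _, U, c, ψ, hU, hc, hψ, hw, hdw⟩ := h
  simp only [hw, hdw]
  have h2 := hasFDerivAt_pi.2 fun j =>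
    hasFDerivAt_comp_step (n := n) (hc j) (hψ j).differentiable x
  have h3 := (hU.differentiable (by norm_num) fun j => comp (c j) (ψ j) (step n x)).hasFDerivAt.comp
    x h2
  rw [show fderiv ℝ (fun x => U fun j => comp (c j) (ψ j) (step n x)) x = _ from h3.fderiv]
  rw [ContinuousLinearMap.comp_apply]
  congr 1
  ext j
  rw [ContinuousLinearMap.pi_apply, comp_step (hc j), sum_apply]
  refine Finset.sum_congr rfl fun i _ => ?_
  rw [smul_apply, smul_apply, endsLin_comp h0 h1]
  rfl

/-- Pointwise limits of continuous functions of finitely many grid values. -/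
theorem IsTest.measurable (h : IsTest φ w dw) (hφ : VecField φ) :
    (Measurable fun g : QuantileFn => w g.1) ∧ Measurable fun g : QuantileFn => dw g.1 := by
  have h1 : ∀ n, Continuous fun x : Fin n → ℝ => w (step n x) := fun n =>
    (h.contDiff_step n).continuous
  have h2 : ∀ n, Continuous fun x : Fin n → ℝ => dw (step n x) := fun n => by
    simp only [← h.fderiv_step hφ.zero hφ.one]
    exact ((h.contDiff_step n).continuous_fderiv (by norm_num)).clm_apply
      (continuous_pi fun i => hφ.continuous.comp (continuous_apply i))
  constructor
  · refine measurable_of_tendsto_metrizable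
      (fun n => (h1 n).measurable.comp (measurable_gridEval n)) ?_
    rw [tendsto_pi_nhds]
    exact fun g => (h.tendsto hφ.toBddC2 (fun n => measurable_step _)
      (tendsto_step_gridEval g)).1
  · refine measurable_of_tendsto_metrizable
      (fun n => (h2 n).measurable.comp (measurable_gridEval n)) ?_
    rw [tendsto_pi_nhds]
    exact fun g => (h.tendsto hφ.toBddC2 (fun n => measurable_step _)
      (tendsto_step_gridEval g)).2

/-- Test functions are stable under C¹ operations; sums, products and compositions are special
cases. The two families of path integrals are joined over ι ⊕ ι'. -/
theorem IsTest.map₂ (h : IsTest φ w dw) (h' : IsTest φ w' dw') {A : ℝ × ℝ → ℝ}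
    (hA : ContDiff ℝ 1 A) :
    IsTest φ (fun k => A (w k, w' k)) fun k => fderiv ℝ A (w k, w' k) (dw k, dw' k) := by
  obtain ⟨ι, _, U, c, ψ, hU, hc, hψ, hw, hdw⟩ := h
  obtain ⟨ι', _, U', c', ψ', hU', hc', hψ', hw', hdw'⟩ := h'
  let L : (ι ⊕ ι' → ℝ) →L[ℝ] (ι → ℝ) :=
    ContinuousLinearMap.pi fun j => ContinuousLinearMap.proj (Sum.inl j)
  let L' : (ι ⊕ ι' → ℝ) →L[ℝ] (ι' → ℝ) :=
    ContinuousLinearMap.pi fun j => ContinuousLinearMap.proj (Sum.inr j)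
  refine ⟨ι ⊕ ι', inferInstance, fun y => A (U (L y), U' (L' y)), Sum.elim c c', Sum.elim ψ ψ',
    hA.comp ((hU.comp L.contDiff).prodMk (hU'.comp L'.contDiff)), ?_, ?_, ?_, ?_⟩
  · rintro (j | j)
    exacts [hc j, hc' j]
  · rintro (j | j)
    exacts [hψ j, hψ' j]
  · intro k
    beta_reduce
    rw [hw, hw']
    rfl
  · intro k
    set y : ι ⊕ ι' → ℝ := fun j => comp (Sum.elim c c' j) (Sum.elim ψ ψ' j) k
    have e1 : L y = fun j => comp (c j) (ψ j) k := rfl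
    have e2 : L' y = fun j => comp (c' j) (ψ' j) k := rfl
    have h1 := (hU.differentiable (by norm_num) (L y)).hasFDerivAt.comp y L.hasFDerivAt
    have h2 := (hU'.differentiable (by norm_num) (L' y)).hasFDerivAt.comp y L'.hasFDerivAt
    have h3 := (hA.differentiable (by norm_num) (U (L y), U' (L' y))).hasFDerivAt.comp y
      (h1.prodMk h2)
    beta_reduce
    rw [show fderiv ℝ (fun y => A (U (L y), U' (L' y))) y = _ from h3.fderiv, hw, hw', hdw, hdw']
    rfl

theorem IsTest.add (h : IsTest φ w dw) (h' : IsTest φ w' dw') :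
    IsTest φ (fun k => w k + w' k) fun k => dw k + dw' k := by
  have := h.map₂ h' (A := fun p => p.1 + p.2) (contDiff_fst.add contDiff_snd)
  convert this using 2 with k
  rw [show fderiv ℝ (fun p : ℝ × ℝ => p.1 + p.2) (w k, w' k) = _ from
    (hasFDerivAt_fst.add hasFDerivAt_snd).fderiv]
  rfl

theorem IsTest.mul (h : IsTest φ w dw) (h' : IsTest φ w' dw') :
    IsTest φ (fun k => w k * w' k) fun k => dw k * w' k + w k * dw' k := by
  have := h.map₂ h' (A := fun p => p.1 * p.2) (contDiff_fst.mul contDiff_snd)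
  convert this using 2 with k
  rw [show fderiv ℝ (fun p : ℝ × ℝ => p.1 * p.2) (w k, w' k) = _ from
    (hasFDerivAt_fst.mul hasFDerivAt_snd).fderiv]
  simp
  ring

theorem IsTest.comp_left (h : IsTest φ w dw) {T : ℝ → ℝ} (hT : ContDiff ℝ 1 T) :
    IsTest φ (fun k => T (w k)) fun k => deriv T (w k) * dw k := by
  have := h.map₂ h (A := fun p => T p.1) (hT.comp contDiff_fst)
  convert this using 2 with k
  have h1 := HasDerivAt.comp_hasFDerivAt (h₂ := T) (f := Prod.fst) (w k, w k)
    (hT.differentiable (by norm_num) (w k)).hasDerivAt (hasFDerivAt_fst (𝕜 := ℝ))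
  rw [show fderiv ℝ (fun p : ℝ × ℝ => T p.1) (w k, w k) = _ from h1.fderiv]
  rfl

theorem IsTest.const_mul (h : IsTest φ w dw) (r : ℝ) :
    IsTest φ (fun k => r * w k) fun k => r * dw k := by
  have := h.comp_left (T := fun x => r * x) (contDiff_const.mul contDiff_id)
  convert this using 2 with k
  rw [deriv_const_mul _ differentiableAt_id, deriv_id'', mul_one]

/-- Reversing the field turns the range of l - D into that of l + D. -/
theorem IsTest.neg_field (h : IsTest φ w dw) :
    IsTest (fun x => -φ x) w fun k => -dw k := by
  obtain ⟨ι, _, U, c, ψ, hU, hc, hψ, hw, hdw⟩ := h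
  refine ⟨ι, inferInstance, U, c, ψ, hU, hc, hψ, hw, fun k => ?_⟩
  beta_reduce
  rw [hdw, ← map_neg]
  congr 1
  ext j
  simp only [Pi.neg_apply, comp, ← integral_neg]
  refine integral_congr_ae (Eventually.of_forall fun t => ?_)
  simp only
  ring

end Test

/-! ### Density of trigonometric functions of path integrals -/

theorem BddC2.of_hasCompactSupport {ψ : ℝ → ℝ} (h : ContDiff ℝ 2 ψ) (hc : HasCompactSupport ψ) :
    BddC2 ψ := by
  have h1 : ContDiff ℝ 1 (deriv ψ) :=
    (contDiff_succ_iff_deriv (n := 1)).1 (by simpa [one_add_one_eq_two] using h) |>.2.2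
  have h2 : Continuous (deriv (deriv ψ)) := h1.continuous_deriv le_rfl
  obtain ⟨A, hA⟩ := hc.exists_bound_of_continuous h.continuous
  obtain ⟨B, hB⟩ := hc.deriv.exists_bound_of_continuous h1.continuous
  obtain ⟨C, hC⟩ := hc.deriv.deriv.exists_bound_of_continuous h2
  refine ⟨h, max A (max B C), ?_, fun x => ⟨?_, ?_, ?_⟩⟩
  · exact (norm_nonneg _).trans ((hA 0).trans (le_max_left _ _))
  · exact (hA x).trans (le_max_left _ _)
  · exact (hB x).trans ((le_max_left _ _).trans (le_max_right _ _))
  · exact (hC x).trans ((le_max_right _ _).trans (le_max_right _ _))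

/-- A smooth cut-off function. -/
theorem exists_cutoff (R : ℝ) : ∃ χ : ℝ → ℝ, ContDiff ℝ ∞ χ ∧ HasCompactSupport χ ∧
    ∀ x, |x| ≤ R → χ x = 1 := by
  let f : ContDiffBump (0 : ℝ) := ⟨|R| + 1, |R| + 2, by positivity, by linarith⟩
  refine ⟨f, f.contDiff, f.hasCompactSupport, fun x hx => f.one_of_mem_closedBall ?_⟩
  rw [mem_closedBall_zero_iff, Real.norm_eq_abs]
  change |x| ≤ |R| + 1
  linarith [le_abs_self R]

/-- A compactly supported function which is the identity on `[0,1]`. -/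
def truncId : ℝ → ℝ := fun x => Classical.choose (exists_cutoff 2) x * x

theorem contDiff_truncId : ContDiff ℝ ∞ truncId :=
  (Classical.choose_spec (exists_cutoff 2)).1.mul contDiff_id

theorem truncId_bddC2 : BddC2 truncId :=
  BddC2.of_hasCompactSupport (contDiff_infty.1 contDiff_truncId 2)
    (Classical.choose_spec (exists_cutoff 2)).2.1.mul_right

theorem truncId_eq {x : ℝ} (hx : |x| ≤ 2) : truncId x = x := by
  rw [truncId, (Classical.choose_spec (exists_cutoff 2)).2.2 x hx, one_mul]

theorem truncId_eq_of_mem {x : ℝ} (hx : x ∈ Icc (0 : ℝ) 1) : truncId x = x :=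
  truncId_eq (by rw [abs_of_nonneg hx.1]; linarith [hx.2])

theorem deriv_truncId {x : ℝ} (hx : x ∈ Icc (0 : ℝ) 1) : deriv truncId x = 1 := by
  have h : truncId =ᶠ[𝓝 x] id := by
    filter_upwards [Ioo_mem_nhds (by linarith [hx.1] : (-2 : ℝ) < x)
      (by linarith [hx.2] : x < 2)] with y hy
    exact truncId_eq (abs_le.2 ⟨hy.1.le, hy.2.le⟩)
  rw [h.deriv_eq, deriv_id]

theorem comp_truncId (c : UnitIco → ℝ) (g : QuantileFn) :
    comp c truncId g.1 = ∫ t, c t * g.1 t ∂lebesgueIco := by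
  simp only [comp, truncId_eq_of_mem (g.2.2.1 _)]

/-- The averaging kernel at `s`. -/
def avgKernel (k : ℕ) (s : UnitIco) : UnitIco → ℝ :=
  (Subtype.val ⁻¹' Ico (s : ℝ) (s + 1 / (k + 1))).indicator fun _ => (k + 1 : ℝ)

theorem measurable_avgKernel (k : ℕ) (s : UnitIco) : Measurable (avgKernel k s) :=
  measurable_const.indicator (measurable_subtype_coe measurableSet_Ico)

theorem avgKernel_nonneg (k : ℕ) (s t : UnitIco) : 0 ≤ avgKernel k s t :=
  indicator_nonneg (fun _ _ => by positivity) t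

theorem avgKernel_le (k : ℕ) (s t : UnitIco) : avgKernel k s t ≤ k + 1 :=
  indicator_le_self' (fun _ _ => by positivity) t

theorem integrable_of_bdd {c : UnitIco → ℝ} (hc : Measurable c) {C : ℝ} (hC : ∀ t, |c t| ≤ C) :
    Integrable c lebesgueIco :=
  Integrable.of_bound hc.aestronglyMeasurable C (Eventually.of_forall hC)

theorem integrable_avgKernel (k : ℕ) (s : UnitIco) : Integrable (avgKernel k s) lebesgueIco :=
  integrable_of_bdd (C := k + 1) (measurable_avgKernel k s) fun t => by
    rw [abs_of_nonneg (avgKernel_nonneg k s t)]; exact avgKernel_le k s t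

theorem integrable_mul_quantile {c : UnitIco → ℝ} (hc : Integrable c lebesgueIco)
    (g : QuantileFn) : Integrable (fun t => c t * g.1 t) lebesgueIco :=
  hc.mul_bdd (c := 1) g.measurable.aestronglyMeasurable
    (Eventually.of_forall fun t => by
      rw [Real.norm_eq_abs, abs_of_nonneg (g.2.2.1 t).1]; exact (g.2.2.1 t).2)

/-- By right continuity an evaluation is a limit of averages over intervals to its right, so path
integrals carry as much information as evaluations. -/
theorem tendsto_avg (g : QuantileFn) (s : UnitIco) :
    Tendsto (fun k => ∫ t, avgKernel k s t * g.1 t ∂lebesgueIco) atTop (𝓝 (g.1 s)) := by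
  rw [Metric.tendsto_atTop]
  intro ε hε
  obtain ⟨δ, hδ, hg⟩ := Metric.continuousWithinAt_iff.1 (g.2.2.2 s) (ε / 2) (by positivity)
  have ht : (0 : ℝ) < 1 - s := sub_pos.2 s.2.2
  obtain ⟨N, hN⟩ := exists_nat_one_div_lt (lt_min hδ ht)
  refine ⟨N, fun k hn => ?_⟩
  have hnN : (1 : ℝ) / (k + 1) ≤ 1 / (N + 1) :=
    one_div_le_one_div_of_le (by positivity) (by gcongr)
  have h1 : (1 : ℝ) / (k + 1) < δ := hnN.trans_lt (hN.trans_le (min_le_left _ _))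
  have h2 : (1 : ℝ) / (k + 1) < 1 - s := hnN.trans_lt (hN.trans_le (min_le_right _ _))
  have hp : (0 : ℝ) < k + 1 := by positivity
  have hint1 : ∫ t, avgKernel k s t ∂lebesgueIco = 1 := by
    rw [avgKernel, integral_indicator (measurable_subtype_coe measurableSet_Ico),
      setIntegral_const, Measure.real, lebesgueIco_preimage, inter_eq_left.2, Real.volume_Ico,
      ENNReal.toReal_ofReal]
    · rw [add_sub_cancel_left, smul_eq_mul]; field_simp
    · rw [add_sub_cancel_left]; positivity
    · exact Ico_subset_Ico s.2.1 (by linarith)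
  have heq : ∫ t, avgKernel k s t * g.1 t ∂lebesgueIco - g.1 s =
      ∫ t, avgKernel k s t * (g.1 t - g.1 s) ∂lebesgueIco := by
    simp only [mul_sub]
    rw [integral_sub (integrable_mul_quantile (integrable_avgKernel k s) g)
      ((integrable_avgKernel k s).mul_const _), integral_mul_const, hint1, one_mul]
  rw [Real.dist_eq, heq]
  have hle : |∫ t, avgKernel k s t * (g.1 t - g.1 s) ∂lebesgueIco| ≤
      ∫ t, avgKernel k s t * (ε / 2) ∂lebesgueIco := by
    refine norm_integral_le_of_norm_le (f := fun t => avgKernel k s t * (g.1 t - g.1 s))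
      ((integrable_avgKernel k s).mul_const _) (Eventually.of_forall fun t => ?_)
    rw [Real.norm_eq_abs, abs_mul, abs_of_nonneg (avgKernel_nonneg k s t)]
    by_cases h : t ∈ Subtype.val ⁻¹' Ico (s : ℝ) (s + 1 / (k + 1))
    · refine mul_le_mul_of_nonneg_left ?_ (avgKernel_nonneg k s t)
      have h3 := hg (show t ∈ Ici s from h.1) (by
        rw [Subtype.dist_eq, Real.dist_eq, abs_of_nonneg (sub_nonneg.2 h.1)]
        linarith [h.2])
      exact h3.le
    · rw [avgKernel, indicator_of_notMem h, zero_mul, zero_mul]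
  rw [integral_mul_const, hint1, one_mul] at hle
  linarith

/-- The orthogonality passes from path integrals to linear combinations of evaluations by
`tendsto_avg`. Hence y⁺ Q and y⁻ Q have the same finite-dimensional marginals and coincide. This is
the totality statement behind all the density arguments below. -/
theorem ae_eq_zero_of_trig_path {Q : Measure QuantileFn} [IsFiniteMeasure Q]
    {y : QuantileFn → ℝ} (hy : Integrable y Q)
    (hcos : ∀ c : UnitIco → ℝ, Measurable c → (∃ C, ∀ t, |c t| ≤ C) →
      ∫ g, Real.cos (∫ t, c t * g.1 t ∂lebesgueIco) * y g ∂Q = 0)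
    (hsin : ∀ c : UnitIco → ℝ, Measurable c → (∃ C, ∀ t, |c t| ≤ C) →
      ∫ g, Real.sin (∫ t, c t * g.1 t ∂lebesgueIco) * y g ∂Q = 0) : y =ᵐ[Q] 0 := by
  classical
  have hev : ∀ c : UnitIco → ℝ, Measurable c →
      StronglyMeasurable fun g : QuantileFn => ∫ t, c t * g.1 t ∂lebesgueIco := fun c hc =>
    StronglyMeasurable.integral_prod_right
      (f := fun (g : QuantileFn) (t : UnitIco) => c t * g.1 t)
      ((hc.comp measurable_snd).mul measurable_eval).stronglyMeasurable
  have hfin : ∀ I : Finset UnitIco,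
      (Q.withDensity fun x => ENNReal.ofReal (y x)).map (fun g (i : I) => g.1 i) =
      (Q.withDensity fun x => ENNReal.ofReal (-y x)).map (fun g (i : I) => g.1 i) := by
    intro I
    -- A functional of finitely many evaluations is the limit of integrals against combinations of
    -- averaging kernels.
    have key : ∀ L : StrongDual ℝ (I → ℝ), ∃ c : ℕ → UnitIco → ℝ,
        (∀ k, Measurable (c k) ∧ ∃ C, ∀ t, |c k t| ≤ C) ∧ ∀ g : QuantileFn,
        Tendsto (fun k => ∫ t, c k t * g.1 t ∂lebesgueIco) atTop (𝓝 (L fun i : I => g.1 i)) := by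
      intro L
      refine ⟨fun k t => ∑ i : I, avgKernel k i t * L (Pi.single i 1), fun k => ⟨?_, ?_⟩,
        fun g => ?_⟩
      · exact Finset.measurable_sum _ fun i _ => (measurable_avgKernel k i).mul_const _
      · refine ⟨∑ i : I, (k + 1) * |L (Pi.single i 1)|, fun t => ?_⟩
        refine (Finset.abs_sum_le_sum_abs _ _).trans (Finset.sum_le_sum fun i _ => ?_)
        rw [abs_mul, abs_of_nonneg (avgKernel_nonneg k i t)]
        gcongr
        exact avgKernel_le k i t
      · have h1 : ∀ k, ∫ t, (∑ i : I, avgKernel k i t * L (Pi.single i 1)) * g.1 t ∂lebesgueIco =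
            ∑ i : I, (∫ t, avgKernel k i t * g.1 t ∂lebesgueIco) * L (Pi.single i 1) := by
          intro k
          simp only [Finset.sum_mul]
          rw [integral_finsetSum]
          · refine Finset.sum_congr rfl fun i _ => ?_
            rw [← integral_mul_const]
            refine integral_congr_ae (Eventually.of_forall fun t => ?_)
            simp only
            ring
          · intro i _
            refine ((integrable_mul_quantile (integrable_avgKernel k i) g).mul_const
              (L (Pi.single i 1))).congr (Eventually.of_forall fun t => ?_)
            simp only
            ring
        simp only [h1]
        rw [clm_apply_eq_sum L]
        exact tendsto_finsetSum _ fun i _ => (tendsto_avg g i).mul_const _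
    refine map_withDensity_eq_of_trig ?_ hy (fun L => ?_) fun L => ?_
    · exact measurable_pi_lambda _ fun i => (measurable_pi_apply _).comp measurable_subtype_coe
    · obtain ⟨c, hc, hlim⟩ := key L
      have h := tendsto_integral_of_dominated_convergence (μ := Q)
        (F := fun k g => Real.cos (∫ t, c k t * g.1 t ∂lebesgueIco) * y g)
        (f := fun g => Real.cos (L fun i : I => g.1 i) * y g) (fun g => |y g|)
        (fun k => (Real.continuous_cos.comp_stronglyMeasurable
          (hev _ (hc k).1)).aestronglyMeasurable.mul hy.1) hy.abs
        (fun k => Eventually.of_forall fun g => by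
          rw [Real.norm_eq_abs, abs_mul]
          exact mul_le_of_le_one_left (abs_nonneg _) (Real.abs_cos_le_one _))
        (Eventually.of_forall fun g =>
          ((Real.continuous_cos.tendsto _).comp (hlim g)).mul_const _)
      simp only [hcos _ (hc _).1 (hc _).2] at h
      exact (tendsto_nhds_unique tendsto_const_nhds h).symm
    · obtain ⟨c, hc, hlim⟩ := key L
      have h := tendsto_integral_of_dominated_convergence (μ := Q)
        (F := fun k g => Real.sin (∫ t, c k t * g.1 t ∂lebesgueIco) * y g)
        (f := fun g => Real.sin (L fun i : I => g.1 i) * y g) (fun g => |y g|)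
        (fun k => (Real.continuous_sin.comp_stronglyMeasurable
          (hev _ (hc k).1)).aestronglyMeasurable.mul hy.1) hy.abs
        (fun k => Eventually.of_forall fun g => by
          rw [Real.norm_eq_abs, abs_mul]
          exact mul_le_of_le_one_left (abs_nonneg _) (Real.abs_sin_le_one _))
        (Eventually.of_forall fun g =>
          ((Real.continuous_sin.tendsto _).comp (hlim g)).mul_const _)
      simp only [hsin _ (hc _).1 (hc _).2] at h
      exact (tendsto_nhds_unique tendsto_const_nhds h).symm
  refine ae_eq_zero_of_withDensity_eq hy ?_
  set μ₁ := Q.withDensity fun x => ENNReal.ofReal (y x)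
  set μ₂ := Q.withDensity fun x => ENNReal.ofReal (-y x)
  have hf2 : IsFiniteMeasure μ₂ := isFiniteMeasure_withDensity_ofReal hy.neg.2
  have hmm : ∀ (μ : Measure QuantileFn) (I : Finset UnitIco),
      (μ.map (Subtype.val : QuantileFn → UnitIco → ℝ)).map I.restrict =
        μ.map fun g (i : I) => g.1 i := fun μ I => by
    rw [Measure.map_map (Finset.measurable_restrict I) measurable_subtype_coe]
    rfl
  -- Marginals determine a finite measure on the full product space, and the measurable sets of
  -- `QuantileFn` are the traces of measurable sets there.
  have hval : μ₁.map (Subtype.val : QuantileFn → UnitIco → ℝ) = μ₂.map Subtype.val := by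
    refine IsProjectiveLimit.unique
      (P := fun I => (μ₂.map (Subtype.val : QuantileFn → UnitIco → ℝ)).map I.restrict)
      (fun I => ?_) fun I => rfl
    exact (hmm _ I).trans ((hfin I).trans (hmm _ I).symm)
  ext s hs
  obtain ⟨B, hB, rfl⟩ := hs
  rw [← Measure.map_apply measurable_subtype_coe hB, hval,
    Measure.map_apply measurable_subtype_coe hB]

/-! ### Divergences of vector fields on the path space -/

section Lift

variable {β : ℝ} {Q : Measure QuantileFn} (hQ : IsDirichletLaw β Q)

include hQ in
theorem IsDirichletLaw.isProbabilityMeasure_particle (n : ℕ) :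
    IsProbabilityMeasure (particleMeasure β n) := by
  have := hQ.isProbabilityMeasure
  rw [← (hQ.measurePreserving n).map_eq]
  exact Measure.isProbabilityMeasure_map (hQ.measurePreserving n).measurable.aemeasurable

theorem liftMap_ae (n : ℕ) (f : Lp ℝ 2 (particleMeasure β n)) :
    liftMap hQ n f =ᵐ[Q] fun g => f (gridEval n g) :=
  Lp.coeFn_compMeasurePreserving f (hQ.measurePreserving n)

theorem liftMap_ae_of_ae (n : ℕ) {f : Lp ℝ 2 (particleMeasure β n)} {F : (Fin n → ℝ) → ℝ}
    (h : f =ᵐ[particleMeasure β n] F) : liftMap hQ n f =ᵐ[Q] fun g => F (gridEval n g) :=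
  (liftMap_ae hQ n f).trans ((hQ.measurePreserving n).quasiMeasurePreserving.ae_eq_comp h)

include hQ in
theorem ae_gap_gridEval (n : ℕ) : ∀ᵐ g ∂Q, ∀ i, 0 < gap (gridEval n g) i :=
  (hQ.measurePreserving n).quasiMeasurePreserving.ae
    (ae_mem_particleMeasure.mono fun _ h => h.2)

include hQ in
theorem integral_gridEval (n : ℕ) {F : (Fin n → ℝ) → ℝ}
    (hF : AEStronglyMeasurable F (particleMeasure β n)) :
    ∫ g, F (gridEval n g) ∂Q = ∫ x, F x ∂(particleMeasure β n) := by
  have hmp := hQ.measurePreserving n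
  rw [← hmp.map_eq] at hF ⊢
  exact (integral_map hmp.measurable.aemeasurable hF).symm

/-- Bounded approximation of a function of `g` by functions of `gridEval n g`. -/
theorem exists_tendsto_lift {F : ∀ n, (Fin n → ℝ) → ℝ} (hF : ∀ n, Measurable (F n)) {C : ℝ}
    (hC : ∀ n, ∀ x ∈ orderedSimplex n, |F n x| ≤ C) {u : Lp ℝ 2 Q} {G : QuantileFn → ℝ}
    (hu : u =ᵐ[Q] G) (hl : ∀ g, Tendsto (fun n => F n (gridEval n g)) atTop (𝓝 (G g))) :
    ∃ v : ∀ n, Lp ℝ 2 (particleMeasure β n), (∀ n, v n =ᵐ[particleMeasure β n] F n) ∧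
      Tendsto (fun n => liftMap hQ n (v n)) atTop (𝓝 u) := by
  have := hQ.isProbabilityMeasure
  have hp := hQ.isProbabilityMeasure_particle
  have hmem : ∀ n, MemLp (F n) 2 (particleMeasure β n) := fun n =>
    MemLp.of_bound (hF n).aestronglyMeasurable C
      (ae_mem_particleMeasure.mono fun x hx => hC n x hx.1)
  refine ⟨fun n => (hmem n).toLp _, fun n => (hmem n).coeFn_toLp, ?_⟩
  have h1 : ∀ n, liftMap hQ n ((hmem n).toLp _) =ᵐ[Q] fun g => F n (gridEval n g) := fun n =>
    liftMap_ae_of_ae hQ n (hmem n).coeFn_toLp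
  refine L2_tendsto_of_bounded C (fun n => ?_) ?_
  · filter_upwards [h1 n] with g hg
    rw [hg]
    exact hC n _ (gridEval_mem n g)
  · filter_upwards [ae_all_iff.2 h1, hu] with g h2 h3
    rw [h3]
    exact (hl g).congr fun n => (h2 n).symm

theorem isTest_comp (φ : ℝ → ℝ) {c : UnitIco → ℝ} (hc : Integrable c lebesgueIco) {ψ : ℝ → ℝ}
    (hψ : BddC2 ψ) : IsTest φ (comp c ψ) (comp c fun x => deriv ψ x * φ x) := by
  refine ⟨Unit, inferInstance, fun y => y (), fun _ => c, fun _ => ψ, contDiff_apply ℝ ℝ (),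
    fun _ => hc, fun _ => hψ, fun _ => rfl, fun h => ?_⟩
  rw [(hasFDerivAt_apply (𝕜 := ℝ) (F' := fun _ : Unit => ℝ) () _).fderiv]
  rfl

theorem IsTest.exists_tendsto_lift {φ : ℝ → ℝ} {w dw : (UnitIco → ℝ) → ℝ} (h : IsTest φ w dw)
    (hφ : BddC2 φ) {u : Lp ℝ 2 Q} (hu : u =ᵐ[Q] fun g => w g.1) :
    ∃ v : ∀ n, Lp ℝ 2 (particleMeasure β n),
      (∀ n, v n =ᵐ[particleMeasure β n] fun x => w (step n x)) ∧
      Tendsto (fun n => liftMap hQ n (v n)) atTop (𝓝 u) := by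
  obtain ⟨C, hC⟩ := h.bounded hφ
  exact _root_.exists_tendsto_lift hQ (fun n => (h.contDiff_step n).continuous.measurable)
    (fun n x _ => (hC _).1) hu fun g =>
      (h.tendsto hφ (fun n => measurable_step _) (tendsto_step_gridEval g)).1

theorem vecField_zero : VecField fun _ => 0 :=
  { contDiff := contDiff_const
    bound := ⟨0, le_rfl, by simp⟩
    zero := rfl
    one := rfl }

/-- The conditional expectations converge strongly. -/
theorem tendsto_condExp (u : Lp ℝ 2 Q) :
    Tendsto (fun n => liftMap hQ n (condExpMap hQ n u)) atTop (𝓝 u) := by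
  have := hQ.isProbabilityMeasure
  -- S collects the limits of lifted particle functions. It contains every C¹ function of ∫ c g,
  -- because such a function may be evaluated at step functions.
  let S : Submodule ℝ (Lp ℝ 2 Q) :=
    { carrier := {u | ∃ v : ∀ n, Lp ℝ 2 (particleMeasure β n),
        Tendsto (fun n => liftMap hQ n (v n)) atTop (𝓝 u)}
      zero_mem' := ⟨fun _ => 0, by simp⟩
      add_mem' := by
        rintro a b ⟨v, hv⟩ ⟨w, hw⟩
        exact ⟨fun n => v n + w n, by simpa using hv.add hw⟩
      smul_mem' := by
        rintro r a ⟨v, hv⟩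
        exact ⟨fun n => r • v n, by simpa using hv.const_smul r⟩ }
  refine tendsto_projection (liftMap hQ) (S : Set (Lp ℝ 2 Q)) ?_ (fun u hu => hu) u
  refine dense_of_orthogonal S fun y hy => ?_
  -- Only values matter here, so the zero field is used; `truncId` replaces the identity on [0, 1]
  -- by a function with bounded derivatives.
  have key : ∀ c : UnitIco → ℝ, Measurable c → (∃ C, ∀ t, |c t| ≤ C) → ∀ T : ℝ → ℝ,
      ContDiff ℝ 1 T → ∫ g, T (∫ t, c t * g.1 t ∂lebesgueIco) * y g ∂Q = 0 := by
    rintro c hc ⟨C, hC⟩ T hT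
    have ht := (isTest_comp (fun _ => 0) (integrable_of_bdd hc hC) truncId_bddC2).comp_left hT
    obtain ⟨B, hB⟩ := ht.bounded vecField_zero.toBddC2
    have hmem : MemLp (fun g : QuantileFn => T (comp c truncId g.1)) 2 Q :=
      MemLp.of_bound (ht.measurable vecField_zero).1.aestronglyMeasurable B
        (Eventually.of_forall fun g => (hB _).1)
    obtain ⟨v, -, hv⟩ := ht.exists_tendsto_lift hQ vecField_zero.toBddC2 hmem.coeFn_toLp
    have h1 := hy _ (show hmem.toLp _ ∈ S from ⟨v, hv⟩)
    rw [L2_inner_congr hmem.coeFn_toLp EventuallyEq.rfl] at h1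
    simpa only [comp_truncId] using h1
  have h0 : (y : QuantileFn → ℝ) =ᵐ[Q] 0 :=
    ae_eq_zero_of_trig_path ((Lp.memLp y).integrable (by norm_num))
      (fun c hc hC => key c hc hC _ (Real.contDiff_cos))
      fun c hc hC => key c hc hC _ (Real.contDiff_sin)
  exact (Lp.eq_zero_iff_ae_eq_zero).2 h0

theorem measurable_vecDiv {φ : ℝ → ℝ} (hφ : BddC2 φ) (n : ℕ) : Measurable (vecDiv β n φ) := by
  unfold vecDiv
  refine (Finset.measurable_sum _ fun i _ =>
    hφ.continuous_deriv.measurable.comp (measurable_pi_apply i)).add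
    ((Finset.measurable_sum _ fun i _ => ?_).const_mul _)
  exact ((hφ.continuous.comp (continuous_withEnds _)).sub
    (hφ.continuous.comp (continuous_withEnds _))).measurable.div (continuous_gap i).measurable

include hQ in
/-- Integration by parts along a coarser grid. -/
theorem integral_mul_vecDiv (hβ : 0 < β) {φ : ℝ → ℝ} (hφ : VecField φ) {n m d : ℕ}
    (hd : m + 1 = (n + 1) * d) {f : (Fin n → ℝ) → ℝ} (hf : ContDiff ℝ 1 f) :
    ∫ g, f (gridEval n g) * vecDiv β m φ (gridEval m g) ∂Q =
      -∫ g, fderiv ℝ f (gridEval n g) (fun i => φ (gridEval n g i)) ∂Q := by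
  have := hQ.isProbabilityMeasure
  have hpm := hQ.isProbabilityMeasure_particle m
  have hd0 : 0 < d := Nat.pos_of_ne_zero fun h => by simp [h] at hd
  -- The coarse time (i+1)/(n+1) equals the fine time (i+1)d/(m+1), which has zero-based index
  -- (i+1)d - 1.
  have hs : ∀ i : Fin n, (i + 1) * d - 1 < m := fun i => by
    have h1 : (i + 1) * d ≤ n * d := Nat.mul_le_mul_right d i.2
    have h2 : 1 ≤ (i + 1) * d := Nat.succ_le_of_lt (by positivity)
    have h3 : (n + 1) * d = n * d + d := by ring
    omega
  -- L selects the coarse coordinates from the fine ones. The field acts coordinatewise, so it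
  -- commutes with L, and the fine-grid formula applied to f ∘ L mentions only the coarse
  -- derivative.
  let L : (Fin m → ℝ) →L[ℝ] (Fin n → ℝ) :=
    ContinuousLinearMap.pi fun i => ContinuousLinearMap.proj ⟨(i + 1) * d - 1, hs i⟩
  have hL : ∀ g, L (gridEval m g) = gridEval n g := by
    intro g
    ext i
    change g.1 (gridTime m ⟨(i + 1) * d - 1, hs i⟩) = g.1 (gridTime n i)
    refine congrArg g.1 (Subtype.ext ?_)
    change (((i + 1) * d - 1 + 1 : ℕ) : ℝ) / (m + 1 : ℕ) = ((i + 1 : ℕ) : ℝ) / (n + 1 : ℕ)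
    have h2 : 1 ≤ (i + 1) * d := Nat.succ_le_of_lt (by positivity)
    rw [Nat.sub_add_cancel h2, hd]
    push_cast
    field_simp
  have hfL : ContDiff ℝ 1 fun x => f (L x) := hf.comp L.contDiff
  have hcA : Continuous fun x : Fin n → ℝ => fderiv ℝ f x (fun i => φ (x i)) :=
    (hf.continuous_fderiv (by norm_num)).clm_apply
      (continuous_pi fun i => hφ.continuous.comp (continuous_apply i))
  have hder : ∀ x, fderiv ℝ (fun x => f (L x)) x (fun i => φ (x i)) =
      fderiv ℝ f (L x) (fun i => φ (L x i)) := by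
    intro x
    have h := (hf.differentiable (by norm_num) (L x)).hasFDerivAt.comp x L.hasFDerivAt
    rw [show fderiv ℝ (fun x => f (L x)) x = _ from h.fderiv]
    rfl
  have h0 := integral_particle_div hβ hφ hfL
  have hmeas : Measurable fun x => fderiv ℝ f (L x) (fun i => φ (L x i)) :=
    hcA.measurable.comp L.continuous.measurable
  have hmeas2 : Measurable fun x => f (L x) * vecDiv β m φ x :=
    (hf.continuous.measurable.comp L.continuous.measurable).mul (measurable_vecDiv hφ.toBddC2 m)
  simp only [hder] at h0
  have hmeas3 : Measurable fun x => fderiv ℝ f (L x) (fun i => φ (L x i)) +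
      f (L x) * vecDiv β m φ x := hmeas.add hmeas2
  rw [← integral_gridEval hQ m hmeas3.aestronglyMeasurable] at h0
  simp only [hL] at h0
  obtain ⟨A, hA⟩ := (isCompact_orderedSimplex n).exists_bound_of_continuousOn hcA.continuousOn
  obtain ⟨B, hB⟩ :=
    (isCompact_orderedSimplex n).exists_bound_of_continuousOn hf.continuous.continuousOn
  obtain ⟨C, hC0, hC⟩ := hφ.bound
  have hi1 : Integrable (fun g => fderiv ℝ f (gridEval n g) (fun i => φ (gridEval n g i))) Q :=
    Integrable.of_bound (hcA.measurable.comp (measurable_gridEval n)).aestronglyMeasurable A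
      (Eventually.of_forall fun g => hA _ (gridEval_mem n g))
  have hi2 : Integrable (fun g => f (gridEval n g) * vecDiv β m φ (gridEval m g)) Q := by
    refine Integrable.of_bound ((hf.continuous.measurable.comp (measurable_gridEval n)).mul
      ((measurable_vecDiv hφ.toBddC2 m).comp (measurable_gridEval m))).aestronglyMeasurable
      (B * ((β + 2) * C)) ?_
    filter_upwards [ae_gap_gridEval hQ m] with g hg
    rw [Real.norm_eq_abs, abs_mul]
    have hB' := hB _ (gridEval_mem n g)
    exact mul_le_mul hB' (abs_vecDiv_le hβ hφ.toBddC2 (fun x => (hC x).2) hg) (abs_nonneg _)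
      ((norm_nonneg _).trans hB')
  rw [integral_add hi1 hi2] at h0
  linarith

/-- The divergence of a vector field on the path space, as a limit of the divergences for the
particle measures. -/
structure IsDivergence (φ : ℝ → ℝ) (V : Lp ℝ 2 Q) : Prop where
  bound : ∃ C, ∀ᵐ g ∂Q, |V g| ≤ C
  tendsto : ∃ (C : ℝ) (v : ∀ n, Lp ℝ 2 (particleMeasure β n)),
    (∀ n, v n =ᵐ[particleMeasure β n] vecDiv β n φ) ∧
    (∀ n, ∀ᵐ x ∂(particleMeasure β n), |vecDiv β n φ x| ≤ C) ∧
    Tendsto (fun n => liftMap hQ n (v n)) atTop (𝓝 V)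

/-- By `integral_mul_vecDiv`, the divergence on a refined grid projects onto the one on the coarse
grid. A weak limit V along ever finer grids therefore has all the `vecDiv β n φ` as its conditional
expectations, and `tendsto_condExp` upgrades weak to strong convergence. -/
theorem exists_divergence (hβ : 0 < β) {φ : ℝ → ℝ} (hφ : VecField φ) :
    ∃ V : Lp ℝ 2 Q, IsDivergence hQ φ V := by
  have := hQ.isProbabilityMeasure
  have hp := hQ.isProbabilityMeasure_particle
  obtain ⟨C, hC0, hC⟩ := hφ.bound
  have hbd : ∀ n, ∀ᵐ x ∂(particleMeasure β n), |vecDiv β n φ x| ≤ (β + 2) * C := fun n =>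
    ae_mem_particleMeasure.mono fun x hx =>
      abs_vecDiv_le hβ hφ.toBddC2 (fun x => (hC x).2) hx.2
  have hmem : ∀ n, MemLp (vecDiv β n φ) 2 (particleMeasure β n) := fun n =>
    MemLp.of_bound (measurable_vecDiv hφ.toBddC2 n).aestronglyMeasurable _ (hbd n)
  set v : ∀ n, Lp ℝ 2 (particleMeasure β n) := fun n => (hmem n).toLp _ with hv
  have hvae : ∀ n, v n =ᵐ[particleMeasure β n] vecDiv β n φ := fun n => (hmem n).coeFn_toLp
  have hvn : ∀ n, ‖v n‖ ≤ (β + 2) * C := by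
    intro n
    have h1 : ∀ᵐ x ∂(particleMeasure β n), ‖v n x‖ ≤ (β + 2) * C := by
      filter_upwards [hvae n, hbd n] with x h1 h2
      rw [h1]; exact h2
    have := Lp.norm_le_of_ae_bound (by positivity) h1
    simpa [measureUnivNNReal] using this
  -- Grids with N = k! intervals, that is n = k! - 1, eventually refine every fixed grid.
  obtain ⟨V, -, hV⟩ := exists_weak_limit (Ultrafilter.of (atTop : Filter ℕ))
    (fun k : ℕ => liftMap hQ (k.factorial - 1) (v (k.factorial - 1))) ((β + 2) * C)
    (Eventually.of_forall fun k => by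
      simp only [LinearIsometry.norm_map]; exact hvn _)
  have hproj : ∀ n, condExpMap hQ n V = v n := by
    intro n
    have key : ∀ f : (Fin n → ℝ) → ℝ, ContDiff ℝ 1 f →
        ∫ x, f x * (condExpMap hQ n V - v n) x ∂(particleMeasure β n) = 0 := by
      intro f hf
      obtain ⟨B, hB⟩ :=
        (isCompact_orderedSimplex n).exists_bound_of_continuousOn hf.continuous.continuousOn
      have hfm : MemLp f 2 (particleMeasure β n) :=
        MemLp.of_bound hf.continuous.aestronglyMeasurable B
          (ae_mem_particleMeasure.mono fun x hx => hB x hx.1)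
      rw [← L2_inner_congr hfm.coeFn_toLp EventuallyEq.rfl, inner_sub_right, real_inner_comm,
        condExpMap, ContinuousLinearMap.adjoint_inner_left]
      have h1 := hV (liftMap hQ n (hfm.toLp f))
      -- Both pairings equal minus the integral of the derivative of f along φ; the case d = 1
      -- treats the coarse grid itself.
      have h2 : ∀ᶠ k : ℕ in ((Ultrafilter.of (atTop : Filter ℕ) : Ultrafilter ℕ) : Filter ℕ),
          inner ℝ (liftMap hQ (k.factorial - 1) (v (k.factorial - 1)))
            (liftMap hQ n (hfm.toLp f)) = inner ℝ (hfm.toLp f) (v n) := by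
        have h3 : ∀ᶠ k : ℕ in atTop, n + 1 ≤ k := eventually_ge_atTop _
        refine (Ultrafilter.of_le atTop) (h3.mono fun k hk => ?_)
        have h4 : k.factorial - 1 + 1 = k.factorial := Nat.sub_add_cancel k.factorial_pos
        obtain ⟨d, hd⟩ := Nat.dvd_factorial (Nat.succ_pos n) hk
        have h5 := integral_mul_vecDiv hQ hβ hφ (n := n) (m := k.factorial - 1) (d := d)
          (by rw [h4]; exact hd) hf
        have h6 := integral_mul_vecDiv hQ hβ hφ (n := n) (m := n) (d := 1) (by ring) hf
        rw [real_inner_comm, L2_inner_congr (liftMap_ae_of_ae hQ n hfm.coeFn_toLp)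
          (liftMap_ae_of_ae hQ _ (hvae _)), h5, ← h6, ← LinearIsometry.inner_map_map (liftMap hQ n),
          L2_inner_congr (liftMap_ae_of_ae hQ n hfm.coeFn_toLp) (liftMap_ae_of_ae hQ _ (hvae _))]
      have h3 := tendsto_nhds_unique h1
        ((tendsto_congr' h2).2 tendsto_const_nhds)
      exact sub_eq_zero.2 h3
    have hint := (Lp.memLp (condExpMap hQ n V - v n)).integrable (by norm_num)
    have h0 := ae_eq_zero_of_withDensity_eq hint (by
      have := map_withDensity_eq_of_trig (p := id) measurable_id hint
        (fun L => key _ (Real.contDiff_cos.comp L.contDiff))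
        fun L => key _ (Real.contDiff_sin.comp L.contDiff)
      simpa only [Measure.map_id] using this)
    exact sub_eq_zero.1 ((Lp.eq_zero_iff_ae_eq_zero).2 h0)
  have hlim : Tendsto (fun n => liftMap hQ n (v n)) atTop (𝓝 V) := by
    simpa only [hproj] using tendsto_condExp hQ V
  refine ⟨V, ⟨(β + 2) * C, L2_abs_le_of_tendsto hlim fun n => ?_⟩, _, v, hvae, hbd, hlim⟩
  have h1 := (hQ.measurePreserving n).quasiMeasurePreserving.ae (hbd n)
  filter_upwards [liftMap_ae_of_ae hQ n (hvae n), h1] with g h2 h3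
  rw [h2]
  exact h3

end Lift

/-! ### Integration by parts on the path space -/

theorem memLp_bdd_mul {Ω : Type*} [MeasurableSpace Ω] {μ : Measure Ω} {a b : Ω → ℝ} {C : ℝ}
    (hb : MemLp b 2 μ) (ham : AEStronglyMeasurable a μ) (ha : ∀ᵐ x ∂μ, |a x| ≤ C) :
    MemLp (fun x => a x * b x) 2 μ :=
  hb.of_le_mul (c := C) (ham.mul hb.1) (ha.mono fun x hx => by
    rw [norm_mul]
    exact mul_le_mul_of_nonneg_right hx (norm_nonneg _))

section Path

variable {β : ℝ} {Q : Measure QuantileFn} {hQ : IsDirichletLaw β Q} {φ : ℝ → ℝ}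
  {w dw : (UnitIco → ℝ) → ℝ} {V : Lp ℝ 2 Q}

theorem IsTest.measurable_step (h : IsTest φ w dw) (hφ : VecField φ) (n : ℕ) :
    (Measurable fun x : Fin n → ℝ => w (step n x)) ∧
      Measurable fun x : Fin n → ℝ => dw (step n x) := by
  refine ⟨(h.contDiff_step n).continuous.measurable, ?_⟩
  simp only [← h.fderiv_step hφ.zero hφ.one]
  exact (((h.contDiff_step n).continuous_fderiv (by norm_num)).clm_apply
    (continuous_pi fun i => hφ.continuous.comp (continuous_apply i))).measurable

theorem IsTest.memLp [IsFiniteMeasure Q] (h : IsTest φ w dw) (hφ : VecField φ) :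
    MemLp (fun g : QuantileFn => w g.1) 2 Q ∧ MemLp (fun g : QuantileFn => dw g.1) 2 Q := by
  obtain ⟨C, hC⟩ := h.bounded hφ.toBddC2
  exact ⟨MemLp.of_bound (h.measurable hφ).1.aestronglyMeasurable C
    (Eventually.of_forall fun g => (hC _).1),
    MemLp.of_bound (h.measurable hφ).2.aestronglyMeasurable C
    (Eventually.of_forall fun g => (hC _).2)⟩

theorem IsTest.memLp_mul [IsFiniteMeasure Q] (h : IsTest φ w dw) (hφ : VecField φ)
    (V : Lp ℝ 2 Q) : MemLp (fun g : QuantileFn => w g.1 * V g) 2 Q := by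
  obtain ⟨C, hC⟩ := h.bounded hφ.toBddC2
  exact memLp_bdd_mul (C := C) (Lp.memLp V) (h.measurable hφ).1.aestronglyMeasurable
    (Eventually.of_forall fun g => (hC _).1)

theorem IsTest.memLp_div [IsFiniteMeasure Q] (h : IsTest φ w dw) (hφ : VecField φ)
    (V : Lp ℝ 2 Q) : MemLp (fun g : QuantileFn => dw g.1 + w g.1 * V g) 2 Q :=
  (h.memLp hφ).2.add (h.memLp_mul hφ V)

/-- The term dw converges boundedly. In w V the second factor converges only in L², which the
boundedness of w makes sufficient (`L2_tendsto_mul`). -/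
theorem IsTest.exists_tendsto_div (h : IsTest φ w dw) (hφ : VecField φ)
    (hV : IsDivergence hQ φ V) {δ : Lp ℝ 2 Q} (hδ : δ =ᵐ[Q] fun g => dw g.1 + w g.1 * V g) :
    ∃ v : ∀ n, Lp ℝ 2 (particleMeasure β n),
      (∀ n, v n =ᵐ[particleMeasure β n] fun x => dw (step n x) + w (step n x) * vecDiv β n φ x) ∧
      Tendsto (fun n => liftMap hQ n (v n)) atTop (𝓝 δ) := by
  have := hQ.isProbabilityMeasure
  have hp := hQ.isProbabilityMeasure_particle
  obtain ⟨C, hC⟩ := h.bounded hφ.toBddC2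
  obtain ⟨D, v, hv, hD, hlim⟩ := hV.tendsto
  obtain ⟨a, ha, halim⟩ := _root_.exists_tendsto_lift hQ (fun n => (h.measurable_step hφ n).2)
    (fun n x _ => (hC _).2) (h.memLp hφ).2.coeFn_toLp fun g =>
      (h.tendsto hφ.toBddC2 (fun n => _root_.measurable_step _) (tendsto_step_gridEval g)).2
  have hm : ∀ n, MemLp (fun x => w (step n x) * v n x) 2 (particleMeasure β n) := fun n =>
    memLp_bdd_mul (C := C) (Lp.memLp (v n)) (h.measurable_step hφ n).1.aestronglyMeasurable
      (Eventually.of_forall fun g => (hC _).1)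
  have hb : Tendsto (fun n => liftMap hQ n ((hm n).toLp _)) atTop
      (𝓝 ((h.memLp_mul hφ V).toLp _)) := by
    refine L2_tendsto_mul (a := fun n g => w (step n (gridEval n g))) (a' := fun g => w g.1)
      (b := fun n => liftMap hQ n (v n)) (b' := V) (C := C) (fun n => ?_) ?_ (fun n => ?_) ?_
      hlim (fun n => ?_) (h.memLp_mul hφ V).coeFn_toLp
    · exact ((h.measurable_step hφ n).1.comp (measurable_gridEval n)).aestronglyMeasurable
    · exact (h.measurable hφ).1.aestronglyMeasurable
    · exact Eventually.of_forall fun g => (hC _).1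
    · exact Eventually.of_forall fun g =>
        (h.tendsto hφ.toBddC2 (fun n => _root_.measurable_step _) (tendsto_step_gridEval g)).1
    · filter_upwards [liftMap_ae_of_ae hQ n (hm n).coeFn_toLp, liftMap_ae hQ n (v n)]
        with g h1 h2
      rw [h1, h2]
  refine ⟨fun n => a n + (hm n).toLp _, fun n => ?_, ?_⟩
  · filter_upwards [Lp.coeFn_add (a n) ((hm n).toLp _), ha n, (hm n).coeFn_toLp, hv n]
      with x h1 h2 h3 h4
    rw [h1, Pi.add_apply, h2, h3, h4]
  · have hδ' : δ = (h.memLp hφ).2.toLp _ + (h.memLp_mul hφ V).toLp _ := by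
      refine Lp.ext ?_
      filter_upwards [hδ, Lp.coeFn_add ((h.memLp hφ).2.toLp _) ((h.memLp_mul hφ V).toLp _),
        (h.memLp hφ (Q := Q)).2.coeFn_toLp, (h.memLp_mul hφ V).coeFn_toLp] with g h1 h2 h3 h4
      rw [h1, h2, Pi.add_apply, h3, h4]
    rw [hδ']
    simpa only [map_add] using halim.add hb

theorem integral_particle_test (hQ : IsDirichletLaw β Q) (hβ : 0 < β) (h : IsTest φ w dw)
    (hφ : VecField φ) (n : ℕ) :
    ∫ x, (dw (step n x) + w (step n x) * vecDiv β n φ x) ∂(particleMeasure β n) = 0 := by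
  have := hQ.isProbabilityMeasure_particle n
  simpa only [h.fderiv_step hφ.zero hφ.one] using
    integral_particle_div hβ hφ (h.contDiff_step n)

theorem tendsto_integral_Lp {μ : Measure QuantileFn} [IsFiniteMeasure μ] {f : ℕ → Lp ℝ 2 μ}
    {g : Lp ℝ 2 μ} (h : Tendsto f atTop (𝓝 g)) :
    Tendsto (fun n => ∫ x, f n x ∂μ) atTop (𝓝 (∫ x, g x ∂μ)) := by
  have hone : MemLp (fun _ : QuantileFn => (1 : ℝ)) 2 μ := memLp_const 1
  have h1 := h.inner (𝕜 := ℝ) (tendsto_const_nhds (x := hone.toLp _))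
  simpa only [L2_inner_congr EventuallyEq.rfl hone.coeFn_toLp, mul_one] using h1

/-- Limit of the particle identities. Applied to products of test functions, it is the integration
by parts formula on path space. -/
theorem integral_div_eq_zero' (hβ : 0 < β) (h : IsTest φ w dw) (hφ : VecField φ)
    (hV : IsDivergence hQ φ V) : ∫ g, (dw g.1 + w g.1 * V g) ∂Q = 0 := by
  have := hQ.isProbabilityMeasure
  obtain ⟨v, hv, hlim⟩ := h.exists_tendsto_div hφ hV (h.memLp_div hφ V).coeFn_toLp
  have h1 := tendsto_integral_Lp hlim
  have h2 : ∀ n, ∫ g, liftMap hQ n (v n) g ∂Q = 0 := by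
    intro n
    rw [integral_congr_ae (liftMap_ae hQ n (v n)),
      integral_gridEval hQ n (Lp.aestronglyMeasurable (v n)), integral_congr_ae (hv n)]
    exact integral_particle_test hQ hβ h hφ n
  simp only [h2, integral_congr_ae (h.memLp_div hφ V).coeFn_toLp] at h1
  exact (tendsto_nhds_unique tendsto_const_nhds h1).symm

end Path

/-! ### Resolvent equations for a vector field -/

section Euler

variable {φ : ℝ → ℝ}

theorem BddC2.abs_taylor_le {ψ : ℝ → ℝ} (h : BddC2 ψ) {C : ℝ}
    (hC : ∀ x, |deriv (deriv ψ) x| ≤ C) (x y : ℝ) :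
    |ψ y - ψ x - deriv ψ x * (y - x)| ≤ C * (y - x) ^ 2 := by
  have h1 : ∀ z ∈ uIcc x y, HasDerivWithinAt (fun z => ψ z - deriv ψ x * z)
      (deriv ψ z - deriv ψ x) (uIcc x y) z := fun z _ => by
    have := (h.hasDerivAt z).sub ((hasDerivAt_id z).const_mul (deriv ψ x))
    rw [mul_one] at this
    exact this.hasDerivWithinAt
  have hC0 : 0 ≤ C := (abs_nonneg _).trans (hC 0)
  have h2 : ∀ z ∈ uIcc x y, ‖deriv ψ z - deriv ψ x‖ ≤ C * |y - x| := fun z hz =>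
    (h.abs_deriv_sub_le hC z x).trans
      (mul_le_mul_of_nonneg_left (abs_sub_left_of_mem_uIcc hz) hC0)
  have h3 := (convex_uIcc x y).norm_image_sub_le_of_norm_hasDerivWithin_le h1 h2
    left_mem_uIcc right_mem_uIcc
  rw [Real.norm_eq_abs, Real.norm_eq_abs, mul_assoc, ← sq, sq_abs] at h3
  convert h3 using 2
  ring

/-- One explicit Euler step along the vector field `φ`. -/
def eulerStep (φ : ℝ → ℝ) (s : ℝ) (ψ : ℝ → ℝ) : ℝ → ℝ := fun x => ψ (x + s * φ x)

theorem hasDerivAt_eulerStep (hφ : BddC2 φ) (s : ℝ) {ψ : ℝ → ℝ} (hψ : Differentiable ℝ ψ)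
    (x : ℝ) : HasDerivAt (eulerStep φ s ψ)
      (deriv ψ (x + s * φ x) * (1 + s * deriv φ x)) x :=
  (hψ _).hasDerivAt.comp x ((hasDerivAt_id x).add ((hφ.hasDerivAt x).const_mul s))

/-- The supremum bound is preserved, and the derivative bounds grow by at most p³, where p = 1 + sD.
For the second derivative this is p² + p - 1 ≤ p³, that is (p - 1)²(p + 1) ≥ 0. Growth 1 + O(s) per
step is what a large l can compensate. -/
theorem eulerStep_bound (hφ : BddC2 φ) {D : ℝ}
    (hD : ∀ x, |φ x| ≤ D ∧ |deriv φ x| ≤ D ∧ |deriv (deriv φ) x| ≤ D) {s : ℝ} (hs : 0 < s)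
    {ψ : ℝ → ℝ} (hψ : BddC2 ψ) {M B : ℝ}
    (hM : ∀ x, |ψ x| ≤ M ∧ |deriv ψ x| ≤ B ∧ |deriv (deriv ψ) x| ≤ B) :
    BddC2 (eulerStep φ s ψ) ∧ ∀ x, |eulerStep φ s ψ x| ≤ M ∧
      |deriv (eulerStep φ s ψ) x| ≤ (1 + s * D) ^ 3 * B ∧
      |deriv (deriv (eulerStep φ s ψ)) x| ≤ (1 + s * D) ^ 3 * B := by
  have hD0 : 0 ≤ D := (abs_nonneg _).trans (hD 0).1
  have hB0 : 0 ≤ B := (abs_nonneg _).trans (hM 0).2.1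
  have hM0 : 0 ≤ M := (abs_nonneg _).trans (hM 0).1
  set p := 1 + s * D with hp
  have hp1 : 1 ≤ p := by rw [hp]; nlinarith
  have hder : deriv (eulerStep φ s ψ) =
      fun x => deriv ψ (x + s * φ x) * (1 + s * deriv φ x) :=
    funext fun x => (hasDerivAt_eulerStep hφ s hψ.differentiable x).deriv
  have hder2 : ∀ x, deriv (deriv (eulerStep φ s ψ)) x =
      deriv (deriv ψ) (x + s * φ x) * (1 + s * deriv φ x) * (1 + s * deriv φ x) +
        deriv ψ (x + s * φ x) * (s * deriv (deriv φ) x) := by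
    intro x
    rw [hder]
    have h1 := hasDerivAt_eulerStep hφ s (hψ.contDiff_deriv.differentiable (by norm_num)) x
    have h2 := ((hφ.contDiff_deriv.differentiable (by norm_num) x).hasDerivAt.const_mul s).const_add
      1
    exact (h1.mul h2).deriv
  have hb1 : ∀ x, |1 + s * deriv φ x| ≤ p := fun x => by
    refine (abs_add_le _ _).trans ?_
    rw [abs_one, abs_mul, abs_of_pos hs, hp]
    gcongr
    exact (hD x).2.1
  have key : ∀ x, |eulerStep φ s ψ x| ≤ M ∧
      |deriv (eulerStep φ s ψ) x| ≤ p ^ 3 * B ∧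
      |deriv (deriv (eulerStep φ s ψ)) x| ≤ p ^ 3 * B := by
    intro x
    refine ⟨(hM _).1, ?_, ?_⟩
    · rw [hder, abs_mul, mul_comm]
      have hpp : p ≤ p ^ 3 := le_self_pow₀ hp1 (by norm_num)
      exact mul_le_mul ((hb1 x).trans hpp) (hM _).2.1 (abs_nonneg _) (by positivity)
    · rw [hder2]
      have e1 : |deriv (deriv ψ) (x + s * φ x) * (1 + s * deriv φ x) * (1 + s * deriv φ x)| ≤
          B * p * p := by
        rw [abs_mul, abs_mul]
        have := hb1 x
        have := (hM (x + s * φ x)).2.2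
        gcongr
      have e2 : |deriv ψ (x + s * φ x) * (s * deriv (deriv φ) x)| ≤ B * (s * D) := by
        rw [abs_mul, abs_mul, abs_of_pos hs]
        have := (hD x).2.2
        have := (hM (x + s * φ x)).2.1
        gcongr
      refine (abs_add_le _ _).trans ((add_le_add e1 e2).trans ?_)
      have e3 : s * D = p - 1 := by rw [hp]; ring
      rw [e3]
      have e4 : 0 ≤ B * ((p - 1) ^ 2 * (p + 1)) := by positivity
      nlinarith
  refine ⟨⟨?_, max M (p ^ 3 * B), le_max_of_le_left hM0, fun x => ⟨?_, ?_, ?_⟩⟩, key⟩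
  · exact hψ.contDiff.comp (contDiff_id.add (contDiff_const.mul hφ.contDiff))
  · exact (key x).1.trans (le_max_left _ _)
  · exact (key x).2.1.trans (le_max_right _ _)
  · exact (key x).2.2.trans (le_max_right _ _)

theorem eulerStep_iterate_bound (hφ : BddC2 φ) {D : ℝ}
    (hD : ∀ x, |φ x| ≤ D ∧ |deriv φ x| ≤ D ∧ |deriv (deriv φ) x| ≤ D) {s : ℝ} (hs : 0 < s)
    {ψ : ℝ → ℝ} (hψ : BddC2 ψ) {M : ℝ}
    (hM : ∀ x, |ψ x| ≤ M ∧ |deriv ψ x| ≤ M ∧ |deriv (deriv ψ) x| ≤ M) (k : ℕ) :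
    BddC2 ((eulerStep φ s)^[k] ψ) ∧ ∀ x, |(eulerStep φ s)^[k] ψ x| ≤ M ∧
      |deriv ((eulerStep φ s)^[k] ψ) x| ≤ ((1 + s * D) ^ 3) ^ k * M ∧
      |deriv (deriv ((eulerStep φ s)^[k] ψ)) x| ≤ ((1 + s * D) ^ 3) ^ k * M := by
  induction k with
  | zero => simpa using ⟨hψ, hM⟩
  | succ k ih =>
    rw [Function.iterate_succ_apply', pow_succ', mul_assoc]
    exact eulerStep_bound hφ hD hs ih.1 ih.2

theorem isTest_sum {w dw : ℕ → (UnitIco → ℝ) → ℝ} (h : ∀ k, IsTest φ (w k) (dw k)) (K : ℕ) :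
    IsTest φ (fun k => ∑ i ∈ Finset.range K, w i k) fun k => ∑ i ∈ Finset.range K, dw i k := by
  induction K with
  | zero => simpa using (h 0).const_mul 0
  | succ K ih =>
    simp only [Finset.sum_range_succ]
    exact ih.add (h K)

theorem integrable_mul_comp {c : UnitIco → ℝ} (hc : Integrable c lebesgueIco) {ψ : ℝ → ℝ}
    (hψc : Continuous ψ) {C : ℝ} (hψ : ∀ x, |ψ x| ≤ C) {h : UnitIco → ℝ} (hh : Measurable h) :
    Integrable (fun t => c t * ψ (h t)) lebesgueIco :=
  hc.mul_bdd (c := C) (hψc.measurable.comp hh).aestronglyMeasurable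
    (Eventually.of_forall fun _ => hψ _)

/-- The error of one Euler step. -/
theorem euler_error (hφ : BddC2 φ) {D : ℝ} (hD : ∀ x, |φ x| ≤ D) {s : ℝ} (hs : 0 < s)
    {ψ : ℝ → ℝ} (hψ : BddC2 ψ) {B : ℝ}
    (hB : ∀ x, |deriv ψ x| ≤ B ∧ |deriv (deriv ψ) x| ≤ B)
    {U : ℝ → ℝ} (hU : BddC2 U) {M : ℝ}
    (hM : ∀ x, |deriv U x| ≤ M ∧ |deriv (deriv U) x| ≤ M)
    {c : UnitIco → ℝ} (hc : Integrable c lebesgueIco) {h : UnitIco → ℝ} (hh : Measurable h) :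
    |U (comp c (eulerStep φ s ψ) h) - U (comp c ψ h) -
        s * (deriv U (comp c ψ h) * comp c (fun x => deriv ψ x * φ x) h)| ≤
      s ^ 2 * (M * D ^ 2 * (B * (∫ t, |c t| ∂lebesgueIco) +
        (B * ∫ t, |c t| ∂lebesgueIco) ^ 2)) := by
  set I := ∫ t, |c t| ∂lebesgueIco with hI
  have hI0 : 0 ≤ I := integral_nonneg fun _ => abs_nonneg _
  have hM0 : 0 ≤ M := (abs_nonneg _).trans (hM 0).1
  have hB0 : 0 ≤ B := (abs_nonneg _).trans (hB 0).1
  have hD0 : 0 ≤ D := (abs_nonneg _).trans (hD 0)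
  obtain ⟨C, -, hC⟩ := hψ.bound
  obtain ⟨C', hC'⟩ := hψ.deriv_mul_bound hφ
  have hcont : Continuous (eulerStep φ s ψ) :=
    hψ.continuous.comp (continuous_id.add (continuous_const.mul hφ.continuous))
  have i1 := integrable_mul_comp hc hcont (C := C) (fun x => (hC _).1) hh
  have i2 := integrable_mul_comp hc hψ.continuous (fun x => (hC x).1) hh
  have i3 := integrable_mul_comp hc (hψ.continuous_deriv.mul hφ.continuous) hC' hh
  have i12 : Integrable (fun t => c t * eulerStep φ s ψ (h t) - c t * ψ (h t)) lebesgueIco :=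
    i1.sub i2
  have i3' : Integrable (fun t => s * (c t * (deriv ψ (h t) * φ (h t)))) lebesgueIco :=
    i3.const_mul s
  have e1 : comp c (eulerStep φ s ψ) h - comp c ψ h - s * comp c (fun x => deriv ψ x * φ x) h =
      comp c (fun x => eulerStep φ s ψ x - ψ x - s * (deriv ψ x * φ x)) h := by
    have : ∀ t, c t * (eulerStep φ s ψ (h t) - ψ (h t) - s * (deriv ψ (h t) * φ (h t))) =
      c t * eulerStep φ s ψ (h t) - c t * ψ (h t) - s * (c t * (deriv ψ (h t) * φ (h t))) :=
      fun t => by ring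
    simp only [comp, this]
    rw [integral_sub i12 i3', integral_sub i1 i2, integral_const_mul]
  have e2 : comp c (eulerStep φ s ψ) h - comp c ψ h =
      comp c (fun x => eulerStep φ s ψ x - ψ x) h := by
    simp only [comp, mul_sub]
    rw [integral_sub i1 i2]
  have b1 : |comp c (eulerStep φ s ψ) h - comp c ψ h - s * comp c (fun x => deriv ψ x * φ x) h| ≤
      B * (s * D) ^ 2 * I := by
    rw [e1]
    refine abs_comp_le hc (fun x => ?_) h
    have := hψ.abs_taylor_le (fun x => (hB x).2) x (x + s * φ x)
    rw [add_sub_cancel_left] at this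
    calc _ = |ψ (x + s * φ x) - ψ x - deriv ψ x * (s * φ x)| := by
          unfold eulerStep; congr 1; ring
      _ ≤ B * (s * φ x) ^ 2 := this
      _ ≤ _ := by
          rw [mul_pow, mul_pow, ← sq_abs (φ x)]
          have := hD x
          gcongr
  have b2 : |comp c (eulerStep φ s ψ) h - comp c ψ h| ≤ B * (s * D) * I := by
    rw [e2]
    refine abs_comp_le hc (fun x => ?_) h
    refine (hψ.abs_sub_le (fun x => (hB x).1) _ _).trans ?_
    rw [add_sub_cancel_left, abs_mul, abs_of_pos hs]
    have := hD x
    gcongr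
  have b3 := hU.abs_taylor_le (fun x => (hM x).2) (comp c ψ h) (comp c (eulerStep φ s ψ) h)
  have b4 : |deriv U (comp c ψ h) * (comp c (eulerStep φ s ψ) h - comp c ψ h -
      s * comp c (fun x => deriv ψ x * φ x) h)| ≤ M * (B * (s * D) ^ 2 * I) := by
    rw [abs_mul]
    exact mul_le_mul (hM _).1 b1 (abs_nonneg _) hM0
  have b5 : (comp c (eulerStep φ s ψ) h - comp c ψ h) ^ 2 ≤ (B * (s * D) * I) ^ 2 :=
    sq_le_sq' (abs_le.1 b2).1 (abs_le.1 b2).2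
  calc _ = |(U (comp c (eulerStep φ s ψ) h) - U (comp c ψ h) -
        deriv U (comp c ψ h) * (comp c (eulerStep φ s ψ) h - comp c ψ h)) +
        deriv U (comp c ψ h) * (comp c (eulerStep φ s ψ) h - comp c ψ h -
          s * comp c (fun x => deriv ψ x * φ x) h)| := by congr 1; ring
    _ ≤ M * (B * (s * D) * I) ^ 2 + M * (B * (s * D) ^ 2 * I) :=
        (abs_add_le _ _).trans (add_le_add (b3.trans (mul_le_mul_of_nonneg_left b5 hM0)) b4)
    _ = _ := by ring

/-- The equation l w - Dw = u is formally solved by the Laplace transform of u along the flow of φ.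
Here the flow is replaced by Euler iterates with step s, and the exponential weight by powers of r =
1/(1 + ls). The finite sum telescopes up to its tail and the one-step errors of order s². The
threshold L depends only on φ. -/
theorem exists_resolvent (hφ : BddC2 φ) : ∃ L : ℝ, ∀ l ≥ L, ∀ (U ψ : ℝ → ℝ), BddC2 U →
    BddC2 ψ → ∀ c : UnitIco → ℝ, Integrable c lebesgueIco → ∀ ε > 0, ∃ w dw, IsTest φ w dw ∧
      ∀ h, Measurable h → |l * w h - dw h - U (comp c ψ h)| ≤ ε := by
  obtain ⟨D, hD0, hD⟩ := hφ.bound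
  -- With this threshold, convexity of x ↦ x⁶ gives p⁶ ≤ 1 + ls/2. The one-step error grows like
  -- (p⁶)^k, since it contains the square of a derivative bound growing like (p³)^k.
  refine ⟨2 * (1 + D) ^ 6, fun l hl U ψ hU hψ c hc ε hε => ?_⟩
  obtain ⟨M, hM0, hM⟩ := hU.bound
  obtain ⟨B, hB0, hB⟩ := hψ.bound
  set I := ∫ t, |c t| ∂lebesgueIco with hI
  have hI0 : 0 ≤ I := integral_nonneg fun _ => abs_nonneg _
  have hl0 : 0 < l := lt_of_lt_of_le (by positivity) hl
  set C := M * D ^ 2 * (B * I + (B * I) ^ 2) with hC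
  have hC0 : 0 ≤ C := by positivity
  -- 2sC/l is the total of the Euler errors after summing the geometric series; s ≤ 1 is needed for
  -- the convexity estimate.
  obtain ⟨s, hs, hs1, hsC⟩ : ∃ s : ℝ, 0 < s ∧ s ≤ 1 ∧ 2 * s * C / l ≤ ε / 2 := by
    refine ⟨min 1 (ε * l / (4 * (C + 1))), by positivity, min_le_left _ _, ?_⟩
    have h1 : min 1 (ε * l / (4 * (C + 1))) ≤ ε * l / (4 * (C + 1)) := min_le_right _ _
    rw [le_div_iff₀ (by positivity)] at h1
    have h2 : 0 < min 1 (ε * l / (4 * (C + 1))) := by positivity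
    rw [div_le_iff₀ hl0]
    nlinarith
  set p := 1 + s * D with hp
  have hp1 : 1 ≤ p := by rw [hp]; nlinarith
  have hp6 : p ^ 6 ≤ 1 + l / 2 * s := by
    have h := (convexOn_pow (𝕜 := ℝ) 6).2 (mem_Ici.2 (zero_le_one (α := ℝ)))
      (mem_Ici.2 (show 0 ≤ 1 + D by positivity)) (show 0 ≤ 1 - s by linarith) hs.le (by ring)
    simp only [smul_eq_mul] at h
    have e : (1 - s) * 1 + s * (1 + D) = p := by rw [hp]; ring
    rw [e, one_pow] at h
    nlinarith
  set r := 1 / (1 + l * s) with hr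
  have hls : 0 < l * s := by positivity
  have hr0 : 0 < r := by positivity
  have hr1 : r < 1 := by rw [hr, div_lt_one (by positivity)]; linarith
  have hrl : l * s * r = 1 - r := by rw [hr]; field_simp; ring
  obtain ⟨K, hK⟩ := exists_pow_lt_of_lt_one (show 0 < ε / (2 * (M + 1)) by positivity) hr1
  let ψk : ℕ → ℝ → ℝ := fun k => (eulerStep φ s)^[k] ψ
  have hψk := fun k => eulerStep_iterate_bound hφ hD hs hψ hB k
  let F : ℕ → (UnitIco → ℝ) → ℝ := fun k h => U (comp c (ψk k) h)
  let dF : ℕ → (UnitIco → ℝ) → ℝ := fun k h =>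
    deriv U (comp c (ψk k) h) * comp c (fun x => deriv (ψk k) x * φ x) h
  have hF : ∀ k, IsTest φ (F k) (dF k) := fun k =>
    (isTest_comp φ hc (hψk k).1).comp_left (hU.contDiff.of_le (by norm_num))
  refine ⟨_, _, isTest_sum (fun k => (hF k).const_mul (s * r ^ (k + 1))) K, fun h hh => ?_⟩
  have herr : ∀ k, |F (k + 1) h - F k h - s * dF k h| ≤ s ^ 2 * (C * (p ^ 6) ^ k) := by
    intro k
    have h1 := euler_error hφ (fun x => (hD x).1) hs (hψk k).1 (fun x => ((hψk k).2 x).2) hU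
      (fun x => (hM x).2) hc hh
    have h2 : F (k + 1) h = U (comp c (eulerStep φ s (ψk k)) h) := by
      simp only [F, ψk, Function.iterate_succ_apply']
    rw [h2]
    refine h1.trans ?_
    rw [← hI, hC]
    have e1 : (1 : ℝ) ≤ (p ^ 3) ^ k := one_le_pow₀ (one_le_pow₀ hp1)
    have e2 : (p ^ 6) ^ k = (p ^ 3) ^ k * (p ^ 3) ^ k := by rw [← mul_pow]; ring
    have e3 : (p ^ 3) ^ k ≤ (p ^ 6) ^ k := by rw [e2]; exact le_mul_of_one_le_left (by positivity) e1
    rw [mul_assoc (M * D ^ 2)]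
    gcongr
    calc _ = B * I * (p ^ 3) ^ k + (B * I) ^ 2 * (p ^ 6) ^ k := by rw [e2]; ring
      _ ≤ B * I * (p ^ 6) ^ k + (B * I) ^ 2 * (p ^ 6) ^ k := by gcongr
      _ = _ := by ring
  -- The identity l s r = 1 - r turns the first term into (r^k - r^(k+1)) F_k, which makes the sum
  -- telescope.
  have htel : ∀ k, l * (s * r ^ (k + 1) * F k h) - s * r ^ (k + 1) * dF k h =
      -(r ^ (k + 1) * F (k + 1) h - r ^ k * F k h) +
        r ^ (k + 1) * (F (k + 1) h - F k h - s * dF k h) := by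
    intro k
    have : l * (s * r ^ (k + 1) * F k h) = (1 - r) * r ^ k * F k h := by
      rw [← hrl]; ring
    rw [this]; ring
  have hsum : l * (∑ i ∈ Finset.range K, s * r ^ (i + 1) * F i h) -
      ∑ i ∈ Finset.range K, s * r ^ (i + 1) * dF i h - U (comp c ψ h) =
      -(r ^ K * F K h) + ∑ k ∈ Finset.range K, r ^ (k + 1) * (F (k + 1) h - F k h - s * dF k h) := by
    rw [Finset.mul_sum, ← Finset.sum_sub_distrib, Finset.sum_congr rfl fun k _ => htel k,
      Finset.sum_add_distrib, Finset.sum_neg_distrib,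
      Finset.sum_range_sub (fun k => r ^ k * F k h)]
    have : F 0 h = U (comp c ψ h) := rfl
    rw [this]
    ring
  rw [hsum]
  have hrp : r * p ^ 6 ≤ 1 - l * s * r / 2 := by
    have h1 : r * p ^ 6 ≤ r * (1 + l / 2 * s) := by gcongr
    refine h1.trans (le_of_eq ?_)
    rw [hrl]
    linear_combination hrl / 2
  have hgeom : ∑ k ∈ Finset.range K, (r * p ^ 6) ^ k ≤ 2 / (l * s * r) := by
    have h0 : 0 ≤ r * p ^ 6 := by positivity
    have h1 := mul_neg_geom_sum (r * p ^ 6) K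
    have h2 : 0 ≤ ∑ k ∈ Finset.range K, (r * p ^ 6) ^ k :=
      Finset.sum_nonneg fun k _ => pow_nonneg h0 k
    have h3 := pow_nonneg h0 K
    rw [le_div_iff₀ (by positivity)]
    nlinarith
  have b1 : |-(r ^ K * F K h)| ≤ ε / 2 := by
    rw [abs_neg, abs_mul, abs_of_pos (pow_pos hr0 K)]
    have h1 : |F K h| ≤ M + 1 := (hM _).1.trans (by linarith)
    calc r ^ K * |F K h| ≤ ε / (2 * (M + 1)) * (M + 1) :=
          mul_le_mul hK.le h1 (abs_nonneg _) (by positivity)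
      _ = ε / 2 := by field_simp
  have b2 : |∑ k ∈ Finset.range K, r ^ (k + 1) * (F (k + 1) h - F k h - s * dF k h)| ≤ ε / 2 := by
    calc _ ≤ ∑ k ∈ Finset.range K, s ^ 2 * C * r * (r * p ^ 6) ^ k := by
          refine (Finset.abs_sum_le_sum_abs _ _).trans (Finset.sum_le_sum fun k _ => ?_)
          rw [abs_mul, abs_of_pos (pow_pos hr0 _)]
          calc _ ≤ r ^ (k + 1) * (s ^ 2 * (C * (p ^ 6) ^ k)) :=
                mul_le_mul_of_nonneg_left (herr k) (by positivity)
            _ = _ := by rw [mul_pow]; ring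
      _ ≤ s ^ 2 * C * r * (2 / (l * s * r)) := by
          rw [← Finset.mul_sum]
          exact mul_le_mul_of_nonneg_left hgeom (by positivity)
      _ = 2 * s * C / l := by field_simp
      _ ≤ ε / 2 := hsC
  exact (abs_add_le _ _).trans (by linarith)

end Euler

/-! ### Weak directional derivatives are strong -/

section WeakStrong

variable {β : ℝ} {Q : Measure QuantileFn} {hQ : IsDirichletLaw β Q} {φ : ℝ → ℝ}

theorem bddC2_cos : BddC2 Real.cos :=
  ⟨Real.contDiff_cos, 1, zero_le_one, fun x => by
    simp [Real.abs_cos_le_one, Real.abs_sin_le_one]⟩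

theorem bddC2_sin : BddC2 Real.sin :=
  ⟨Real.contDiff_sin, 1, zero_le_one, fun x => by
    simp [Real.abs_cos_le_one, Real.abs_sin_le_one]⟩

theorem VecField.neg (hφ : VecField φ) : VecField fun x => -φ x :=
  { contDiff := hφ.contDiff.neg
    bound := by
      obtain ⟨C, hC0, hC⟩ := hφ.bound
      refine ⟨C, hC0, fun x => ?_⟩
      have h1 : deriv (fun x => -φ x) = fun x => -deriv φ x := funext fun x => deriv.fun_neg
      have h2 : deriv (fun x => -deriv φ x) x = -deriv (deriv φ) x := deriv.fun_neg
      rw [h1, h2, abs_neg, abs_neg, abs_neg]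
      exact hC x
    zero := by simp [hφ.zero]
    one := by simp [hφ.one] }

/-- The pairs `(w, dw)` of test functions and their derivatives in the direction `φ`. -/
def testGraph (Q : Measure QuantileFn) (φ : ℝ → ℝ) : Submodule ℝ (Lp ℝ 2 Q × Lp ℝ 2 Q) where
  carrier := {p | ∃ w dw, IsTest φ w dw ∧ (p.1 =ᵐ[Q] fun g => w g.1) ∧ p.2 =ᵐ[Q] fun g => dw g.1}
  zero_mem' := by
    have h : IsTest φ (fun _ => 0) fun _ => 0 := by
      simpa using (isTest_comp φ (integrable_zero _ _ _) truncId_bddC2).const_mul 0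
    exact ⟨_, _, h, Lp.coeFn_zero _ _ _, Lp.coeFn_zero _ _ _⟩
  add_mem' := by
    rintro p q ⟨w, dw, h, h1, h2⟩ ⟨w', dw', h', h1', h2'⟩
    refine ⟨_, _, h.add h', ?_, ?_⟩
    · filter_upwards [Lp.coeFn_add p.1 q.1, h1, h1'] with g e1 e2 e3
      rw [Prod.fst_add, e1, Pi.add_apply, e2, e3]
    · filter_upwards [Lp.coeFn_add p.2 q.2, h2, h2'] with g e1 e2 e3
      rw [Prod.snd_add, e1, Pi.add_apply, e2, e3]
  smul_mem' := by
    rintro r p ⟨w, dw, h, h1, h2⟩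
    refine ⟨_, _, h.const_mul r, ?_, ?_⟩
    · filter_upwards [Lp.coeFn_smul r p.1, h1] with g e1 e2
      rw [Prod.smul_fst, e1, Pi.smul_apply, e2, smul_eq_mul]
    · filter_upwards [Lp.coeFn_smul r p.2, h2] with g e1 e2
      rw [Prod.smul_snd, e1, Pi.smul_apply, e2, smul_eq_mul]

/-- The range of l - D comes arbitrarily close to cosines and sines of path integrals, and these are
total. -/
theorem exists_resolvent_Lp [IsProbabilityMeasure Q] (hφ : VecField φ) : ∃ L : ℝ, ∀ l ≥ L,
    ∀ f : Lp ℝ 2 Q, ∀ ε > 0, ∃ p ∈ testGraph Q φ, ‖l • p.1 - p.2 - f‖ < ε := by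
  obtain ⟨L, hL⟩ := exists_resolvent hφ.toBddC2
  refine ⟨L, fun l hl => ?_⟩
  have key : ∀ c : UnitIco → ℝ, Measurable c → (∃ C, ∀ t, |c t| ≤ C) → ∀ U, BddC2 U →
      ∀ f : Lp ℝ 2 Q, (f =ᵐ[Q] fun g => U (∫ t, c t * g.1 t ∂lebesgueIco)) →
      ∀ ε > 0, ∃ p ∈ testGraph Q φ, ‖l • p.1 - p.2 - f‖ ≤ ε := by
    rintro c hc ⟨C, hC⟩ U hU f hf ε hε
    obtain ⟨w, dw, hw, hb⟩ := hL l hl U truncId hU truncId_bddC2 c (integrable_of_bdd hc hC) ε hε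
    have hm := hw.memLp hφ (Q := Q)
    refine ⟨(hm.1.toLp _, hm.2.toLp _), ⟨w, dw, hw, hm.1.coeFn_toLp, hm.2.coeFn_toLp⟩, ?_⟩
    have h1 : ∀ᵐ g ∂Q, ‖(l • hm.1.toLp _ - hm.2.toLp _ - f) g‖ ≤ ε := by
      filter_upwards [Lp.coeFn_sub (l • hm.1.toLp _ - hm.2.toLp _) f,
        Lp.coeFn_sub (l • hm.1.toLp _) (hm.2.toLp _), Lp.coeFn_smul l (hm.1.toLp _),
        hm.1.coeFn_toLp, hm.2.coeFn_toLp, hf] with g e1 e2 e3 e4 e5 e6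
      rw [e1, Pi.sub_apply, e2, Pi.sub_apply, e3, Pi.smul_apply, e4, e5, e6, smul_eq_mul,
        ← comp_truncId]
      exact hb _ g.measurable
    simpa [measureUnivNNReal] using Lp.norm_le_of_ae_bound hε.le h1
  let R : Submodule ℝ (Lp ℝ 2 Q) := (testGraph Q φ).map
    (l • LinearMap.fst ℝ (Lp ℝ 2 Q) (Lp ℝ 2 Q) - LinearMap.snd ℝ (Lp ℝ 2 Q) (Lp ℝ 2 Q))
  have hR : Dense (R : Set (Lp ℝ 2 Q)) := by
    refine dense_of_orthogonal R fun y hy => ?_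
    have h0 : ∀ c : UnitIco → ℝ, Measurable c → (∃ C, ∀ t, |c t| ≤ C) → ∀ U, BddC2 U →
        ∫ g, U (∫ t, c t * g.1 t ∂lebesgueIco) * y g ∂Q = 0 := by
      rintro c hc hC U hU
      obtain ⟨C, hC'⟩ := hC
      have hm := (((isTest_comp φ (integrable_of_bdd hc hC') truncId_bddC2).comp_left
        (hU.contDiff.of_le (by norm_num))).memLp hφ (Q := Q)).1
      have hf : hm.toLp _ =ᵐ[Q] fun g => U (∫ t, c t * g.1 t ∂lebesgueIco) := by
        filter_upwards [hm.coeFn_toLp] with g hg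
        rw [hg, comp_truncId]
      rw [← L2_inner_congr hf EventuallyEq.rfl]
      set f := hm.toLp _
      have hcl : f ∈ closure (R : Set (Lp ℝ 2 Q)) := by
        rw [Metric.mem_closure_iff]
        intro ε hε
        obtain ⟨p, hp, hpf⟩ := key c hc ⟨C, hC'⟩ U hU f hf (ε / 2) (by positivity)
        refine ⟨l • p.1 - p.2, ⟨p, hp, rfl⟩, ?_⟩
        rw [dist_comm, dist_eq_norm]
        linarith
      have hcl2 : closure (R : Set (Lp ℝ 2 Q)) ⊆ {x | inner ℝ x y = (0 : ℝ)} :=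
        closure_minimal (fun x hx => hy x hx)
          (isClosed_eq (continuous_id.inner continuous_const) continuous_const)
      exact hcl2 hcl
    exact (Lp.eq_zero_iff_ae_eq_zero).2 (ae_eq_zero_of_trig_path
      ((Lp.memLp y).integrable (by norm_num)) (fun c hc hC => h0 c hc hC _ bddC2_cos)
      fun c hc hC => h0 c hc hC _ bddC2_sin)
  intro f ε hε
  obtain ⟨_, ⟨p, hp, rfl⟩, hpf⟩ := Metric.mem_closure_iff.1 (hR f) ε hε
  refine ⟨p, hp, ?_⟩
  rw [dist_comm, dist_eq_norm] at hpf
  exact hpf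

/-- Weak derivatives along φ are strong: `mem_closure_of_weak` applies with multiplication by the
bounded divergence as perturbation. The second range condition is the first one for -φ. -/
theorem mem_closure_testGraph (hβ : 0 < β) (hφ : VecField φ) {V : Lp ℝ 2 Q}
    (hV : IsDivergence hQ φ V) {u e : Lp ℝ 2 Q}
    (hue : ∀ w dw, IsTest φ w dw → ∀ δ y : Lp ℝ 2 Q,
      (δ =ᵐ[Q] fun g => dw g.1 + w g.1 * V g) → (y =ᵐ[Q] fun g => w g.1) →
      inner ℝ u δ = -inner ℝ e y) :
    (u, e) ∈ closure (testGraph Q φ : Set (Lp ℝ 2 Q × Lp ℝ 2 Q)) := by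
  have := hQ.isProbabilityMeasure
  obtain ⟨C, hC⟩ := hV.bound
  have hC0 : 0 ≤ C := by
    obtain ⟨g, hg⟩ := hC.exists
    exact (abs_nonneg _).trans hg
  have hex : ∀ x : Lp ℝ 2 Q, ∃ y : Lp ℝ 2 Q, y =ᵐ[Q] fun g => V g * x g := fun x =>
    ⟨(memLp_bdd_mul (Lp.memLp x) (Lp.aestronglyMeasurable V) hC).toLp _, MemLp.coeFn_toLp _⟩
  choose T hT using hex
  obtain ⟨L₁, hL₁⟩ := exists_resolvent_Lp (Q := Q) hφ
  obtain ⟨L₂, hL₂⟩ := exists_resolvent_Lp (Q := Q) hφ.neg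
  refine mem_closure_of_weak (testGraph Q φ) T hC0
    (l := max (2 * C + 1) (max L₁ L₂)) (lt_of_lt_of_le (lt_add_one _) (le_max_left _ _))
    (fun x => L2_norm_le_of_ae_le ?_) ?_
    (hL₁ _ ((le_max_left _ _).trans (le_max_right _ _))) (fun f ε hε => ?_) u e ?_
  · filter_upwards [hT x, hC] with g h1 h2
    rw [h1, abs_mul]
    gcongr
  · rintro p ⟨w, dw, h, h1, h2⟩ q ⟨w', dw', h', h1', h2'⟩
    have h0 := integral_div_eq_zero' hβ (h.mul h') hφ hV
    have e3 : T q.1 =ᵐ[Q] fun g => V g * w' g.1 := by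
      filter_upwards [hT q.1, h1'] with g a1 a2
      rw [a1, a2]
    have i1 := L2_integrable_mul p.2 q.1
    have i2 := L2_integrable_mul p.1 q.2
    have i3 := L2_integrable_mul p.1 (T q.1)
    have i4 : Integrable (fun g => p.2 g * q.1 g + p.1 g * q.2 g) Q := i1.add i2
    rw [L2_inner_eq, L2_inner_eq, L2_inner_eq, ← integral_add i1 i2, ← integral_add i4 i3]
    refine (integral_congr_ae ?_).trans h0
    filter_upwards [h1, h2, h1', h2', e3] with g a1 a2 a3 a4 a5
    rw [a1, a2, a3, a4, a5]
    ring
  · obtain ⟨p, ⟨w, dw, h, h1, h2⟩, hp⟩ :=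
      hL₂ _ ((le_max_right L₁ L₂).trans (le_max_right (2 * C + 1) _)) f ε hε
    refine ⟨(p.1, -p.2), ⟨w, _, by simpa only [neg_neg] using h.neg_field, h1, ?_⟩, ?_⟩
    · filter_upwards [h2, Lp.coeFn_neg p.2] with g a1 a2
      rw [a2, Pi.neg_apply, a1]
    · rwa [← sub_eq_add_neg]
  · rintro p ⟨w, dw, h, h1, h2⟩
    refine hue w dw h _ _ ?_ h1
    filter_upwards [Lp.coeFn_add p.2 (T p.1), h1, h2, hT p.1] with g a1 a2 a3 a4
    rw [a1, Pi.add_apply, a3, a4, a2]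
    ring

end WeakStrong

/-! ### Weak gradients on the path space -/

section WeakGradient

variable {β : ℝ} {Q : Measure QuantileFn} {hQ : IsDirichletLaw β Q} {φ : ℝ → ℝ}
  {w dw : (UnitIco → ℝ) → ℝ}

/-- The pairs consisting of the divergence of a vector field `w(g) φ(g t)` and this field. -/
def divGraph (hQ : IsDirichletLaw β Q) : Set (Lp ℝ 2 Q × Lp ℝ 2 (Q.prod lebesgueIco)) :=
  {p | ∃ φ w dw V, VecField φ ∧ IsTest φ w dw ∧ IsDivergence hQ φ V ∧
    (p.1 =ᵐ[Q] fun g => dw g.1 + w g.1 * V g) ∧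
    p.2 =ᵐ[Q.prod lebesgueIco] fun z => w z.1.1 * φ (z.1.1 z.2)}

/-- The pairs of a function and a weak gradient. -/
def weakGraph (hQ : IsDirichletLaw β Q) :
    Submodule ℝ (Lp ℝ 2 Q × Lp ℝ 2 (Q.prod lebesgueIco)) where
  carrier := {p | ∀ q ∈ divGraph hQ, inner ℝ p.1 q.1 = -inner ℝ p.2 q.2}
  zero_mem' := fun q _ => by simp
  add_mem' := fun {a b} ha hb q hq => by
    rw [Prod.fst_add, Prod.snd_add, inner_add_left, inner_add_left, ha q hq, hb q hq]; ring
  smul_mem' := fun r a ha q hq => by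
    rw [Prod.smul_fst, Prod.smul_snd, inner_smul_left, inner_smul_left, ha q hq]; ring

theorem isClosed_weakGraph :
    IsClosed (weakGraph hQ : Set (Lp ℝ 2 Q × Lp ℝ 2 (Q.prod lebesgueIco))) := by
  have : (weakGraph hQ : Set (Lp ℝ 2 Q × Lp ℝ 2 (Q.prod lebesgueIco))) =
      ⋂ q ∈ divGraph hQ, {p | inner ℝ p.1 q.1 = -inner ℝ p.2 q.2} := by
    ext p
    simp only [mem_iInter]
    rfl
  rw [this]
  exact isClosed_biInter fun q _ => isClosed_eq (continuous_fst.inner continuous_const)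
    (continuous_snd.inner continuous_const).neg

theorem measurable_field (hφ : Continuous φ) :
    Measurable fun z : QuantileFn × UnitIco => φ (z.1.1 z.2) :=
  hφ.measurable.comp measurable_eval

theorem memLp_field [IsFiniteMeasure Q] (hφ : VecField φ) (h : IsTest φ w dw) {ψ : ℝ → ℝ}
    (hψ : BddC2 ψ) :
    MemLp (fun z : QuantileFn × UnitIco => w z.1.1 * ψ (z.1.1 z.2)) 2 (Q.prod lebesgueIco) := by
  obtain ⟨C, hC⟩ := h.bounded hφ.toBddC2
  obtain ⟨D, -, hD⟩ := hψ.bound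
  refine MemLp.of_bound (((h.measurable hφ).1.comp measurable_fst).mul
    (measurable_field hψ.continuous)).aestronglyMeasurable (C * D) (Eventually.of_forall fun z => ?_)
  rw [norm_mul]
  exact mul_le_mul (hC _).1 (hD _).1 (abs_nonneg _) ((abs_nonneg _).trans (hC z.1.1).1)

/-- The component of `ξ` in the direction of a vector field. -/
theorem exists_component [IsFiniteMeasure Q] (hφ : BddC2 φ) (ξ : Lp ℝ 2 (Q.prod lebesgueIco)) :
    ∃ e : Lp ℝ 2 Q, e =ᵐ[Q] fun g => ∫ t, ξ (g, t) * φ (g.1 t) ∂lebesgueIco := by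
  obtain ⟨D, hD0, hD⟩ := hφ.bound
  have hm : MemLp (fun z : QuantileFn × UnitIco => φ (z.1.1 z.2) * ξ z) 2 (Q.prod lebesgueIco) :=
    memLp_bdd_mul (Lp.memLp ξ) (measurable_field hφ.continuous).aestronglyMeasurable
      (Eventually.of_forall fun z => (hD _).1)
  have hm' : MemLp (fun z : QuantileFn × UnitIco => ξ z * φ (z.1.1 z.2)) 2
      (Q.prod lebesgueIco) := by simpa only [mul_comm] using hm
  have hmeas : AEStronglyMeasurable (fun g : QuantileFn =>
      ∫ t, ξ (g, t) * φ (g.1 t) ∂lebesgueIco) Q := hm'.1.integral_prod_right'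
  have hsq := hm'.integrable_sq
  have hmem : MemLp (fun g : QuantileFn => ∫ t, ξ (g, t) * φ (g.1 t) ∂lebesgueIco) 2 Q := by
    rw [memLp_two_iff_integrable_sq hmeas]
    refine hsq.integral_prod_left.mono' (hmeas.pow 2) ?_
    filter_upwards [hsq.prod_right_ae, hm'.1.prodMk_left] with g h1 h2
    rw [Real.norm_eq_abs, abs_of_nonneg (sq_nonneg _)]
    exact sq_integral_le ((memLp_two_iff_integrable_sq h2).2 h1)
  exact ⟨hmem.toLp _, hmem.coeFn_toLp⟩

/-- By Fubini a field w φ sees ξ only through its scalar component along φ. This reduces weak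
gradients to weak directional derivatives. -/
theorem inner_field [IsFiniteMeasure Q] {ξ ζ : Lp ℝ 2 (Q.prod lebesgueIco)} {e : Lp ℝ 2 Q}
    (hζ : ζ =ᵐ[Q.prod lebesgueIco] fun z => w z.1.1 * φ (z.1.1 z.2))
    (he : e =ᵐ[Q] fun g => ∫ t, ξ (g, t) * φ (g.1 t) ∂lebesgueIco) :
    inner ℝ ξ ζ = ∫ g, e g * w g.1 ∂Q := by
  have hi : Integrable (fun z => ξ z * (w z.1.1 * φ (z.1.1 z.2))) (Q.prod lebesgueIco) :=
    (L2_integrable_mul ξ ζ).congr (hζ.mono fun z hz => by simp only; rw [hz])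
  rw [L2_inner_congr EventuallyEq.rfl hζ, integral_prod _ hi]
  refine integral_congr_ae (he.mono fun g hg => ?_)
  beta_reduce
  rw [hg, ← integral_mul_const]
  refine integral_congr_ae (Eventually.of_forall fun t => ?_)
  simp only
  ring

/-- Integration by parts for the product of the function with w shows that the classical gradient is
a weak one. The choice ψ = `truncId` covers cylinder functions, and c = 1 the functions of 𝒵₀. -/
theorem mem_weakGraph_of_repr (hβ : 0 < β) {ι : Type} [Fintype ι] [DecidableEq ι]
    {U : (ι → ℝ) → ℝ}
    {c : ι → UnitIco → ℝ} {ψ : ι → ℝ → ℝ} (hU : ContDiff ℝ 1 U)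
    (hc : ∀ j, Integrable (c j) lebesgueIco) (hψ : ∀ j, BddC2 (ψ j)) {u : Lp ℝ 2 Q}
    {ξ : Lp ℝ 2 (Q.prod lebesgueIco)} (hu : u =ᵐ[Q] fun g => U fun j => comp (c j) (ψ j) g.1)
    (hξ : ξ =ᵐ[Q.prod lebesgueIco] fun z => ∑ i,
      fderiv ℝ U (fun j => comp (c j) (ψ j) z.1.1) (Pi.single i 1) *
        (c i z.2 * deriv (ψ i) (z.1.1 z.2))) : (u, ξ) ∈ weakGraph hQ := by
  have := hQ.isProbabilityMeasure
  rintro ⟨δ, ζ⟩ ⟨φ, w, dw, V, hφ, hw, hV, hδ, hζ⟩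
  simp only at hδ hζ ⊢
  set v : (UnitIco → ℝ) → ℝ := fun h => U fun j => comp (c j) (ψ j) h
  set dv : (UnitIco → ℝ) → ℝ := fun h => fderiv ℝ U (fun j => comp (c j) (ψ j) h)
      fun j => comp (c j) (fun x => deriv (ψ j) x * φ x) h
  have hv : IsTest φ v dv := ⟨ι, inferInstance, U, c, ψ, hU, hc, hψ, fun _ => rfl, fun _ => rfl⟩
  have he : (hv.memLp hφ (Q := Q)).2.toLp _ =ᵐ[Q]
      fun g => ∫ t, ξ (g, t) * φ (g.1 t) ∂lebesgueIco := by
    filter_upwards [(hv.memLp hφ (Q := Q)).2.coeFn_toLp, Measure.ae_ae_of_ae_prod hξ]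
      with g h1 h2
    rw [h1]
    have hi : ∀ i, Integrable (fun t => c i t * (deriv (ψ i) (g.1 t) * φ (g.1 t)))
        lebesgueIco := fun i => by
      obtain ⟨C, hC⟩ := (hψ i).deriv_mul_bound hφ.toBddC2
      exact integrable_mul_comp (ψ := fun x => deriv (ψ i) x * φ x) (hc i)
        ((hψ i).continuous_deriv.mul hφ.continuous) hC g.measurable
    have h3 : ∫ t, ξ (g, t) * φ (g.1 t) ∂lebesgueIco = ∫ t, ∑ i,
        fderiv ℝ U (fun j => comp (c j) (ψ j) g.1) (Pi.single i 1) *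
          (c i t * (deriv (ψ i) (g.1 t) * φ (g.1 t))) ∂lebesgueIco := by
      refine integral_congr_ae (h2.mono fun t ht => ?_)
      beta_reduce
      rw [ht, Finset.sum_mul]
      exact Finset.sum_congr rfl fun i _ => by ring
    rw [h3, integral_finsetSum _ fun i _ => (hi i).const_mul _]
    simp only [dv]
    rw [clm_apply_eq_sum]
    refine Finset.sum_congr rfl fun i _ => ?_
    rw [integral_const_mul, mul_comm]
    rfl
  rw [inner_field hζ he, L2_inner_congr hu hδ]
  have h0 := integral_div_eq_zero' hβ (hv.mul hw) hφ hV
  have i1 : Integrable (fun g : QuantileFn => v g.1 * (dw g.1 + w g.1 * V g)) Q := by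
    refine (L2_integrable_mul u δ).congr ?_
    filter_upwards [hu, hδ] with g h1 h2
    rw [h1, h2]
  have i2 : Integrable (fun g : QuantileFn => dv g.1 * w g.1) Q :=
    (hv.memLp hφ (Q := Q)).2.integrable_mul (hw.memLp hφ).1
  have h1 : ∫ g, (hv.memLp hφ (Q := Q)).2.toLp _ g * w g.1 ∂Q = ∫ g, dv g.1 * w g.1 ∂Q :=
    integral_congr_ae ((hv.memLp hφ (Q := Q)).2.coeFn_toLp.mono fun g hg => by
      beta_reduce; rw [hg])
  rw [h1, eq_neg_iff_add_eq_zero, ← integral_add i1 i2]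
  refine (integral_congr_ae (Eventually.of_forall fun g => ?_)).trans h0
  ring

theorem integrable_Lp (f : Lp ℝ 2 lebesgueIco) : Integrable f lebesgueIco :=
  (Lp.memLp f).integrable (by norm_num)

theorem comp_truncId_eq_pairing (f : Lp ℝ 2 lebesgueIco) (g : QuantileFn) :
    comp f truncId g.1 = pairing f g := comp_truncId f g

theorem cylinderGradient_subset (hβ : 0 < β) :
    cylinderGradient Q ⊆ (weakGraph hQ : Set (Lp ℝ 2 Q × Lp ℝ 2 (Q.prod lebesgueIco))) := by
  rintro ⟨u, ξ⟩ ⟨m, U, f, hU, -, hu, hξ⟩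
  refine mem_weakGraph_of_repr hβ hU (fun j => integrable_Lp (f j)) (fun _ => truncId_bddC2)
    (by simpa only [comp_truncId_eq_pairing] using hu) ?_
  simpa only [comp_truncId_eq_pairing, deriv_truncId (Subtype.prop (_ : QuantileFn) |>.2.1 _),
    mul_one] using hξ

theorem measurable_pairing (f : Lp ℝ 2 lebesgueIco) : Measurable (pairing f) := by
  have h := ((isTest_comp (fun _ => 0) (integrable_Lp f) truncId_bddC2).measurable
    vecField_zero).1
  simpa only [comp_truncId_eq_pairing] using h

theorem exists_cylinder [IsProbabilityMeasure Q] {m : ℕ} {U : (Fin m → ℝ) → ℝ}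
    (f : Fin m → Lp ℝ 2 lebesgueIco) (hU : ContDiff ℝ 1 U) (hUc : HasCompactSupport U) :
    ∃ p ∈ cylinderGradient Q, p.1 =ᵐ[Q] fun g => U fun i => pairing (f i) g := by
  have hm : Measurable fun g => fun i => pairing (f i) g :=
    measurable_pi_lambda _ fun i => measurable_pairing (f i)
  obtain ⟨C, hC⟩ := hUc.exists_bound_of_continuous hU.continuous
  have h1 : MemLp (fun g => U fun i => pairing (f i) g) 2 Q :=
    MemLp.of_bound (hU.continuous.measurable.comp hm).aestronglyMeasurable C
      (Eventually.of_forall fun g => hC _)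
  have h2 : MemLp (fun z : QuantileFn × UnitIco =>
      ∑ i, fderiv ℝ U (fun j => pairing (f j) z.1) (Pi.single i 1) * f i z.2) 2
      (Q.prod lebesgueIco) := by
    refine memLp_finsetSum _ fun i _ => ?_
    have hcont : Continuous fun x => fderiv ℝ U x (Pi.single i 1) :=
      (hU.continuous_fderiv (by norm_num)).clm_apply continuous_const
    obtain ⟨D, hD⟩ := (hUc.fderiv_apply ℝ (Pi.single i 1)).exists_bound_of_continuous hcont
    exact memLp_bdd_mul (C := D) ((Lp.memLp (f i)).comp_measurePreserving
      measurePreserving_snd) ((hcont.measurable.comp hm).comp measurable_fst).aestronglyMeasurable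
      (Eventually.of_forall fun z => hD _)
  exact ⟨(h1.toLp _, h2.toLp _), ⟨m, U, f, hU, hUc, h1.coeFn_toLp, h2.coeFn_toLp⟩, h1.coeFn_toLp⟩

/-- Cylinder functions are dense: cutting T off outside the range of the path integral makes it
compactly supported and changes no value. -/
theorem eq_zero_of_orthogonal_cylinder [IsProbabilityMeasure Q] {y : Lp ℝ 2 Q}
    (hy : ∀ p ∈ cylinderGradient Q, inner ℝ p.1 y = (0 : ℝ)) : y = 0 := by
  have key : ∀ c : UnitIco → ℝ, Measurable c → (∃ C, ∀ t, |c t| ≤ C) → ∀ T : ℝ → ℝ,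
      ContDiff ℝ 1 T → ∫ g, T (∫ t, c t * g.1 t ∂lebesgueIco) * y g ∂Q = 0 := by
    rintro c hc ⟨C, hC⟩ T hT
    have hcm : MemLp c 2 lebesgueIco :=
      MemLp.of_bound hc.aestronglyMeasurable C (Eventually.of_forall hC)
    have hpair : ∀ g, pairing (hcm.toLp c) g = ∫ t, c t * g.1 t ∂lebesgueIco := fun g =>
      integral_congr_ae (hcm.coeFn_toLp.mono fun t ht => by beta_reduce; rw [ht])
    obtain ⟨χ, hχ, hχc, hχ1⟩ := exists_cutoff (1 * ∫ t, |c t| ∂lebesgueIco)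
    have hproj : ContDiff ℝ 1 fun y : Fin 1 → ℝ => y 0 := contDiff_apply ℝ ℝ 0
    have hTχ : ContDiff ℝ 1 fun x => T x * χ x := hT.mul (hχ.of_le (mod_cast le_top))
    have hcs : HasCompactSupport fun y : Fin 1 → ℝ => T (y 0) * χ (y 0) :=
      (hχc.mul_left (f := T)).comp_homeomorph (Homeomorph.funUnique (Fin 1) ℝ)
    obtain ⟨p, hp, hpe⟩ := exists_cylinder (Q := Q) (fun _ : Fin 1 => hcm.toLp c)
      (hTχ.comp hproj) hcs
    have h1 := hy p hp
    rw [L2_inner_congr hpe EventuallyEq.rfl] at h1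
    refine (integral_congr_ae (Eventually.of_forall fun g => ?_)).trans h1
    have hle : |∫ t, c t * g.1 t ∂lebesgueIco| ≤ 1 * ∫ t, |c t| ∂lebesgueIco :=
      -- The clamp is the identity on the values of g and is bounded by 1 on all of ℝ, as
      -- `abs_comp_le` requires.
      abs_comp_le (ψ := fun x => max 0 (min 1 x)) (integrable_of_bdd hc hC) (C := 1) (fun x => by
        rw [abs_of_nonneg (le_max_left _ _)]
        exact max_le zero_le_one (min_le_left _ _)) g.1 |>.trans_eq' (by
          unfold comp
          congr 2
          ext t
          beta_reduce
          rw [min_eq_right (g.2.2.1 t).2, max_eq_right (g.2.2.1 t).1])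
    simp only [Function.comp_apply, hpair]
    rw [hχ1 _ hle, mul_one]
  exact (Lp.eq_zero_iff_ae_eq_zero).2 (ae_eq_zero_of_trig_path
    ((Lp.memLp y).integrable (by norm_num))
    (fun c hc hC => key c hc hC _ Real.contDiff_cos)
    fun c hc hC => key c hc hC _ Real.contDiff_sin)

end WeakGradient

/-! ### The Markov property of the weak gradient -/

section Markov

variable {β : ℝ} {Q : Measure QuantileFn} {hQ : IsDirichletLaw β Q}

/-- Fix one field φ. The component e of ξ along φ is the weak derivative of u along φ, so (u, e) is
a limit of test pairs, for which the chain rule is classical. In the limit T(u_k) converges since T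
is Lipschitz, and T'(u_k) e_k converges along an almost everywhere convergent subsequence. -/
theorem weakGraph_chain (hβ : 0 < β) {T : ℝ → ℝ} (hT : ContDiff ℝ 1 T)
    (hT0 : T 0 = 0) (hT1 : ∀ x, |deriv T x| ≤ 1) {u v : Lp ℝ 2 Q}
    {ξ η : Lp ℝ 2 (Q.prod lebesgueIco)} (h : (u, ξ) ∈ weakGraph hQ)
    (hv : v =ᵐ[Q] fun g => T (u g))
    (hη : η =ᵐ[Q.prod lebesgueIco] fun z => deriv T (u z.1) * ξ z) : (v, η) ∈ weakGraph hQ := by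
  have := hQ.isProbabilityMeasure
  rintro ⟨δ, ζ⟩ ⟨φ, w, dw, V, hφ, hw, hV, hδ, hζ⟩
  simp only at hδ hζ ⊢
  have hcT : Continuous (deriv T) := hT.continuous_deriv le_rfl
  have hlip : ∀ x y, |T x - T y| ≤ 1 * |x - y| := fun x y =>
    Convex.norm_image_sub_le_of_norm_deriv_le (s := univ)
      (fun x _ => hT.differentiable (by norm_num) x) (fun x _ => hT1 x) convex_univ
      (mem_univ y) (mem_univ x)
  obtain ⟨e, he⟩ := exists_component hφ.toBddC2 ξ
  have hcl : (u, e) ∈ closure (testGraph Q φ : Set (Lp ℝ 2 Q × Lp ℝ 2 Q)) := by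
    refine mem_closure_testGraph hβ hφ hV fun w' dw' h' δ' y hδ' hy => ?_
    have hm := memLp_field (Q := Q) hφ h' hφ.toBddC2
    have h1 := h (δ', hm.toLp _) ⟨φ, w', dw', V, hφ, h', hV, hδ', hm.coeFn_toLp⟩
    rw [show inner ℝ u δ' = _ from h1, L2_inner_congr EventuallyEq.rfl hy]
    exact congrArg Neg.neg (inner_field hm.coeFn_toLp he)
  obtain ⟨p, hp, hlim⟩ := mem_closure_iff_seq_limit.1 hcl
  have hlim1 : Tendsto (fun n => (p n).1) atTop (𝓝 u) := (continuous_fst.tendsto _).comp hlim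
  have hlim2 : Tendsto (fun n => (p n).2) atTop (𝓝 e) := (continuous_snd.tendsto _).comp hlim
  obtain ⟨s, hs, hae⟩ := L2_exists_subseq hlim1
  have hTu : ∀ x : Lp ℝ 2 Q, ∃ y : Lp ℝ 2 Q, y =ᵐ[Q] fun g => T (x g) := fun x =>
    ⟨((Lp.memLp x).of_le_mul (c := 1)
      (hT.continuous.comp_aestronglyMeasurable (Lp.aestronglyMeasurable x))
      (Eventually.of_forall fun g => by simpa [hT0] using hlip (x g) 0)).toLp _,
      MemLp.coeFn_toLp _⟩
  have hDe : ∀ x y : Lp ℝ 2 Q, ∃ z : Lp ℝ 2 Q, z =ᵐ[Q] fun g => deriv T (x g) * y g := fun x y =>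
    ⟨(memLp_bdd_mul (C := 1) (Lp.memLp y)
      (hcT.comp_aestronglyMeasurable (Lp.aestronglyMeasurable x))
      (Eventually.of_forall fun g => hT1 _)).toLp _, MemLp.coeFn_toLp _⟩
  choose A hA using hTu
  choose B hB using hDe
  have hAv : A u = v := Lp.ext ((hA u).trans hv.symm)
  have l1 : Tendsto (fun k => A (p (s k)).1) atTop (𝓝 v) := by
    rw [← hAv, tendsto_iff_norm_sub_tendsto_zero]
    refine squeeze_zero (fun _ => norm_nonneg _) (fun k => ?_)
      (tendsto_iff_norm_sub_tendsto_zero.1 (hlim1.comp hs.tendsto_atTop))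
    refine (L2_norm_le_of_ae_le (g := (p (s k)).1 - u) (C := 1) ?_).trans_eq (one_mul _)
    filter_upwards [Lp.coeFn_sub (A (p (s k)).1) (A u), Lp.coeFn_sub (p (s k)).1 u,
      hA (p (s k)).1, hA u] with g h1 h2 h3 h4
    rw [h1, h2, Pi.sub_apply, Pi.sub_apply, h3, h4]
    exact hlip _ _
  have l2 : Tendsto (fun k => B (p (s k)).1 (p (s k)).2) atTop (𝓝 (B u e)) :=
    L2_tendsto_mul (a := fun k g => deriv T ((p (s k)).1 g)) (a' := fun g => deriv T (u g))
      (C := 1) (fun k => hcT.comp_aestronglyMeasurable (Lp.aestronglyMeasurable _))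
      (hcT.comp_aestronglyMeasurable (Lp.aestronglyMeasurable _))
      (fun k => Eventually.of_forall fun g => hT1 _)
      (hae.mono fun g hg => (hcT.tendsto _).comp hg) (hlim2.comp hs.tendsto_atTop)
      (fun k => hB _ _) (hB _ _)
  have hwm := (hw.memLp hφ (Q := Q)).1
  have key : ∀ k, inner ℝ (A (p k).1) δ = -inner ℝ (B (p k).1 (p k).2) (hwm.toLp _) := by
    intro k
    obtain ⟨w', dw', h', h1, h2⟩ := hp k
    have h0 := integral_div_eq_zero' hβ ((h'.comp_left hT).mul hw) hφ hV
    have i1 := L2_integrable_mul (A (p k).1) δ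
    have i2 := L2_integrable_mul (B (p k).1 (p k).2) (hwm.toLp _)
    rw [L2_inner_eq, L2_inner_eq, eq_neg_iff_add_eq_zero, ← integral_add i1 i2]
    refine (integral_congr_ae ?_).trans h0
    filter_upwards [h1, h2, hA (p k).1, hB (p k).1 (p k).2, hδ, hwm.coeFn_toLp]
      with g a1 a2 a3 a4 a5 a6
    rw [a3, a4, a5, a6, a1, a2]
    ring
  have l3 := l1.inner (𝕜 := ℝ) (tendsto_const_nhds (x := δ))
  have l4 := (l2.inner (𝕜 := ℝ) (tendsto_const_nhds (x := hwm.toLp _))).neg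
  simp only [key] at l3
  have hBu : B u e =ᵐ[Q] fun g => ∫ t, η (g, t) * φ (g.1 t) ∂lebesgueIco := by
    filter_upwards [hB u e, he, Measure.ae_ae_of_ae_prod hη] with g a1 a2 a3
    rw [a1, a2, ← integral_const_mul]
    refine integral_congr_ae (a3.mono fun t ht => ?_)
    beta_reduce
    rw [ht, mul_assoc]
  rw [tendsto_nhds_unique l3 l4, inner_field hζ hBu, L2_inner_congr EventuallyEq.rfl hwm.coeFn_toLp]

/-- A smooth approximation of the unit contraction. -/
def smoothUnit (ε x : ℝ) : ℝ := (√(x ^ 2 + ε) - √((x - 1) ^ 2 + ε) + (√(1 + ε) - √ε)) / 2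

theorem hasDerivAt_smoothUnit {ε : ℝ} (hε : 0 < ε) (x : ℝ) :
    HasDerivAt (smoothUnit ε) ((x / √(x ^ 2 + ε) - (x - 1) / √((x - 1) ^ 2 + ε)) / 2) x := by
  have h1 : HasDerivAt (fun x => √(x ^ 2 + ε)) (2 * x / (2 * √(x ^ 2 + ε))) x := by
    have := ((hasDerivAt_pow 2 x).add_const ε).sqrt (by positivity)
    simpa using this
  have h2 : HasDerivAt (fun x => √((x - 1) ^ 2 + ε))
      (2 * (x - 1) / (2 * √((x - 1) ^ 2 + ε))) x := by
    have := ((((hasDerivAt_id x).sub_const 1).pow 2).add_const ε).sqrt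
      (by have := sq_nonneg (x - 1); simp only [id, Pi.pow_apply]; positivity)
    simpa using this
  have h3 := ((h1.sub h2).add_const (√(1 + ε) - √ε)).div_const 2
  rw [mul_div_mul_left _ _ two_ne_zero, mul_div_mul_left _ _ two_ne_zero] at h3
  exact h3

theorem deriv_smoothUnit {ε : ℝ} (hε : 0 < ε) (x : ℝ) :
    deriv (smoothUnit ε) x = (x / √(x ^ 2 + ε) - (x - 1) / √((x - 1) ^ 2 + ε)) / 2 :=
  (hasDerivAt_smoothUnit hε x).deriv

theorem abs_div_sqrt_le {ε : ℝ} (hε : 0 < ε) (x : ℝ) : |x / √(x ^ 2 + ε)| ≤ 1 := by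
  rw [abs_div, abs_of_nonneg (Real.sqrt_nonneg _)]
  exact div_le_one_of_le₀ (Real.abs_le_sqrt (by linarith)) (Real.sqrt_nonneg _)

theorem abs_deriv_smoothUnit_le {ε : ℝ} (hε : 0 < ε) (x : ℝ) : |deriv (smoothUnit ε) x| ≤ 1 := by
  rw [deriv_smoothUnit hε]
  have h1 := abs_le.1 (abs_div_sqrt_le hε x)
  have h2 := abs_le.1 (abs_div_sqrt_le hε (x - 1))
  rw [abs_le]
  constructor <;> linarith [h1.1, h1.2, h2.1, h2.2]

theorem contDiff_smoothUnit {ε : ℝ} (hε : 0 < ε) : ContDiff ℝ 1 (smoothUnit ε) := by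
  unfold smoothUnit
  refine ContDiff.div_const (ContDiff.add (ContDiff.sub ?_ ?_) contDiff_const) _
  · exact ((contDiff_id.pow 2).add contDiff_const).sqrt fun x => by
      have := sq_nonneg x; simp only [id]; positivity
  · exact (((contDiff_id.sub contDiff_const).pow 2).add contDiff_const).sqrt fun x => by
      have := sq_nonneg (x - 1); simp only [id]; positivity

theorem smoothUnit_zero (ε : ℝ) : smoothUnit ε 0 = 0 := by simp [smoothUnit]

/-- The unit contraction equals (|x| - |x - 1| + 1)/2, and √(x² + ε) smooths each absolute value.
The additive constant is adjusted so that 0 is mapped to 0. -/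
theorem tendsto_smoothUnit {ε : ℕ → ℝ} (hε : Tendsto ε atTop (𝓝 0)) (x : ℝ) :
    Tendsto (fun n => smoothUnit (ε n) x) atTop (𝓝 (min (max 0 x) 1)) := by
  have hs : ∀ a : ℝ, Tendsto (fun n => √(a + ε n)) atTop (𝓝 √a) := fun a => by
    have := (Real.continuous_sqrt.tendsto (a + 0)).comp (hε.const_add a)
    rwa [add_zero] at this
  have h := (((hs (x ^ 2)).sub (hs ((x - 1) ^ 2))).add ((hs 1).sub (by simpa using hs 0))).div_const 2
  suffices e : min (max 0 x) 1 = (√(x ^ 2) - √((x - 1) ^ 2) + (√1 - 0)) / 2 by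
    rw [e]; exact h
  rw [Real.sqrt_sq_eq_abs, Real.sqrt_sq_eq_abs, Real.sqrt_one]
  rcases le_total x 0 with h0 | h0
  · rw [max_eq_left h0, min_eq_left zero_le_one, abs_of_nonpos h0, abs_of_nonpos (by linarith)]
    ring
  · rw [max_eq_right h0, abs_of_nonneg h0]
    rcases le_total x 1 with h1 | h1
    · rw [min_eq_left h1, abs_of_nonpos (by linarith)]; ring
    · rw [min_eq_right h1, abs_of_nonneg (by linarith)]; ring

/-- The convention 0/0 = 0 gives the correct limit at the kinks 0 and 1 as well. Convergence holds
everywhere, so nothing has to be known about gradients on level sets. -/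
theorem tendsto_deriv_smoothUnit {ε : ℕ → ℝ} (hε0 : ∀ n, 0 < ε n) (hε : Tendsto ε atTop (𝓝 0))
    (x : ℝ) : Tendsto (fun n => deriv (smoothUnit (ε n)) x) atTop
      (𝓝 ((x / |x| - (x - 1) / |x - 1|) / 2)) := by
  have hs : ∀ a : ℝ, Tendsto (fun n => a / √(a ^ 2 + ε n)) atTop (𝓝 (a / |a|)) := fun a => by
    rcases eq_or_ne a 0 with rfl | ha
    · simp
    · have := (Real.continuous_sqrt.tendsto (a ^ 2 + 0)).comp (hε.const_add (a ^ 2))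
      rw [add_zero, Real.sqrt_sq_eq_abs] at this
      exact tendsto_const_nhds.div this (abs_ne_zero.2 ha)
  simp only [fun n => deriv_smoothUnit (hε0 n) x]
  exact ((hs x).sub (hs (x - 1))).div_const 2

/-- The chain rule for the smooth approximations passes to the limit in the closed weak graph. The
limiting gradient is S(u) ξ with |S| ≤ 1. -/
theorem weakGraph_markov (hβ : 0 < β) {u v : Lp ℝ 2 Q} {ξ : Lp ℝ 2 (Q.prod lebesgueIco)}
    (h : (u, ξ) ∈ weakGraph hQ) (hv : v =ᵐ[Q] fun g => min (max 0 (u g)) 1) :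
    ∃ η, (v, η) ∈ weakGraph hQ ∧ ‖η‖ ≤ ‖ξ‖ := by
  have := hQ.isProbabilityMeasure
  let ε : ℕ → ℝ := fun n => 1 / ((n : ℝ) + 1)
  have hε0 : ∀ n, 0 < ε n := fun n => by positivity
  have hε : Tendsto ε atTop (𝓝 0) := tendsto_one_div_add_atTop_nhds_zero_nat
  have hum : AEStronglyMeasurable (fun z : QuantileFn × UnitIco => u z.1) (Q.prod lebesgueIco) :=
    (Lp.aestronglyMeasurable u).comp_fst
  have hcd : ∀ n, Continuous (deriv (smoothUnit (ε n))) := fun n =>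
    (contDiff_smoothUnit (hε0 n)).continuous_deriv le_rfl
  have hle : ∀ n x, |smoothUnit (ε n) x| ≤ |x| := fun n x => by
    have := Convex.norm_image_sub_le_of_norm_deriv_le (s := univ) (𝕜 := ℝ) (C := 1)
      (fun x _ => (contDiff_smoothUnit (hε0 n)).differentiable (by norm_num) x)
      (fun x _ => abs_deriv_smoothUnit_le (hε0 n) x) convex_univ (mem_univ 0) (mem_univ x)
    simpa [smoothUnit_zero] using this
  have ha : ∀ n, MemLp (fun g => smoothUnit (ε n) (u g)) 2 Q := fun n =>
    (Lp.memLp u).of_le ((contDiff_smoothUnit (hε0 n)).continuous.comp_aestronglyMeasurable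
      (Lp.aestronglyMeasurable u)) (Eventually.of_forall fun g => hle n _)
  have hb : ∀ n, MemLp (fun z : QuantileFn × UnitIco => deriv (smoothUnit (ε n)) (u z.1) * ξ z) 2
      (Q.prod lebesgueIco) := fun n =>
    memLp_bdd_mul (C := 1) (Lp.memLp ξ) ((hcd n).comp_aestronglyMeasurable hum)
      (Eventually.of_forall fun z => abs_deriv_smoothUnit_le (hε0 n) _)
  have hmem : ∀ n, ((ha n).toLp _, (hb n).toLp _) ∈ weakGraph hQ := fun n =>
    weakGraph_chain hβ (contDiff_smoothUnit (hε0 n)) (smoothUnit_zero _)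
      (abs_deriv_smoothUnit_le (hε0 n)) h (ha n).coeFn_toLp (hb n).coeFn_toLp
  let S : ℝ → ℝ := fun x => (x / |x| - (x - 1) / |x - 1|) / 2
  have hSl : ∀ x, Tendsto (fun n => deriv (smoothUnit (ε n)) x) atTop (𝓝 (S x)) :=
    tendsto_deriv_smoothUnit hε0 hε
  have hS : ∀ x, |S x| ≤ 1 := fun x => by
    have h1 := (hSl x).abs
    exact le_of_tendsto h1 (Eventually.of_forall fun n => abs_deriv_smoothUnit_le (hε0 n) x)
  have hSm : AEStronglyMeasurable (fun z : QuantileFn × UnitIco => S (u z.1))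
      (Q.prod lebesgueIco) :=
    aestronglyMeasurable_of_tendsto_ae atTop (fun n => (hcd n).comp_aestronglyMeasurable hum)
      (Eventually.of_forall fun z => hSl _)
  have hη : MemLp (fun z => S (u z.1) * ξ z) 2 (Q.prod lebesgueIco) :=
    memLp_bdd_mul (C := 1) (Lp.memLp ξ) hSm (Eventually.of_forall fun z => hS _)
  refine ⟨hη.toLp _, ?_, ?_⟩
  · refine isClosed_weakGraph.mem_of_tendsto (b := (atTop : Filter ℕ)) (Tendsto.prodMk_nhds ?_ ?_)
      (Eventually.of_forall hmem)
    · refine L2_tendsto_of_dominated (fun g => |u g|) (Lp.memLp u).norm (fun n => ?_) ?_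
      · filter_upwards [(ha n).coeFn_toLp] with g h1
        rw [h1]; exact hle n _
      · filter_upwards [ae_all_iff.2 fun n => (ha n).coeFn_toLp, hv] with g h1 h2
        rw [h2]
        exact (tendsto_smoothUnit hε (u g)).congr fun n => (h1 n).symm
    · exact L2_tendsto_mul (C := 1) (fun n => (hcd n).comp_aestronglyMeasurable hum) hSm
        (fun n => Eventually.of_forall fun z => abs_deriv_smoothUnit_le (hε0 n) _)
        (Eventually.of_forall fun z => hSl _) (tendsto_const_nhds (x := ξ))
        (fun n => (hb n).coeFn_toLp) hη.coeFn_toLp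
  · refine (L2_norm_le_of_ae_le (C := 1) ?_).trans_eq (one_mul _)
    filter_upwards [hη.coeFn_toLp] with z hz
    rw [hz, abs_mul]
    exact mul_le_mul_of_nonneg_right (hS _) (abs_nonneg _)

end Markov

/-! ### The Dirichlet form of weak gradients -/

section Form

variable {β : ℝ} {Q : Measure QuantileFn} {hQ : IsDirichletLaw β Q}

/-- The closed linear span of the elementary vector fields. -/
def fieldSpan (hQ : IsDirichletLaw β Q) : Submodule ℝ (Lp ℝ 2 (Q.prod lebesgueIco)) :=
  (Submodule.span ℝ (Prod.snd '' divGraph hQ)).topologicalClosure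

/-- The weak gradients inside the tangent field space. -/
def weakGrad (hQ : IsDirichletLaw β Q) :
    Submodule ℝ (Lp ℝ 2 Q × Lp ℝ 2 (Q.prod lebesgueIco)) :=
  weakGraph hQ ⊓ (fieldSpan hQ).comap (LinearMap.snd ℝ _ _)

theorem mem_fieldSpan {q : Lp ℝ 2 Q × Lp ℝ 2 (Q.prod lebesgueIco)} (hq : q ∈ divGraph hQ) :
    q.2 ∈ fieldSpan hQ :=
  Submodule.le_topologicalClosure _ (Submodule.subset_span ⟨q, hq, rfl⟩)

/-- The orthogonal projection to the span of the fields changes no pairing with a field, so it is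
again a weak gradient, of no larger norm. -/
theorem exists_mem_weakGrad {u : Lp ℝ 2 Q} {ξ : Lp ℝ 2 (Q.prod lebesgueIco)}
    (h : (u, ξ) ∈ weakGraph hQ) : ∃ η, (u, η) ∈ weakGrad hQ ∧ ‖η‖ ≤ ‖ξ‖ := by
  have hc : CompleteSpace (fieldSpan hQ) :=
    (Submodule.isClosed_topologicalClosure _).completeSpace_coe
  refine ⟨(fieldSpan hQ).starProjection ξ, ⟨fun q hq => ?_, ?_⟩,
    (fieldSpan hQ).norm_starProjection_apply_le ξ⟩
  · have h1 := (fieldSpan hQ).starProjection_inner_eq_zero ξ q.2 (mem_fieldSpan hq)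
    rw [inner_sub_left, sub_eq_zero] at h1
    rw [show inner ℝ u q.1 = _ from h q hq, h1]
  · exact (fieldSpan hQ).starProjection_apply_mem ξ

theorem isClosed_weakGrad :
    IsClosed (weakGrad hQ : Set (Lp ℝ 2 Q × Lp ℝ 2 (Q.prod lebesgueIco))) :=
  isClosed_weakGraph.inter
    ((Submodule.isClosed_topologicalClosure _).preimage continuous_snd)

/-- A weak gradient of 0 is orthogonal to every field. This is why gradients are restricted to the
span of the fields: there they are unique. -/
theorem eq_zero_of_mem_weakGrad {ξ : Lp ℝ 2 (Q.prod lebesgueIco)}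
    (h : (0, ξ) ∈ weakGrad hQ) : ξ = 0 := by
  have h1 : Prod.snd '' divGraph hQ ⊆ {η | inner ℝ ξ η = (0 : ℝ)} := by
    rintro _ ⟨q, hq, rfl⟩
    have := h.1 q hq
    rw [show inner ℝ (0 : Lp ℝ 2 Q) q.1 = 0 from inner_zero_left _] at this
    exact neg_eq_zero.1 this.symm
  have h2 : Submodule.span ℝ (Prod.snd '' divGraph hQ) ≤ LinearMap.ker (innerSL ℝ ξ).toLinearMap :=
    Submodule.span_le.2 h1
  have h3 : (fieldSpan hQ : Set (Lp ℝ 2 (Q.prod lebesgueIco))) ⊆ {η | inner ℝ ξ η = (0 : ℝ)} :=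
    closure_minimal (fun η hη => h2 hη)
      (isClosed_eq (continuous_const.inner continuous_id) continuous_const)
  exact inner_self_eq_zero.1 (h3 h.2)

theorem dense_weakGrad (hβ : 0 < β) : Dense {u : Lp ℝ 2 Q | ∃ ξ, (u, ξ) ∈ weakGrad hQ} := by
  have := hQ.isProbabilityMeasure
  have h := dense_of_orthogonal ((weakGrad hQ).map (LinearMap.fst ℝ _ _)) fun y hy =>
    eq_zero_of_orthogonal_cylinder fun p hp => by
      obtain ⟨η, hη, -⟩ := exists_mem_weakGrad (hQ := hQ) (cylinderGradient_subset hβ hp)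
      exact hy _ ⟨_, hη, rfl⟩
  refine h.mono ?_
  rintro _ ⟨p, hp, rfl⟩
  exact ⟨p.2, hp⟩

theorem bddC2_deriv {ψ : ℝ → ℝ} (h : ContDiff ℝ ∞ ψ) (hc : HasCompactSupport ψ) :
    BddC2 (deriv ψ) :=
  BddC2.of_hasCompactSupport (contDiff_infty.1 (contDiff_infty_iff_deriv.1 h).2 2) hc.deriv

/-- As φ_i' vanishes at 0 and 1, the gradient is a sum of the admissible fields ∂_iU · φ_i'(g), each
with a divergence. Pairing with any weak gradient is then governed by the definition of `weakGraph`.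
Comparison on the dense cylinder functions identifies w with the sum of these divergences. -/
theorem neumann_generator (hβ : 0 < β) {u w : Lp ℝ 2 Q} (h : IsNeumannGenerator Q u w) :
    ∃ ξ, (u, ξ) ∈ weakGrad hQ ∧ ∀ v η, (v, η) ∈ weakGrad hQ → inner ℝ ξ η = -inner ℝ w v := by
  have := hQ.isProbabilityMeasure
  obtain ⟨ξ, ⟨m, U, φ, hU, hUc, hφ, hu, hξ⟩, hgen⟩ := h
  simp only at hu hξ
  have hφv : ∀ i, VecField (deriv (φ i)) := fun i =>
    { bddC2_deriv (hφ i).1 (hφ i).2.1 with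
      zero := (hφ i).2.2.1
      one := (hφ i).2.2.2 }
  have hφb : ∀ i, BddC2 (φ i) := fun i =>
    BddC2.of_hasCompactSupport (contDiff_infty.1 (hφ i).1 2) (hφ i).2.1
  have hone : Integrable (fun _ : UnitIco => (1 : ℝ)) lebesgueIco := integrable_const _
  have hcomp : ∀ (ψ : ℝ → ℝ) h, comp (fun _ => 1) ψ h = ∫ t, ψ (h t) ∂lebesgueIco := fun ψ h => by
    simp only [comp, one_mul]
  have hUd : ∀ i : Fin m, ContDiff ℝ 1 fun y => fderiv ℝ U y (Pi.single i 1) := fun i =>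
    ((contDiff_infty.1 hU 2).fderiv_right (m := 1) (by norm_num)).clm_apply contDiff_const
  have hw : ∀ i : Fin m, ∃ dw, IsTest (deriv (φ i))
      (fun h => fderiv ℝ U (fun j => comp (fun _ => 1) (φ j) h) (Pi.single i 1)) dw := fun i =>
    ⟨_, Fin m, inferInstance, _, _, _, hUd i, fun _ => hone, hφb, fun _ => rfl, fun _ => rfl⟩
  choose dw hw using hw
  have hV : ∀ i, ∃ V, IsDivergence hQ (deriv (φ i)) V := fun i => exists_divergence hQ hβ (hφv i)
  choose V hV using hV
  let δ : Fin m → Lp ℝ 2 Q := fun i => ((hw i).memLp_div (hφv i) (V i)).toLp _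
  let ζ : Fin m → Lp ℝ 2 (Q.prod lebesgueIco) := fun i =>
    (memLp_field (Q := Q) (hφv i) (hw i) (hφv i).toBddC2).toLp _
  have hζ : ∀ i, ζ i =ᵐ[Q.prod lebesgueIco] fun z =>
      fderiv ℝ U (fun j => comp (fun _ => 1) (φ j) z.1.1) (Pi.single i 1) *
        deriv (φ i) (z.1.1 z.2) := fun i => MemLp.coeFn_toLp _
  have hmem : ∀ i, (δ i, ζ i) ∈ divGraph hQ := fun i =>
    ⟨_, _, _, _, hφv i, hw i, hV i, ((hw i).memLp_div (hφv i) (V i)).coeFn_toLp, hζ i⟩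
  have hξsum : ξ = ∑ i, ζ i := by
    refine Lp.ext ?_
    filter_upwards [hξ, Lp.coeFn_finsetSum Finset.univ ζ, ae_all_iff.2 hζ] with z h1 h2 h3
    rw [h1, h2, Finset.sum_apply]
    refine Finset.sum_congr rfl fun i _ => ?_
    rw [h3]
    simp only [hcomp]
  have hibp : ∀ v η, (v, η) ∈ weakGraph hQ → inner ℝ ξ η = -inner ℝ (∑ i, δ i) v := by
    intro v η hvη
    rw [hξsum, sum_inner, sum_inner, ← Finset.sum_neg_distrib]
    refine Finset.sum_congr rfl fun i _ => ?_
    rw [real_inner_comm, real_inner_comm v, show inner ℝ v (δ i) = _ from hvη _ (hmem i), neg_neg]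
  have hwδ : w = ∑ i, δ i := by
    refine sub_eq_zero.1 (eq_zero_of_orthogonal_cylinder fun p hp => ?_)
    have h1 := hgen p hp
    rw [hibp p.1 p.2 (cylinderGradient_subset hβ hp), neg_inj] at h1
    rw [real_inner_comm, inner_sub_left, h1, sub_self]
  refine ⟨ξ, ⟨?_, ?_⟩, fun v η hvη => ?_⟩
  · refine mem_weakGraph_of_repr hβ (contDiff_infty.1 hU 1) (fun _ => hone) hφb
      (by simpa only [hcomp] using hu) ?_
    simpa only [hcomp, one_mul] using hξ
  · change ξ ∈ fieldSpan hQ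
    rw [hξsum]
    exact Submodule.sum_mem _ fun i _ => mem_fieldSpan (hmem i)
  · rw [hibp v η hvη.1, hwδ]

/-- Under Markov uniqueness, weak gradients bound the form. -/
theorem wassersteinForm_le (hβ : 0 < β) (hM : IsMarkovUnique Q) {u : Lp ℝ 2 Q}
    {ξ : Lp ℝ 2 (Q.prod lebesgueIco)} (h : (u, ξ) ∈ weakGraph hQ) :
    wassersteinForm Q u ≤ ‖ξ‖ₑ ^ 2 := by
  obtain ⟨E, -, hE, hgen⟩ := exists_dirichletForm (weakGrad hQ) isClosed_weakGrad
    (fun ξ hξ => eq_zero_of_mem_weakGrad hξ) (dense_weakGrad hβ) (fun u ξ v huξ hv => by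
      obtain ⟨η, hη, hle⟩ := weakGraph_markov hβ huξ.1 hv
      obtain ⟨η', hη', hle'⟩ := exists_mem_weakGrad hη
      exact ⟨η', hη', hle'.trans hle⟩)
  have heq := hM E fun u w huw => by
    obtain ⟨ξ, hξ, hib⟩ := neumann_generator (hQ := hQ) hβ huw
    exact hgen u ξ w hξ hib
  obtain ⟨η, hη, hle⟩ := exists_mem_weakGrad h
  rw [← heq, hE u η hη]
  gcongr
  exact enorm_le_iff_norm_le.2 hle

end Form

/-! ### Lifting gradients of the particle forms -/

section LiftField

variable {β : ℝ} {Q : Measure QuantileFn} (hQ : IsDirichletLaw β Q) {n : ℕ}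

theorem eq_sum_cell (a : Fin (n + 1) → ℝ) (t : UnitIco) :
    a (cellIdx n t) = ∑ j, (cell n j).indicator (fun _ => (1 : ℝ)) t * a j := by
  rw [Finset.sum_eq_single (cellIdx n t)]
  · rw [indicator_of_mem (show t ∈ cell n (cellIdx n t) from rfl), one_mul]
  · intro j _ hj
    rw [indicator_of_notMem (show t ∉ cell n j from fun ht => hj (Eq.symm ht)), zero_mul]
  · simp

theorem abs_indicator_cell_le (j : Fin (n + 1)) (t : UnitIco) :
    |(cell n j).indicator (fun _ => (1 : ℝ)) t| ≤ 1 := by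
  rw [abs_of_nonneg (indicator_nonneg (fun _ _ => zero_le_one) t)]
  exact indicator_le_self' (fun _ _ => zero_le_one) t

include hQ in
theorem memLp_cellwise {a : Fin (n + 1) → (Fin n → ℝ) → ℝ}
    (ha : ∀ j, MemLp (a j) 2 (particleMeasure β n)) :
    MemLp (fun z : QuantileFn × UnitIco => a (cellIdx n z.2) (gridEval n z.1)) 2
      (Q.prod lebesgueIco) := by
  have := hQ.isProbabilityMeasure
  have h : ∀ z : QuantileFn × UnitIco, a (cellIdx n z.2) (gridEval n z.1) =
      ∑ j, (cell n j).indicator (fun _ => (1 : ℝ)) z.2 * a j (gridEval n z.1) := fun z =>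
    eq_sum_cell (fun j => a j (gridEval n z.1)) z.2
  simp only [h]
  refine memLp_finsetSum _ fun j _ => ?_
  refine memLp_bdd_mul (C := 1)
    ((ha j).comp_measurePreserving ((hQ.measurePreserving n).comp measurePreserving_fst))
    ((measurable_const.indicator (measurableSet_cell j)).comp measurable_snd).aestronglyMeasurable
    (Eventually.of_forall fun z => abs_indicator_cell_le j z.2)

include hQ in
theorem integral_cellwise {a : Fin (n + 1) → (Fin n → ℝ) → ℝ}
    (ha : ∀ j, Integrable (a j) (particleMeasure β n)) :
    ∫ z, a (cellIdx n z.2) (gridEval n z.1) ∂(Q.prod lebesgueIco) =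
      1 / (n + 1) * ∑ j, ∫ x, a j x ∂(particleMeasure β n) := by
  have := hQ.isProbabilityMeasure
  have h : ∀ z : QuantileFn × UnitIco, a (cellIdx n z.2) (gridEval n z.1) =
      ∑ j, a j (gridEval n z.1) * (cell n j).indicator (fun _ => (1 : ℝ)) z.2 := fun z => by
    rw [eq_sum_cell (fun j => a j (gridEval n z.1)) z.2]
    exact Finset.sum_congr rfl fun j _ => mul_comm _ _
  have hi : ∀ j : Fin (n + 1), Integrable ((cell n j).indicator fun _ => (1 : ℝ)) lebesgueIco :=
    fun j => (integrable_const _).indicator (measurableSet_cell j)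
  have hai : ∀ j, Integrable (fun g => a j (gridEval n g)) Q := fun j =>
    (hQ.measurePreserving n).integrable_comp_of_integrable (ha j)
  simp only [h]
  rw [integral_finsetSum _ fun j _ => (hai j).mul_prod (hi j), Finset.mul_sum]
  refine Finset.sum_congr rfl fun j _ => ?_
  rw [integral_prod_mul (fun g => a j (gridEval n g)), integral_gridEval hQ n (ha j).1,
    integral_indicator (measurableSet_cell j), setIntegral_const, lebesgueIco_cell, smul_eq_mul,
    mul_one, mul_comm]

/-- The extension of a vector by zero. -/
def extendZero (v : EuclideanSpace ℝ (Fin n)) : Fin (n + 1) → ℝ :=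
  Fin.snoc (α := fun _ => ℝ) (fun i => v i) 0

@[simp] theorem extendZero_castSucc (v : EuclideanSpace ℝ (Fin n)) (i : Fin n) :
    extendZero v i.castSucc = v i := by simp [extendZero]

@[simp] theorem extendZero_last (v : EuclideanSpace ℝ (Fin n)) :
    extendZero v (Fin.last n) = 0 := by simp [extendZero]

theorem memLp_coord {Ω : Type*} [MeasurableSpace Ω] {μ : Measure Ω}
    {f : Ω → EuclideanSpace ℝ (Fin n)} (hf : MemLp f 2 μ) (i : Fin n) :
    MemLp (fun x => f x i) 2 μ :=
  hf.of_le ((EuclideanSpace.proj (𝕜 := ℝ) i).continuous.comp_aestronglyMeasurable hf.1)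
    (Eventually.of_forall fun _ => PiLp.norm_apply_le _ i)

theorem memLp_extendZero {Ω : Type*} [MeasurableSpace Ω] {μ : Measure Ω}
    {f : Ω → EuclideanSpace ℝ (Fin n)} (hf : MemLp f 2 μ) (j : Fin (n + 1)) :
    MemLp (fun x => extendZero (f x) j) 2 μ := by
  refine Fin.lastCases ?_ (fun i => ?_) j
  · simp
  · simpa using memLp_coord hf i

-- The gradient is spread over the cells as N ∂_i f. Each cell has mass 1/N, so the squared norm is
-- multiplied by N² · 1/N = N, the scaling factor of the forms. The last cell, with its fixed value
-- 1, receives zero.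
include hQ in
theorem exists_liftField (ξ : Lp (EuclideanSpace ℝ (Fin n)) 2 (particleMeasure β n)) :
    ∃ η : Lp ℝ 2 (Q.prod lebesgueIco), (η =ᵐ[Q.prod lebesgueIco] fun z =>
      (n + 1) * extendZero (ξ (gridEval n z.1)) (cellIdx n z.2)) ∧
      ‖η‖ ^ 2 = (n + 1) * ‖ξ‖ ^ 2 := by
  have hm := memLp_cellwise hQ fun j => (memLp_extendZero (Lp.memLp ξ) j).const_mul (n + 1 : ℝ)
  refine ⟨hm.toLp _, hm.coeFn_toLp, ?_⟩
  have hi : ∀ j, Integrable (fun x => ((n + 1) * extendZero (ξ x) j) ^ 2) (particleMeasure β n) :=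
    fun j => ((memLp_extendZero (Lp.memLp ξ) j).const_mul (n + 1 : ℝ)).integrable_sq
  have h1 : ‖hm.toLp _‖ ^ 2 = ∫ z : QuantileFn × UnitIco,
      ((n + 1) * extendZero (ξ (gridEval n z.1)) (cellIdx n z.2)) ^ 2 ∂(Q.prod lebesgueIco) := by
    rw [L2_norm_sq]
    exact integral_congr_ae (hm.coeFn_toLp.mono fun z hz => by beta_reduce; rw [hz])
  rw [h1, integral_cellwise hQ hi, Fin.sum_univ_castSucc]
  have h2 : ‖ξ‖ ^ 2 = ∑ i, ∫ x, ξ x i ^ 2 ∂(particleMeasure β n) := by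
    rw [← real_inner_self_eq_norm_sq, L2.inner_def, ← integral_finsetSum _ fun i _ =>
      (memLp_coord (Lp.memLp ξ) i).integrable_sq]
    refine integral_congr_ae (Eventually.of_forall fun x => ?_)
    simp only [real_inner_self_eq_norm_sq, EuclideanSpace.norm_sq_eq, Real.norm_eq_abs, sq_abs]
  simp only [extendZero_castSucc, extendZero_last, mul_zero, mul_pow, integral_const_mul]
  rw [h2, ← Finset.mul_sum]
  have : (n : ℝ) + 1 ≠ 0 := by positivity
  field_simp
  simp

-- The factor N of the lifted gradient cancels the mass 1/N of a cell, and the last cell drops out.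
-- Pairings with fields thus agree on both sides.
include hQ in
theorem inner_liftField {φ : ℝ → ℝ} {w : (UnitIco → ℝ) → ℝ}
    {ξ y : Lp (EuclideanSpace ℝ (Fin n)) 2 (particleMeasure β n)}
    {η ζ : Lp ℝ 2 (Q.prod lebesgueIco)}
    (hy : y =ᵐ[particleMeasure β n] fun x => WithLp.toLp 2 fun i => w (step n x) * φ (x i))
    (hη : η =ᵐ[Q.prod lebesgueIco] fun z =>
      (n + 1) * extendZero (ξ (gridEval n z.1)) (cellIdx n z.2))
    (hζ : ζ =ᵐ[Q.prod lebesgueIco] fun z =>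
      w (step n (gridEval n z.1)) * φ (step n (gridEval n z.1) z.2)) :
    inner ℝ η ζ = inner ℝ ξ y := by
  have hi : ∀ i, Integrable (fun x => ξ x i * (w (step n x) * φ (x i))) (particleMeasure β n) :=
    fun i => ((memLp_coord (Lp.memLp ξ) i).integrable_mul (memLp_coord (Lp.memLp y) i)).congr
      (hy.mono fun x hx => by simp [hx])
  refine (L2_inner_congr hη hζ).trans ((integral_cellwise hQ (a := fun j x =>
    (n + 1) * extendZero (ξ x) j * (w (step n x) * φ (withEnds x j.succ))) (fun j => ?_)).trans ?_)
  rotate_left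
  · rw [Fin.sum_univ_castSucc]
    have h2 : ∀ (i : Fin n) (x : Fin n → ℝ), (n + 1) * extendZero (ξ x) i.castSucc *
        (w (step n x) * φ (withEnds x i.castSucc.succ)) =
        (n + 1) * (ξ x i * (w (step n x) * φ (x i))) := fun i x => by
      rw [extendZero_castSucc, withEnds_mid]; ring
    simp only [h2, extendZero_last, mul_zero, zero_mul, integral_const_mul, integral_zero]
    rw [← Finset.mul_sum, add_zero, ← mul_assoc, one_div_mul_cancel (by positivity), one_mul,
      ← integral_finsetSum _ fun i _ => hi i, L2.inner_def]
    refine integral_congr_ae (hy.mono fun x hx => ?_)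
    simp [PiLp.inner_apply, hx, mul_comm]
  · refine Fin.lastCases ?_ (fun i => ?_) j
    · simp
    · refine ((hi i).const_mul (n + 1 : ℝ)).congr (Eventually.of_forall fun x => ?_)
      beta_reduce
      rw [extendZero_castSucc, withEnds_mid]; ring

end LiftField

/-! ### The lower bound condition -/

section Lower

variable {β : ℝ} {Q : Measure QuantileFn} (hQ : IsDirichletLaw β Q) {n : ℕ}

-- For smooth f this is `integral_particle_div` applied to the product f · w. Both sides are
-- continuous in (f, ∇f), so it persists on the closure.
include hQ in
theorem inner_particleGradient (hβ : 0 < β) {φ : ℝ → ℝ} (hφ : VecField φ)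
    {w dw : (UnitIco → ℝ) → ℝ} (hw : IsTest φ w dw) {δ : Lp ℝ 2 (particleMeasure β n)}
    {y : Lp (EuclideanSpace ℝ (Fin n)) 2 (particleMeasure β n)}
    (hδ : δ =ᵐ[particleMeasure β n] fun x => dw (step n x) + w (step n x) * vecDiv β n φ x)
    (hy : y =ᵐ[particleMeasure β n] fun x => WithLp.toLp 2 fun i => w (step n x) * φ (x i))
    {p : Lp ℝ 2 (particleMeasure β n) × Lp (EuclideanSpace ℝ (Fin n)) 2 (particleMeasure β n)}
    (hp : p ∈ closure (particleGradient β n)) : inner ℝ p.1 δ = -inner ℝ p.2 y := by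
  have := hQ.isProbabilityMeasure_particle n
  refine closure_minimal (s := particleGradient β n) (t := {p | inner ℝ p.1 δ = -inner ℝ p.2 y})
    ?_ (isClosed_eq (continuous_fst.inner continuous_const)
      (continuous_snd.inner continuous_const).neg) hp
  rintro p ⟨f, hf, h1, h2⟩
  have hf1 : ContDiff ℝ 1 f := contDiff_infty.1 hf 1
  have h0 := integral_particle_div hβ hφ (hf1.mul (hw.contDiff_step n))
  have hder : ∀ x : Fin n → ℝ, fderiv ℝ (fun x => f x * w (step n x)) x (fun i => φ (x i)) =
      f x * dw (step n x) + w (step n x) * ∑ i, φ (x i) * fderiv ℝ f x (Pi.single i 1) := by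
    intro x
    have a1 := (hf1.differentiable (by norm_num) x).hasFDerivAt.mul
      ((hw.contDiff_step n).differentiable (by norm_num) x).hasFDerivAt
    rw [show fderiv ℝ (fun x => f x * w (step n x)) x = _ from a1.fderiv, add_apply, smul_apply,
      smul_apply, hw.fderiv_step hφ.zero hφ.one, clm_apply_eq_sum (fderiv ℝ f x)]
    rfl
  have i1 := L2_integrable_mul p.1 δ
  have i2 : Integrable (fun x => inner ℝ (p.2 x) (y x)) (particleMeasure β n) :=
    L2.integrable_inner p.2 y
  change inner ℝ p.1 δ = -inner ℝ p.2 y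
  rw [L2_inner_eq, L2.inner_def, eq_neg_iff_add_eq_zero, ← integral_add i1 i2]
  refine (integral_congr_ae ?_).trans h0
  filter_upwards [h1, h2, hδ, hy] with x a1 a2 a3 a4
  rw [a1, a2, a3, a4, hder]
  have e : inner ℝ (WithLp.toLp 2 fun i => fderiv ℝ f x (Pi.single i 1) : EuclideanSpace ℝ (Fin n))
      (WithLp.toLp 2 fun i => w (step n x) * φ (x i)) =
      w (step n x) * ∑ i, φ (x i) * fderiv ℝ f x (Pi.single i 1) := by
    simp only [PiLp.inner_apply, RCLike.inner_apply, conj_trivial, Finset.mul_sum, mul_assoc]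
  rw [e]
  ring

theorem exists_tendsto_field {φ : ℝ → ℝ} (hφ : VecField φ) {w dw : (UnitIco → ℝ) → ℝ}
    (hw : IsTest φ w dw) [IsFiniteMeasure Q] {ζ : Lp ℝ 2 (Q.prod lebesgueIco)}
    (hζ : ζ =ᵐ[Q.prod lebesgueIco] fun z => w z.1.1 * φ (z.1.1 z.2)) :
    ∃ v : ℕ → Lp ℝ 2 (Q.prod lebesgueIco), (∀ n, v n =ᵐ[Q.prod lebesgueIco] fun z =>
      w (step n (gridEval n z.1)) * φ (step n (gridEval n z.1) z.2)) ∧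
      Tendsto v atTop (𝓝 ζ) := by
  obtain ⟨C, hC⟩ := hw.bounded hφ.toBddC2
  obtain ⟨D, -, hD⟩ := hφ.bound
  have hb : ∀ (h : UnitIco → ℝ) t, |w h * φ (h t)| ≤ C * D := fun h t => by
    rw [abs_mul]
    exact mul_le_mul (hC _).1 (hD _).1 (abs_nonneg _) ((abs_nonneg _).trans (hC h).1)
  have hm : ∀ n, MemLp (fun z : QuantileFn × UnitIco =>
      w (step n (gridEval n z.1)) * φ (step n (gridEval n z.1) z.2)) 2 (Q.prod lebesgueIco) :=
    fun n => MemLp.of_bound ((((hw.measurable_step hφ n).1.comp (measurable_gridEval n)).comp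
      measurable_fst).mul (hφ.continuous.measurable.comp
        (measurable_step_uncurry n))).aestronglyMeasurable _ (Eventually.of_forall fun z => hb _ _)
  refine ⟨fun n => (hm n).toLp _, fun n => (hm n).coeFn_toLp,
    L2_tendsto_of_bounded (C * D) (fun n => ?_) ?_⟩
  · filter_upwards [(hm n).coeFn_toLp] with z hz
    rw [hz]
    exact hb _ _
  · filter_upwards [ae_all_iff.2 fun n => (hm n).coeFn_toLp, hζ] with z h1 h2
    rw [h2]
    refine Tendsto.congr (fun n => (h1 n).symm) ?_
    exact (hw.tendsto hφ.toBddC2 (fun n => measurable_step _) (tendsto_step_gridEval z.1)).1.mul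
      ((hφ.continuous.tendsto _).comp (tendsto_step_gridEval z.1 z.2))

theorem exists_of_mul_closedForm_lt {H T : Type*} [NormedAddCommGroup H] [NormedAddCommGroup T]
    {S : Set (H × T)} {u : H} {c b : ℝ≥0∞} (hc : c ≠ 0) (hc' : c ≠ ⊤)
    (h : c * closedForm S u < b) : ∃ ξ, (u, ξ) ∈ closure S ∧ c * ‖ξ‖ₑ ^ 2 < b := by
  rw [closedForm, ENNReal.mul_iInf_of_ne hc hc', iInf_lt_iff] at h
  obtain ⟨ξ, h⟩ := h
  rw [ENNReal.mul_iInf_of_ne hc hc', iInf_lt_iff] at h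
  obtain ⟨h1, h2⟩ := h
  exact ⟨ξ, h1, h2⟩

theorem enorm_sq_eq {E : Type*} [SeminormedAddCommGroup E] (x : E) :
    ‖x‖ₑ ^ 2 = ENNReal.ofReal (‖x‖ ^ 2) := by
  rw [← ofReal_norm, ENNReal.ofReal_pow (norm_nonneg _)]

/-- The lifted gradients of low energy are bounded by √b, so they have a weak limit. The particle
integration by parts passes to the limit because divergences and fields converge strongly while
functions and gradients converge weakly. -/
theorem moscoI_weakGraph (hβ : 0 < β) {u : ∀ n, Lp ℝ 2 (particleMeasure β n)} {v : Lp ℝ 2 Q}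
    (hu : WeaklyConverges (condExpMap hQ) u v) {b : ℝ≥0∞} (hb : b ≠ ⊤)
    (h : ∃ᶠ n in atTop, ((n + 1 : ℕ) : ℝ≥0∞) * particleForm β n (u n) < b) :
    ∃ ξ, (v, ξ) ∈ weakGraph hQ ∧ ‖ξ‖ₑ ^ 2 ≤ b := by
  have := hQ.isProbabilityMeasure
  have hp := hQ.isProbabilityMeasure_particle
  have hex : ∀ n, ∃ (ξ : Lp (EuclideanSpace ℝ (Fin n)) 2 (particleMeasure β n))
      (η : Lp ℝ 2 (Q.prod lebesgueIco)), (η =ᵐ[Q.prod lebesgueIco] fun z =>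
        (n + 1) * extendZero (ξ (gridEval n z.1)) (cellIdx n z.2)) ∧
      (((n + 1 : ℕ) : ℝ≥0∞) * particleForm β n (u n) < b →
        (u n, ξ) ∈ closure (particleGradient β n) ∧ ‖η‖ ≤ √b.toReal) := by
    intro n
    by_cases hn : ((n + 1 : ℕ) : ℝ≥0∞) * particleForm β n (u n) < b
    · obtain ⟨ξ, h1, h2⟩ := exists_of_mul_closedForm_lt (by simp) (ENNReal.natCast_ne_top _) hn
      obtain ⟨η, h3, h4⟩ := exists_liftField hQ ξ
      refine ⟨ξ, η, h3, fun _ => ⟨h1, Real.le_sqrt_of_sq_le ?_⟩⟩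
      rw [h4]
      rw [enorm_sq_eq, ← ENNReal.ofReal_natCast, ← ENNReal.ofReal_mul (by positivity)] at h2
      have := (ENNReal.ofReal_lt_iff_lt_toReal (by positivity) hb).1 h2
      push_cast at this
      exact this.le
    · obtain ⟨η, h3, -⟩ := exists_liftField hQ (0 : Lp (EuclideanSpace ℝ (Fin n)) 2 _)
      exact ⟨0, η, h3, fun h => absurd h hn⟩
  choose ξ η hη hξ using hex
  set s : Set ℕ := {n | ((n + 1 : ℕ) : ℝ≥0∞) * particleForm β n (u n) < b} with hs
  have hne : NeBot (atTop ⊓ 𝓟 s) := frequently_mem_iff_neBot.1 h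
  -- An ultrafilter at infinity containing s plays the role of a subsequence, so a bound for
  -- infinitely many n is enough.
  let F : Ultrafilter ℕ := Ultrafilter.of (atTop ⊓ 𝓟 s)
  have hF : (F : Filter ℕ) ≤ atTop := (Ultrafilter.of_le _).trans inf_le_left
  have hFs : ∀ᶠ n in (F : Filter ℕ), n ∈ s :=
    (Ultrafilter.of_le _).trans inf_le_right (mem_principal_self s)
  obtain ⟨a, ha, hlim⟩ := exists_weak_limit F η (√b.toReal) (hFs.mono fun n hn => (hξ n hn).2)
  refine ⟨a, ?_, ?_⟩
  · rintro ⟨δ, ζ⟩ ⟨φ, w, dw, V, hφ, hw, hV, hδ, hζ⟩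
    simp only at hδ hζ ⊢
    obtain ⟨d, hd, hdlim⟩ := hw.exists_tendsto_div hφ hV hδ
    obtain ⟨z, hz, hzlim⟩ := exists_tendsto_field hφ hw hζ
    have h1 : Tendsto (fun n => inner ℝ (u n) (d n)) F (𝓝 (inner ℝ v δ)) :=
      (hu d δ (stronglyConverges_of_tendsto (liftMap hQ) hdlim)).mono_left hF
    have h2 : Tendsto (fun n => inner ℝ (η n) (z n)) F (𝓝 (inner ℝ a ζ)) := by
      have e1 : Tendsto (fun n => inner ℝ (η n) (z n - ζ)) F (𝓝 (0 : ℝ)) := by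
        have e2 : Tendsto (fun n => √b.toReal * ‖z n - ζ‖) F (𝓝 0) := by
          have := (tendsto_iff_norm_sub_tendsto_zero.1 hzlim).const_mul √b.toReal
          rw [mul_zero] at this
          exact this.mono_left hF
        refine squeeze_zero_norm' (hFs.mono fun n hn => ?_) e2
        exact (norm_inner_le_norm _ _).trans
          (mul_le_mul_of_nonneg_right (hξ n hn).2 (norm_nonneg _))
      have e3 := e1.add (hlim ζ)
      simpa only [inner_sub_right, sub_add_cancel, zero_add] using e3
    have h3 : ∀ᶠ n in (F : Filter ℕ), inner ℝ (u n) (d n) = -inner ℝ (η n) (z n) := by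
      refine hFs.mono fun n hn => ?_
      obtain ⟨C, hC⟩ := hw.bounded hφ.toBddC2
      obtain ⟨D, -, hD⟩ := hφ.bound
      have hym : MemLp (fun x : Fin n → ℝ => WithLp.toLp 2 fun i => w (step n x) * φ (x i)) 2
          (particleMeasure β n) := by
        refine MemLp.of_eval_piLp fun i => ?_
        refine MemLp.of_bound ((hw.measurable_step hφ n).1.mul
          (hφ.continuous.measurable.comp (measurable_pi_apply i))).aestronglyMeasurable (C * D)
          (Eventually.of_forall fun x => ?_)
        rw [norm_mul]
        exact mul_le_mul (hC _).1 (hD _).1 (abs_nonneg _) ((abs_nonneg _).trans (hC (step n x)).1)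
      rw [inner_liftField hQ hym.coeFn_toLp (hη n) (hz n)]
      exact inner_particleGradient hQ hβ hφ hw (hd n) hym.coeFn_toLp (hξ n hn).1
    exact tendsto_nhds_unique (h1.congr' h3) h2.neg
  · rw [enorm_sq_eq]
    refine ENNReal.ofReal_le_of_le_toReal ?_
    calc ‖a‖ ^ 2 ≤ (√b.toReal) ^ 2 := by gcongr
      _ = b.toReal := Real.sq_sqrt ENNReal.toReal_nonneg

theorem moscoI (hβ : 0 < β) (hM : IsMarkovUnique Q) :
    MoscoI (condExpMap hQ) (fun n u => ((n + 1 : ℕ) : ℝ≥0∞) * particleForm β n u)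
      (wassersteinForm Q) := by
  intro u v huv
  by_contra hlt
  obtain ⟨b, hb1, hb2⟩ := exists_between (not_le.1 hlt)
  obtain ⟨ξ, hξ, hle⟩ := moscoI_weakGraph hQ hβ huv (hb2.trans_le le_top).ne
    (frequently_lt_of_liminf_lt (by isBoundedDefault) hb1)
  exact absurd ((wassersteinForm_le hβ hM hξ).trans hle) (not_le.2 hb2)

end Lower

/-! ### Smooth approximation and restriction of cylinder functions to the particle spaces -/

section Smooth

open scoped Convolution

/-- Mollification. It is needed because cylinder functions have only C¹ profiles, whereas the core
of the particle forms consists of smooth functions. -/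
theorem exists_smooth_approx {E : Type} [NormedAddCommGroup E] [NormedSpace ℝ E]
    [FiniteDimensional ℝ E] {U : E → ℝ} (hU : ContDiff ℝ 1 U) (hUc : HasCompactSupport U) :
    ∃ (V : ℕ → E → ℝ) (C : ℝ), (∀ k, ContDiff ℝ ∞ (V k)) ∧
      (∀ k y, |V k y| ≤ C ∧ ‖fderiv ℝ (V k) y‖ ≤ C) ∧
      ∀ y, Tendsto (fun k => V k y) atTop (𝓝 (U y)) ∧
        Tendsto (fun k => fderiv ℝ (V k) y) atTop (𝓝 (fderiv ℝ U y)) := by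
  borelize E
  let μ : Measure E := MeasureTheory.Measure.addHaar
  let f : ℕ → ContDiffBump (0 : E) := fun k =>
    ⟨1 / (k + 2), 1 / (k + 1), by positivity, by gcongr; norm_num⟩
  have hrout : Tendsto (fun k => (f k).rOut) atTop (𝓝 0) := tendsto_one_div_add_atTop_nhds_zero_nat
  have hdc : Continuous (fderiv ℝ U) := hU.continuous_fderiv (by norm_num)
  obtain ⟨A, hA⟩ := hUc.exists_bound_of_continuous hU.continuous
  obtain ⟨B, hB⟩ := (hUc.fderiv ℝ).exists_bound_of_continuous hdc
  let V : ℕ → E → ℝ := fun k =>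
    convolution ((f k).normed μ) U (ContinuousLinearMap.lsmul ℝ ℝ) μ
  have hfd : ∀ k y, fderiv ℝ (V k) y =
      convolution ((f k).normed μ) (fderiv ℝ U) (ContinuousLinearMap.lsmul ℝ ℝ) μ y := by
    intro k y
    have h := (hUc.hasFDerivAt_convolution_right (ContinuousLinearMap.lsmul ℝ ℝ) (μ := μ)
      ((f k).continuous_normed (μ := μ)).locallyIntegrable hU y).fderiv
    exact h
  -- A mollified function differs from g by at most 2D, whence the constant 3D; it is used for U and
  -- for its derivative.
  have hbd : ∀ {F : Type} [NormedAddCommGroup F] [NormedSpace ℝ F] [CompleteSpace F] (g : E → F)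
      (D : ℝ), Continuous g → (∀ x, ‖g x‖ ≤ D) → ∀ k y,
      ‖convolution ((f k).normed μ) g (ContinuousLinearMap.lsmul ℝ ℝ) μ y‖ ≤ 3 * D := by
    intro F _ _ _ g D hg hD k y
    have h1 := ContDiffBump.dist_normed_convolution_le (φ := f k) (μ := μ) (g := g) (x₀ := y)
      (ε := 2 * D) hg.aestronglyMeasurable fun x _ => by
        rw [dist_eq_norm]
        linarith [norm_sub_le (g x) (g y), hD x, hD y]
    rw [dist_eq_norm] at h1
    have h2 := norm_add_le (convolution ((f k).normed μ) g (ContinuousLinearMap.lsmul ℝ ℝ) μ y - g y)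
      (g y)
    rw [sub_add_cancel] at h2
    linarith [hD y]
  refine ⟨V, max (3 * A) (3 * B), fun k => ?_, fun k y => ⟨?_, ?_⟩, fun y => ⟨?_, ?_⟩⟩
  · exact (f k).hasCompactSupport_normed.contDiff_convolution_left _ (f k).contDiff_normed
      hU.continuous.locallyIntegrable
  · exact (hbd U A hU.continuous hA k y).trans (le_max_left _ _)
  · rw [hfd]
    exact (hbd _ B hdc hB k y).trans (le_max_right _ _)
  · exact ContDiffBump.convolution_tendsto_right_of_continuous hrout hU.continuous y
  · simp only [hfd]
    exact ContDiffBump.convolution_tendsto_right_of_continuous hrout hdc y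

end Smooth

/-! ### C¹ compositions in the closed particle gradients, and Jensen's inequality on cells -/

section Restrict

variable {β : ℝ} {Q : Measure QuantileFn} {n : ℕ}

theorem L2_norm_sq' {Ω E : Type*} [MeasurableSpace Ω] {μ : Measure Ω} [NormedAddCommGroup E]
    [InnerProductSpace ℝ E] (f : Lp E 2 μ) : ‖f‖ ^ 2 = ∫ x, ‖f x‖ ^ 2 ∂μ := by
  rw [← real_inner_self_eq_norm_sq, L2.inner_def]
  simp only [real_inner_self_eq_norm_sq]

theorem L2_tendsto_coord {Ω : Type*} [MeasurableSpace Ω] {μ : Measure Ω} [IsFiniteMeasure μ]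
    {f : ℕ → Lp (EuclideanSpace ℝ (Fin n)) 2 μ} {g : Lp (EuclideanSpace ℝ (Fin n)) 2 μ} {C : ℝ}
    (hb : ∀ k, ∀ᵐ x ∂μ, ∀ i, |f k x i| ≤ C)
    (hl : ∀ᵐ x ∂μ, ∀ i, Tendsto (fun k => f k x i) atTop (𝓝 (g x i))) :
    Tendsto f atTop (𝓝 g) := by
  have h1 : ∀ k, ‖f k - g‖ ^ 2 = ∑ i, ∫ x, (f k x i - g x i) ^ 2 ∂μ := by
    intro k
    have hi : ∀ i, Integrable (fun x => (f k x i - g x i) ^ 2) μ := fun i =>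
      ((memLp_coord (Lp.memLp (f k)) i).sub (memLp_coord (Lp.memLp g) i)).integrable_sq
    rw [L2_norm_sq', ← integral_finsetSum _ fun i _ => hi i]
    refine integral_congr_ae ((Lp.coeFn_sub (f k) g).mono fun x hx => ?_)
    beta_reduce
    rw [hx, EuclideanSpace.norm_sq_eq]
    simp
  have h2 : Tendsto (fun k => ‖f k - g‖ ^ 2) atTop (𝓝 0) := by
    simp only [h1]
    suffices h : ∀ i, Tendsto (fun k => ∫ x, (f k x i - g x i) ^ 2 ∂μ) atTop (𝓝 0) by
      simpa using tendsto_finsetSum Finset.univ fun i _ => h i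
    intro i
    have h3 := tendsto_integral_of_dominated_convergence (μ := μ)
      (F := fun k x => (f k x i - g x i) ^ 2) (f := fun _ => (0 : ℝ)) (fun _ => (2 * C) ^ 2)
      (fun k => ((memLp_coord (Lp.memLp (f k)) i).1.sub (memLp_coord (Lp.memLp g) i).1).pow 2)
      (integrable_const _) (fun k => ?_) ?_
    · simpa using h3
    · filter_upwards [ae_all_iff.2 hb, hl] with x a1 a2
      have a3 : |g x i| ≤ C := le_of_tendsto (a2 i).abs (Eventually.of_forall fun k => a1 k i)
      have a4 : |f k x i - g x i| ≤ 2 * C := by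
        refine (abs_sub _ _).trans ?_
        linarith [a1 k i]
      rw [Real.norm_eq_abs, abs_of_nonneg (sq_nonneg _), ← sq_abs]
      gcongr
    · filter_upwards [hl] with x a2
      have := ((a2 i).sub_const (g x i)).pow 2
      simpa using this
  rw [tendsto_iff_norm_sub_tendsto_zero]
  have h3 := (Real.continuous_sqrt.tendsto 0).comp h2
  simpa [Function.comp_def, Real.sqrt_sq (norm_nonneg _)] using h3

theorem memLp_particle [IsFiniteMeasure (particleMeasure β n)] {f : (Fin n → ℝ) → ℝ}
    (hf : Continuous f) : MemLp f 2 (particleMeasure β n) := by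
  obtain ⟨B, hB⟩ := (isCompact_orderedSimplex n).exists_bound_of_continuousOn hf.continuousOn
  exact MemLp.of_bound hf.aestronglyMeasurable B (ae_mem_particleMeasure.mono fun x hx => hB x hx.1)

theorem memLp_particle_gradient [IsFiniteMeasure (particleMeasure β n)] {f : (Fin n → ℝ) → ℝ}
    (hf : ContDiff ℝ 1 f) : MemLp (fun x => (WithLp.toLp 2 fun i =>
      fderiv ℝ f x (Pi.single i 1) : EuclideanSpace ℝ (Fin n))) 2 (particleMeasure β n) :=
  MemLp.of_eval_piLp fun i =>
    memLp_particle ((hf.continuous_fderiv (by norm_num)).clm_apply continuous_const)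

/-- Replace U by its mollifications: functions and gradients converge boundedly on the compact
simplex. -/
theorem mem_closure_particleGradient [IsFiniteMeasure (particleMeasure β n)] {m : ℕ}
    {Y : (Fin n → ℝ) → Fin m → ℝ} (hY : ContDiff ℝ ∞ Y) {U : (Fin m → ℝ) → ℝ}
    (hU : ContDiff ℝ 1 U) (hUc : HasCompactSupport U) {u : Lp ℝ 2 (particleMeasure β n)}
    {ξ : Lp (EuclideanSpace ℝ (Fin n)) 2 (particleMeasure β n)}
    (hu : u =ᵐ[particleMeasure β n] fun x => U (Y x))
    (hξ : ξ =ᵐ[particleMeasure β n] fun x => WithLp.toLp 2 fun i =>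
      fderiv ℝ (fun x => U (Y x)) x (Pi.single i 1)) :
    (u, ξ) ∈ closure (particleGradient β n) := by
  obtain ⟨V, C, hV, hVb, hVl⟩ := exists_smooth_approx hU hUc
  have hVY : ∀ k, ContDiff ℝ ∞ fun x => V k (Y x) := fun k => (hV k).comp hY
  have hder : ∀ {W : (Fin m → ℝ) → ℝ}, ContDiff ℝ 1 W → ∀ x v, fderiv ℝ (fun x => W (Y x)) x v =
      fderiv ℝ W (Y x) (fderiv ℝ Y x v) := by
    intro W hW x v
    have h := (hW.differentiable (by norm_num) (Y x)).hasFDerivAt.comp x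
      (hY.differentiable (by norm_num) x).hasFDerivAt
    rw [show fderiv ℝ (fun x => W (Y x)) x = _ from h.fderiv]
    rfl
  have hV1 : ∀ k, ContDiff ℝ 1 (V k) := fun k => contDiff_infty.1 (hV k) 1
  have h1 := fun k => memLp_particle (β := β) (hVY k).continuous
  have h2 := fun k => memLp_particle_gradient (β := β) (contDiff_infty.1 (hVY k) 1)
  have hYd : ∀ i : Fin n, Continuous fun x => fderiv ℝ Y x (Pi.single i 1) := fun i =>
    (hY.continuous_fderiv (by norm_num)).clm_apply continuous_const
  have hD : ∃ D, ∀ x ∈ orderedSimplex n, ∀ i, ‖fderiv ℝ Y x (Pi.single i 1)‖ ≤ D := by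
    obtain ⟨D, hD⟩ := (isCompact_orderedSimplex n).exists_bound_of_continuousOn
      (continuous_pi hYd).continuousOn
    exact ⟨D, fun x hx i => (norm_le_pi_norm (fun i => fderiv ℝ Y x (Pi.single i 1)) i).trans
      (hD x hx)⟩
  obtain ⟨D, hD⟩ := hD
  refine mem_closure_of_tendsto (b := (atTop : Filter ℕ))
    (f := fun k => ((h1 k).toLp _, (h2 k).toLp _)) (Tendsto.prodMk_nhds ?_ ?_)
    (Eventually.of_forall fun k => ⟨_, hVY k, (h1 k).coeFn_toLp, (h2 k).coeFn_toLp⟩)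
  · refine L2_tendsto_of_bounded C (fun k => ?_) ?_
    · filter_upwards [(h1 k).coeFn_toLp] with x hx
      rw [hx]
      exact (hVb k _).1
    · filter_upwards [ae_all_iff.2 fun k => (h1 k).coeFn_toLp, hu] with x a1 a2
      rw [a2]
      exact (hVl _).1.congr fun k => (a1 k).symm
  · refine L2_tendsto_coord (C := C * D) (fun k => ?_) ?_
    · filter_upwards [(h2 k).coeFn_toLp, ae_mem_particleMeasure (β := β)] with x hx hxs i
      rw [hx]
      simp only [hder (hV1 k)]
      exact ((fderiv ℝ (V k) (Y x)).le_opNorm _).trans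
        (mul_le_mul (hVb k _).2 (hD x hxs.1 i) (norm_nonneg _)
          ((norm_nonneg _).trans (hVb k (Y x)).2))
    · filter_upwards [ae_all_iff.2 fun k => (h2 k).coeFn_toLp, hξ] with x a1 a2 i
      rw [a2]
      simp only [hder hU]
      refine Tendsto.congr (fun k => ?_) (((ContinuousLinearMap.apply ℝ ℝ
        (fderiv ℝ Y x (Pi.single i 1))).continuous.tendsto _).comp (hVl (Y x)).2)
      rw [a1 k]
      simp only [hder (hV1 k)]
      rfl

/-- Jensen's inequality on the cells of the grid. -/
theorem sum_sq_integral_cell_le (F : Lp ℝ 2 lebesgueIco) :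
    (n + 1 : ℝ) * ∑ i : Fin n, (∫ t in cell n i.castSucc, F t ∂lebesgueIco) ^ 2 ≤ ‖F‖ ^ 2 := by
  have hF := Lp.memLp F
  have hcell : ∀ j : Fin (n + 1), (n + 1 : ℝ) * (∫ t in cell n j, F t ∂lebesgueIco) ^ 2 ≤
      ∫ t in cell n j, F t ^ 2 ∂lebesgueIco := by
    intro j
    set I := ∫ t in cell n j, F t ∂lebesgueIco
    have hi : Integrable (fun t => F t) (lebesgueIco.restrict (cell n j)) :=
      (integrable_Lp F).integrableOn
    have hi2 : Integrable (fun t => F t ^ 2) (lebesgueIco.restrict (cell n j)) :=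
      hF.integrable_sq.integrableOn
    have hi3 : Integrable (fun t => F t ^ 2 - 2 * ((n + 1) * I) * F t)
        (lebesgueIco.restrict (cell n j)) := hi2.sub (hi.const_mul _)
    -- (n + 1) I is the mean of F over the cell, which has mass 1/(n + 1).
    have h : 0 ≤ ∫ t in cell n j, (F t - (n + 1) * I) ^ 2 ∂lebesgueIco :=
      integral_nonneg fun _ => sq_nonneg _
    have e : ∀ t, (F t - (n + 1) * I) ^ 2 =
        F t ^ 2 - 2 * ((n + 1) * I) * F t + ((n + 1) * I) ^ 2 := fun t => by ring
    simp only [e] at h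
    rw [integral_add hi3 (integrable_const _), integral_sub hi2 (hi.const_mul _),
      integral_const_mul, setIntegral_const, lebesgueIco_cell] at h
    have hn : (n + 1 : ℝ) ≠ 0 := by positivity
    have e2 : (1 / (n + 1 : ℝ)) • ((n + 1) * I) ^ 2 = (n + 1) * I ^ 2 := by
      rw [smul_eq_mul]; field_simp
    rw [e2] at h
    linarith
  have hsum : ‖F‖ ^ 2 = ∑ j : Fin (n + 1), ∫ t in cell n j, F t ^ 2 ∂lebesgueIco := by
    rw [L2_norm_sq]
    have e : ∀ t, F t ^ 2 = ∑ j : Fin (n + 1), (cell n j).indicator (fun t => F t ^ 2) t := by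
      intro t
      have h1 := eq_sum_cell (n := n) (fun _ => F t ^ 2) t
      refine h1.trans (Finset.sum_congr rfl fun j _ => ?_)
      by_cases ht : t ∈ cell n j
      · rw [indicator_of_mem ht, indicator_of_mem ht, one_mul]
      · rw [indicator_of_notMem ht, indicator_of_notMem ht, zero_mul]
    rw [integral_congr_ae (Eventually.of_forall e), integral_finsetSum _ fun j _ =>
      hF.integrable_sq.indicator (measurableSet_cell j)]
    exact Finset.sum_congr rfl fun j _ => integral_indicator (measurableSet_cell j)
  rw [hsum, Fin.sum_univ_castSucc, Finset.mul_sum]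
  refine (Finset.sum_le_sum fun i _ => hcell i.castSucc).trans (le_add_of_nonneg_right ?_)
  exact integral_nonneg fun _ => sq_nonneg _

end Restrict

/-! ### Recovery sequences -/

theorem closedForm_le {H T : Type*} [NormedAddCommGroup H] [NormedAddCommGroup T]
    {S : Set (H × T)} {u : H} {ξ : T} (h : (u, ξ) ∈ closure S) : closedForm S u ≤ ‖ξ‖ₑ ^ 2 :=
  iInf₂_le (f := fun (ξ : T) (_ : (u, ξ) ∈ closure S) => ‖ξ‖ₑ ^ 2) ξ h

theorem exists_near_of_closedForm_lt {H T : Type*} [NormedAddCommGroup H] [NormedAddCommGroup T]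
    {S : Set (H × T)} {u : H} {b : ℝ≥0∞} (h : closedForm S u < b) {ε : ℝ} (hε : 0 < ε) :
    ∃ p ∈ S, ‖p.1 - u‖ < ε ∧ ‖p.2‖ₑ ^ 2 < b := by
  obtain ⟨ξ, hξ⟩ := iInf_lt_iff.1 h
  obtain ⟨hξ1, hξ2⟩ := iInf_lt_iff.1 hξ
  obtain ⟨q, hq, hqlim⟩ := mem_closure_iff_seq_limit.1 hξ1
  have l1 : Tendsto (fun j => ‖(q j).1 - u‖) atTop (𝓝 0) :=
    tendsto_iff_norm_sub_tendsto_zero.1 ((continuous_fst.tendsto _).comp hqlim)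
  have l2 : Tendsto (fun j => ‖(q j).2‖ₑ ^ 2) atTop (𝓝 (‖ξ‖ₑ ^ 2)) :=
    ((ENNReal.continuous_pow 2).tendsto _).comp
      (((continuous_enorm.comp continuous_snd).tendsto (u, ξ)).comp hqlim)
  obtain ⟨j, hj1, hj2⟩ := ((l1.eventually_lt_const hε).and (l2.eventually_lt_const hξ2)).exists
  exact ⟨q j, hq j, hj1, hj2⟩

section Recovery

variable {β : ℝ} {Q : Measure QuantileFn} (hQ : IsDirichletLaw β Q) {n m : ℕ}

/-- Moving x_i changes the step function only on the cell ending at the i-th grid time, so the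
partial derivative integrates the gradient over that cell. The simplex keeps the values in [0, 1],
where `truncId` has slope 1. -/
theorem fderiv_pairing_step (f : Fin m → Lp ℝ 2 lebesgueIco) {U : (Fin m → ℝ) → ℝ}
    (hU : ContDiff ℝ 1 U) {x : Fin n → ℝ} (hx : x ∈ orderedSimplex n) (i : Fin n) :
    fderiv ℝ (fun x => U fun j => comp (f j) truncId (step n x)) x (Pi.single i 1) =
      ∫ t in cell n i.castSucc, (∑ j, fderiv ℝ U (fun j => comp (f j) truncId (step n x))
        (Pi.single j 1) • f j : Lp ℝ 2 lebesgueIco) t ∂lebesgueIco := by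
  set y : Fin m → ℝ := fun j => comp (f j) truncId (step n x)
  have h1 := hasFDerivAt_pi.2 fun j =>
    hasFDerivAt_comp_step (n := n) (integrable_Lp (f j)) truncId_bddC2.differentiable x
  have h2 := (hU.differentiable (by norm_num) y).hasFDerivAt.comp x h1
  rw [show fderiv ℝ (fun x => U fun j => comp (f j) truncId (step n x)) x = _ from h2.fderiv,
    ContinuousLinearMap.comp_apply, clm_apply_eq_sum (fderiv ℝ U _)]
  have h3 : (∑ j, fderiv ℝ U y (Pi.single j 1) • f j : Lp ℝ 2 lebesgueIco) =ᵐ[lebesgueIco]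
      fun t => ∑ j, fderiv ℝ U y (Pi.single j 1) * f j t := by
    filter_upwards [Lp.coeFn_finsetSum Finset.univ fun j => fderiv ℝ U y (Pi.single j 1) • f j,
      ae_all_iff.2 fun j => Lp.coeFn_smul (fderiv ℝ U y (Pi.single j 1)) (f j)] with t a1 a2
    rw [a1, Finset.sum_apply]
    refine Finset.sum_congr rfl fun j _ => ?_
    rw [a2, Pi.smul_apply, smul_eq_mul]
  rw [integral_congr_ae (ae_restrict_of_ae h3),
    integral_finsetSum _ fun j _ => ((integrable_Lp (f j)).integrableOn).const_mul _]
  refine Finset.sum_congr rfl fun j _ => ?_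
  rw [integral_const_mul, mul_comm]
  congr 1
  rw [ContinuousLinearMap.pi_apply, sum_apply, Finset.sum_eq_single i.castSucc]
  · rw [smul_apply, smul_apply, endsLin_mid, deriv_truncId (withEnds_mem_Icc hx _)]
    simp
  · intro k _ hk
    rw [smul_apply, smul_apply]
    revert hk
    refine Fin.lastCases (fun _ => ?_) (fun l hl => ?_) k
    · rw [endsLin_last]; simp
    · rw [endsLin_mid, Pi.single_eq_of_ne fun h => hl (by rw [h])]; simp
  · simp

theorem norm_sq_cylinder [IsProbabilityMeasure Q] (f : Fin m → Lp ℝ 2 lebesgueIco)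
    (U : (Fin m → ℝ) → ℝ) {ξ : Lp ℝ 2 (Q.prod lebesgueIco)}
    (hξ : ξ =ᵐ[Q.prod lebesgueIco] fun z =>
      ∑ i, fderiv ℝ U (fun j => pairing (f j) z.1) (Pi.single i 1) * f i z.2) :
    ‖ξ‖ ^ 2 = ∫ g, ‖∑ i, fderiv ℝ U (fun j => pairing (f j) g) (Pi.single i 1) • f i‖ ^ 2 ∂Q := by
  have hi : Integrable (fun z => ξ z ^ 2) (Q.prod lebesgueIco) := (Lp.memLp ξ).integrable_sq
  rw [L2_norm_sq, integral_prod _ hi]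
  refine integral_congr_ae ?_
  filter_upwards [Measure.ae_ae_of_ae_prod hξ] with g hg
  rw [L2_norm_sq]
  refine integral_congr_ae ?_
  filter_upwards [hg, Lp.coeFn_finsetSum Finset.univ fun j =>
      fderiv ℝ U (fun j => pairing (f j) g) (Pi.single j 1) • f j,
    ae_all_iff.2 fun j => Lp.coeFn_smul
      (fderiv ℝ U (fun j => pairing (f j) g) (Pi.single j 1)) (f j)] with t a0 a1 a2
  rw [a0, a1, Finset.sum_apply]
  congr 1
  refine Finset.sum_congr rfl fun j _ => ?_
  rw [a2, Pi.smul_apply, smul_eq_mul]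

/-- The cylinder function is evaluated at step functions. By `fderiv_pairing_step` and Jensen's
inequality, N times its squared particle gradient is at most H(Y), the squared gradient norm at the
step function; the average of this tends to the energy. -/
theorem exists_recovery_cylinder {p : Lp ℝ 2 Q × Lp ℝ 2 (Q.prod lebesgueIco)}
    (hp : p ∈ cylinderGradient Q) : ∃ (v : ∀ n, Lp ℝ 2 (particleMeasure β n)) (c : ℕ → ℝ),
      Tendsto (fun n => liftMap hQ n (v n)) atTop (𝓝 p.1) ∧ Tendsto c atTop (𝓝 (‖p.2‖ ^ 2)) ∧
      ∀ n, ((n + 1 : ℕ) : ℝ≥0∞) * particleForm β n (v n) ≤ ENNReal.ofReal (c n) := by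
  have := hQ.isProbabilityMeasure
  have hpm := hQ.isProbabilityMeasure_particle
  obtain ⟨m, U, f, hU, hUc, hu, hξ⟩ := hp
  set Y : (UnitIco → ℝ) → Fin m → ℝ := fun h j => comp (f j) truncId h with hYdef
  set H : (Fin m → ℝ) → ℝ := fun y => ‖∑ j, fderiv ℝ U y (Pi.single j 1) • f j‖ ^ 2 with hHdef
  have hYg : ∀ g : QuantileFn, Y g.1 = fun j => pairing (f j) g := fun g =>
    funext fun j => comp_truncId_eq_pairing (f j) g
  have ht : IsTest (fun _ => 0) (fun h => U (Y h)) _ :=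
    ⟨Fin m, inferInstance, U, fun j => f j, fun _ => truncId, hU, fun j => integrable_Lp (f j),
      fun _ => truncId_bddC2, fun _ => rfl, fun _ => rfl⟩
  obtain ⟨v, hv, hvlim⟩ := ht.exists_tendsto_lift hQ vecField_zero.toBddC2 (u := p.1)
    (by simpa only [hYg] using hu)
  have hYs : ∀ n, ContDiff ℝ ∞ fun x : Fin n → ℝ => Y (step n x) := fun n =>
    contDiff_pi.2 fun j => contDiff_comp_step (integrable_Lp (f j)) contDiff_truncId
  have hdU : ∀ j : Fin m, Continuous fun y => fderiv ℝ U y (Pi.single j 1) := fun j =>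
    (hU.continuous_fderiv (by norm_num)).clm_apply continuous_const
  have hHc : Continuous H :=
    (continuous_finsetSum _ fun j _ => (hdU j).smul continuous_const).norm.pow 2
  have hHb : ∃ D, ∀ y, ‖H y‖ ≤ D := by
    have hB : ∀ j : Fin m, ∃ B, ∀ y, ‖fderiv ℝ U y (Pi.single j 1)‖ ≤ B := fun j =>
      (hUc.fderiv_apply ℝ (Pi.single j 1)).exists_bound_of_continuous (hdU j)
    choose B hB using hB
    refine ⟨(∑ j, B j * ‖f j‖) ^ 2, fun y => ?_⟩
    rw [Real.norm_eq_abs, abs_of_nonneg (sq_nonneg _)]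
    refine pow_le_pow_left₀ (norm_nonneg _) (norm_sum_le_of_le _ fun j _ => ?_) 2
    rw [norm_smul]
    exact mul_le_mul_of_nonneg_right (hB j y) (norm_nonneg _)
  obtain ⟨D, hD⟩ := hHb
  have hHm : ∀ n, Continuous fun x : Fin n → ℝ => H (Y (step n x)) := fun n =>
    hHc.comp (hYs n).continuous
  refine ⟨v, fun n => ∫ g, H (Y (step n (gridEval n g))) ∂Q, hvlim, ?_, fun n => ?_⟩
  · rw [norm_sq_cylinder f U hξ]
    simp only [← hYg]
    refine tendsto_integral_of_dominated_convergence (fun _ => D) (fun n =>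
      ((hHm n).measurable.comp (measurable_gridEval n)).aestronglyMeasurable)
      (integrable_const _) (fun n => Eventually.of_forall fun g => hD _)
      (Eventually.of_forall fun g => (hHc.tendsto _).comp (tendsto_pi_nhds.2 fun j => ?_))
    exact ((isTest_comp (fun _ => 0) (integrable_Lp (f j)) truncId_bddC2).tendsto
      vecField_zero.toBddC2 (fun n => measurable_step _) (tendsto_step_gridEval g)).1
  · have hC1 : ContDiff ℝ 1 fun x : Fin n → ℝ => U (Y (step n x)) := ht.contDiff_step n
    have hm := memLp_particle_gradient (β := β) hC1
    have hcl := mem_closure_particleGradient (hYs n) hU hUc (hv n) hm.coeFn_toLp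
    have hle : particleForm β n (v n) ≤ ‖hm.toLp _‖ₑ ^ 2 := closedForm_le hcl
    refine (mul_le_mul_right hle _).trans ?_
    rw [enorm_sq_eq, ← ENNReal.ofReal_natCast, ← ENNReal.ofReal_mul (by positivity)]
    refine ENNReal.ofReal_le_ofReal ?_
    have hint : Integrable (fun x => ‖hm.toLp _ x‖ ^ 2) (particleMeasure β n) :=
      (memLp_two_iff_integrable_sq_norm (Lp.aestronglyMeasurable _)).1 (Lp.memLp _)
    beta_reduce
    rw [integral_gridEval hQ n (hHm n).aestronglyMeasurable, L2_norm_sq', ← integral_const_mul]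
    refine integral_mono_ae (hint.const_mul _) (Integrable.of_bound
      (hHm n).aestronglyMeasurable D (Eventually.of_forall fun x => hD _)) ?_
    filter_upwards [hm.coeFn_toLp, ae_mem_particleMeasure (β := β)] with x hx hxs
    rw [hx, EuclideanSpace.norm_sq_eq]
    have h1 := sum_sq_integral_cell_le (n := n)
      (∑ j, fderiv ℝ U (Y (step n x)) (Pi.single j 1) • f j)
    refine le_trans (le_of_eq ?_) h1
    rw [Nat.cast_add_one]
    congr 1
    refine Finset.sum_congr rfl fun i _ => ?_
    rw [Real.norm_eq_abs, sq_abs]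
    exact congrArg (· ^ 2) (fderiv_pairing_step f hU hxs.1 i)

/-- Cylinder functions near v with almost minimal energy have recovery sequences, and a diagonal
choice combines them. Where the form is infinite, the conditional expectations suffice. -/
theorem exists_recovery (v : Lp ℝ 2 Q) : ∃ u : ∀ n, Lp ℝ 2 (particleMeasure β n),
    Tendsto (fun n => liftMap hQ n (u n)) atTop (𝓝 v) ∧
    limsup (fun n => ((n + 1 : ℕ) : ℝ≥0∞) * particleForm β n (u n)) atTop ≤ wassersteinForm Q v := by
  rcases eq_or_ne (wassersteinForm Q v) ⊤ with htop | htop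
  · exact ⟨fun n => condExpMap hQ n v, tendsto_condExp hQ v, by rw [htop]; exact le_top⟩
  have hε : ∀ k : ℕ, (0 : ℝ) < 1 / (k + 1) := fun k => by positivity
  have hε' : ∀ k : ℕ, (0 : ℝ≥0∞) < ENNReal.ofReal (1 / (k + 1)) := fun k =>
    ENNReal.ofReal_pos.2 (hε k)
  obtain ⟨u, hu⟩ := exists_diagonal (K := fun n => Lp ℝ 2 (particleMeasure β n))
    (fun k n x => ‖liftMap hQ n x - v‖ < 1 / ((k : ℝ) + 1) ∧
      ((n + 1 : ℕ) : ℝ≥0∞) * particleForm β n x < wassersteinForm Q v + ENNReal.ofReal (1 / (k + 1)))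
    (fun k l hkl n x hx => by
      have h1 : 1 / ((l : ℝ) + 1) ≤ 1 / ((k : ℝ) + 1) := by gcongr
      exact ⟨hx.1.trans_le h1, hx.2.trans_le (by gcongr)⟩) fun k => by
    have h1 : wassersteinForm Q v < wassersteinForm Q v + ENNReal.ofReal (1 / (k + 1)) :=
      ENNReal.lt_add_right htop (hε' k).ne'
    obtain ⟨q, hq, hj1, hj2⟩ := exists_near_of_closedForm_lt h1 (hε k)
    obtain ⟨x, c, hx, hc, hle⟩ := exists_recovery_cylinder hQ hq
    have l3 : Tendsto (fun n => ‖liftMap hQ n (x n) - v‖) atTop (𝓝 ‖q.1 - v‖) :=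
      (hx.sub_const v).norm
    have l4 : Tendsto (fun n => ENNReal.ofReal (c n)) atTop (𝓝 (‖q.2‖ₑ ^ 2)) := by
      rw [enorm_sq_eq]
      exact (ENNReal.continuous_ofReal.tendsto _).comp hc
    filter_upwards [l3.eventually_lt_const hj1, l4.eventually_lt_const hj2] with n a1 a2
    exact ⟨x n, a1, (hle n).trans_lt a2⟩
  refine ⟨u, ?_, ?_⟩
  · rw [tendsto_iff_norm_sub_tendsto_zero, Metric.tendsto_nhds]
    intro ε hε0
    obtain ⟨k, hk⟩ := exists_nat_one_div_lt hε0
    filter_upwards [hu k] with n hn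
    rw [Real.dist_0_eq_abs, abs_of_nonneg (norm_nonneg _)]
    exact hn.1.trans hk
  · have hlim : Tendsto (fun k : ℕ => wassersteinForm Q v + ENNReal.ofReal (1 / (k + 1))) atTop
        (𝓝 (wassersteinForm Q v)) := by
      have h0 := (ENNReal.continuous_ofReal.tendsto 0).comp
        (tendsto_one_div_add_atTop_nhds_zero_nat (𝕜 := ℝ))
      have h1 := h0.const_add (wassersteinForm Q v)
      simpa using h1
    refine ge_of_tendsto' hlim fun k => limsup_le_of_le (by isBoundedDefault) ?_
    filter_upwards [hu k] with n hn using hn.2.le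

theorem moscoII (hβ : 0 < β) (hM : IsMarkovUnique Q) (v : Lp ℝ 2 Q) :
    ∃ u : ∀ n, Lp ℝ 2 (particleMeasure β n),
      Tendsto (fun n => liftMap hQ n (u n)) atTop (𝓝 v) ∧
      Tendsto (fun n => ((n + 1 : ℕ) : ℝ≥0∞) * particleForm β n (u n)) atTop
        (𝓝 (wassersteinForm Q v)) := by
  obtain ⟨u, h1, h2⟩ := exists_recovery hQ v
  refine ⟨u, h1, tendsto_of_le_liminf_of_limsup_le ?_ h2⟩
  exact moscoI hQ hβ hM u v (weaklyConverges_of_tendsto (liftMap hQ) (tendsto_condExp hQ) h1)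

theorem closedForm_zero {H T : Type*} [NormedAddCommGroup H] [NormedAddCommGroup T]
    {S : Set (H × T)} (h : (0, 0) ∈ S) : closedForm S 0 = 0 :=
  le_antisymm ((closedForm_le (subset_closure h)).trans (by simp)) zero_le

theorem wassersteinForm_zero : wassersteinForm Q 0 = 0 := by
  refine closedForm_zero ⟨0, fun _ => 0, fun _ => 0, contDiff_const, HasCompactSupport.zero, ?_, ?_⟩
  · exact Lp.coeFn_zero _ _ _
  · simp only [Finset.univ_eq_empty, Finset.sum_empty]
    exact Lp.coeFn_zero ℝ 2 (Q.prod lebesgueIco)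

theorem particleForm_zero : particleForm β n 0 = 0 := by
  refine closedForm_zero ⟨fun _ => 0, contDiff_const, Lp.coeFn_zero _ _ _, ?_⟩
  filter_upwards [Lp.coeFn_zero (EuclideanSpace ℝ (Fin n)) 2 (particleMeasure β n)] with x hx
  simp only [hx]
  ext i
  simp

/-- The whole domain serves as core. A recovery sequence has finite energy from some n on, and its
earlier members can be replaced by 0. -/
theorem moscoII_core (hβ : 0 < β) (hM : IsMarkovUnique Q) :
    MoscoII' (condExpMap hQ) (fun n u => ((n + 1 : ℕ) : ℝ≥0∞) * particleForm β n u)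
      (wassersteinForm Q) := by
  classical
  refine ⟨{v | wassersteinForm Q v < ⊤}, ⟨fun v hv => hv, fun u hu => ⟨fun _ => u, fun _ => hu,
    tendsto_const_nhds, ?_⟩⟩, fun v hv => ?_⟩
  · simp only [sub_self, wassersteinForm_zero]
    exact tendsto_const_nhds
  · obtain ⟨u, h1, h2⟩ := moscoII hQ hβ hM v
    have hev : ∀ᶠ n in atTop, ((n + 1 : ℕ) : ℝ≥0∞) * particleForm β n (u n) < ⊤ :=
      h2.eventually_lt_const hv
    let u' : ∀ n, Lp ℝ 2 (particleMeasure β n) := fun n =>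
      if ((n + 1 : ℕ) : ℝ≥0∞) * particleForm β n (u n) < ⊤ then u n else 0
    have he : ∀ᶠ n in atTop, u' n = u n := hev.mono fun n hn => if_pos hn
    refine ⟨u', fun n => ?_, stronglyConverges_of_tendsto (liftMap hQ)
      (h1.congr' (he.mono fun n hn => by beta_reduce; rw [hn])),
      h2.congr' (he.mono fun n hn => by beta_reduce; rw [hn])⟩
    by_cases hn : ((n + 1 : ℕ) : ℝ≥0∞) * particleForm β n (u n) < ⊤
    · simpa only [u', if_pos hn] using hn
    · simp only [u', if_neg hn, particleForm_zero, mul_zero]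
      exact ENNReal.zero_lt_top

end Recovery

end

theorem mainTheorem2 (β : ℝ) (hβ : 0 < β) (Q : Measure QuantileFn) (hQ : IsDirichletLaw β Q)
    (hM : IsMarkovUnique Q) :
    HilbertConverges (condExpMap hQ) ∧
    MoscoI (condExpMap hQ) (fun n u => ((n + 1 : ℕ) : ENNReal) * particleForm β n u)
      (wassersteinForm Q) ∧
    MoscoII (condExpMap hQ) (fun n u => ((n + 1 : ℕ) : ENNReal) * particleForm β n u)
      (wassersteinForm Q) ∧
    MoscoII' (condExpMap hQ) (fun n u => ((n + 1 : ℕ) : ENNReal) * particleForm β n u)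
      (wassersteinForm Q) := by
  exact ⟨hilbertConverges_of_tendsto (liftMap hQ) (tendsto_condExp hQ), moscoI hQ hβ hM, fun v => by
    obtain ⟨u, h1, h2⟩ := moscoII hQ hβ hM v
    exact ⟨u, stronglyConverges_of_tendsto (liftMap hQ) h1, h2⟩, moscoII_core hQ hβ hM⟩
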